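/- Write $\zeta_n=e^{2\pi i/n}$, $\tau=x+iy\in\mathbb{H}$, $q=e^{2\pi i\tau}$, and let $K_0(x)=\int_0^\infty e^{-x\cosh u}\,du$ ($x>0$) be the modified Bessel function of the second kind. **Cohen's function.** Let $$\sigma(q)=\sum_{n\ge 0}\frac{q^{n(n+1)/2}}{(1+q)(1+q^2)\cdots(1+q^n)},\qquad \sigma^*(q)=2\sum_{n\ge 1}\frac{(-1)^nq^{n^2}}{(1-q)(1-q^3)\cdots(1-q^{2n-1})},$$ define $T(n)$ for $n\in\mathbb{Z}$, $n\equiv 1\pmod{24}$, by $\sum_{n\equiv 1(24)}T(n)q^{|n|/24}=q^{1/24}\sigma(q)+q^{-1/24}\sigma^*(q)$, put $T(n)=0$ for the other $n$, and set $$\phi_0(\tau)=y^{1/2}\sum_{n\ne 0}T(n)\,e^{2\pi i nx/24}K_0(2\pi|n|y/24).$$ **The indefinite theta functions.** Let $A=\begin{pmatrix}3&0\\0&-2\end{pmatrix}$, $Q(\nu)=\frac12\nu^tA\nu$, $B(\nu,\mu)=\nu^tA\mu$, $c_1=\frac1{\sqrt3}\begin{pmatrix}-2\\3\end{pmatrix}$,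 $c_2=\frac1{\sqrt3}\begin{pmatrix}2\\3\end{pmatrix}$. Let $P\in\mathrm{GL}_2(\mathbb{R})$ satisfy $A=P^t\begin{pmatrix}0&1\\1&0\end{pmatrix}P$, put $c(t)=P^{-1}\begin{pmatrix}e^t\\-e^{-t}\end{pmatrix}$, $c^\perp(t)=P^{-1}\begin{pmatrix}e^t\\e^{-t}\end{pmatrix}$, and suppose $c(t_1)=c_1$, $c(t_2)=c_2$ with $t_1<t_2$; such $P$ exist, and one can take $c(t)=\begin{pmatrix}\sqrt{2/3}\,\sinh t\\ \cosh t\end{pmatrix}$. Write $c_i^\perp=c^\perp(t_i)$. For $a,b\in\mathbb{R}^2$ let $$\widehat\Phi_{a,b}(\tau)=y^{1/2}\sum_{\nu\in a+\mathbb{Z}^2}q^{Q(\nu)}e^{2\pi iB(\nu,b)}\int_{t_1}^{t_2}e^{-\pi yB(\nu,c(t))^2}\,dt,$$ $$\begin{aligned}\Phi_{a,b}(\tau)={}&\operatorname{sgn}(t_2-t_1)\,y^{1/2}\sum_{\nu\in a+\mathbb{Z}^2}\tfrac12\bigl[1-\operatorname{sgn}(B(\nu,c_1)B(\nu,c_2))\bigr]e^{2\pi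 iQ(\nu)x}e^{2\pi iB(\nu,b)}K_0(2\pi Q(\nu)y)\\&+\operatorname{sgn}(t_2-t_1)\,y^{1/2}\sum_{\nu\in a+\mathbb{Z}^2}\tfrac12\bigl[1-\operatorname{sgn}(B(\nu,c_1^\perp)B(\nu,c_2^\perp))\bigr]e^{2\pi iQ(\nu)x}e^{2\pi iB(\nu,b)}K_0(-2\pi Q(\nu)y)\end{aligned}$$ (a term whose bracket vanishes is read as $0$), and with $\mathbf{u}=\begin{pmatrix}1/6\\0\end{pmatrix}$, $\mathbf{w}=\begin{pmatrix}1/6\\1/4\end{pmatrix}$ let $$\widehat\Phi=\bigl(\widehat\Phi_{\mathbf{u},\mathbf{w}},\ \sqrt2\,\widehat\Phi_{\mathbf{w},\mathbf{u}},\ \sqrt2\,\widehat\Phi_{\mathbf{w},\mathbf{w}}\bigr)^t.$$ **Theorem.** The series for $\phi_0$, for $\Phi_{\mathbf{u},\mathbf{w}}$ and for the components of $\widehat\Phi$ converge absolutely on $\mathbb{H}$, and the following hold. 1. $\widehat\Phi(\tau+1)=\begin{pmatrix}\zeta_{24}&0&0\\0&0&\zeta_{48}^5\\0&\zeta_{48}^{-7}&0\end{pmatrix}\widehat\Phi(\tau)$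 and $\widehat\Phi(-1/\tau)=\begin{pmatrix}0&1&0\\1&0&0\\0&0&1\end{pmatrix}\widehat\Phi(\tau)$. Moreover, there is a representation $\rho$ of $\mathrm{SL}_2(\mathbb{Z})$ on $\mathbb{C}^3$, taking these two values at $\begin{pmatrix}1&1\\0&1\end{pmatrix}$ and $\begin{pmatrix}0&-1\\1&0\end{pmatrix}$, with $\widehat\Phi(\gamma\tau)=\rho(\gamma)\widehat\Phi(\tau)$ for all $\gamma\in\mathrm{SL}_2(\mathbb{Z})$. 2. There is exactly one character $v:\Gamma_0(2)\to\mathbb{C}^\times$ with $v\begin{pmatrix}1&1\\0&1\end{pmatrix}=v\begin{pmatrix}1&0\\2&1\end{pmatrix}=\zeta_{24}$; it satisfies $|v|=1$, and $\widehat\Phi_{\mathbf{u},\mathbf{w}}(\gamma\tau)=v(\gamma)\,\widehat\Phi_{\mathbf{u},\mathbf{w}}(\tau)$ for all $\gamma\in\Gamma_0(2)$. 3. $\widehat\Phi_{\mathbf{u},\mathbf{w}}=\Phi_{\mathbf{u},\mathbf{w}}=\zeta_{12}\,\phi_0$. 4. $\phi_0$ is a Maass waveform of weight $0$ on $\Gamma_0(2)$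 with multiplier system $v$ and eigenvalue $\frac14$: it is smooth, $-y^2\bigl(\frac{\partial^2}{\partial x^2}+\frac{\partial^2}{\partial y^2}\bigr)\phi_0=\frac14\phi_0$, $\phi_0(\gamma\tau)=v(\gamma)\phi_0(\tau)$ for all $\gamma\in\Gamma_0(2)$, and $\phi_0$ has at most polynomial growth at every cusp. -/

import Mathlib

noncomputable section

namespace CohenMaass

open Matrix UpperHalfPlane MeasureTheory

/-- The root of unity `ζ_n = e^{2πi/n}`. -/
def zeta (n : ℕ) : ℂ := Complex.exp (2 * Real.pi * Complex.I / n)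

/-- `e(w) = e^{2πiw}`. -/
def e (w : ℂ) : ℂ := Complex.exp (2 * Real.pi * Complex.I * w)

/-- The modified Bessel function of the second kind of order zero,
`K₀(x) = ∫₀^∞ e^{-x cosh u} du`, for `x > 0`. -/
def besselK0 (x : ℝ) : ℝ := ∫ u in Set.Ioi (0 : ℝ), Real.exp (-x * Real.cosh u)

section IndefiniteTheta

/-- The quadratic form `Q(ν) = ½ νᵗ A ν`. -/
def quadForm (A : Matrix (Fin 2) (Fin 2) ℝ) (ν : Fin 2 → ℝ) : ℝ := (ν ⬝ᵥ (A *ᵥ ν)) / 2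

/-- The bilinear form `B(ν, μ) = νᵗ A μ`. -/
def bilForm (A : Matrix (Fin 2) (Fin 2) ℝ) (ν μ : Fin 2 → ℝ) : ℝ := ν ⬝ᵥ (A *ᵥ μ)

/-- `c(t) = P⁻¹ (e^t, -e^{-t})ᵗ`. -/
def cvec (P : Matrix (Fin 2) (Fin 2) ℝ) (t : ℝ) : Fin 2 → ℝ :=
  P⁻¹ *ᵥ ![Real.exp t, -Real.exp (-t)]

/-- `c^⊥(t) = P⁻¹ (e^t, e^{-t})ᵗ`. -/
def cperp (P : Matrix (Fin 2) (Fin 2) ℝ) (t : ℝ) : Fin 2 → ℝ :=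
  P⁻¹ *ᵥ ![Real.exp t, Real.exp (-t)]

/-- The point `a + n` of the shifted lattice `a + ℤ²`. -/
def latticePt (a : Fin 2 → ℝ) (n : Fin 2 → ℤ) : Fin 2 → ℝ := fun i => a i + (n i : ℝ)

/-- The summand at `ν` of the first sum in `Φ_{a,b}^{c₁,c₂}`, where `c_i = c(t_i)`. -/
def PhiTerm₁ (A P : Matrix (Fin 2) (Fin 2) ℝ) (t₁ t₂ : ℝ) (b : Fin 2 → ℝ) (τ : ℍ)
    (ν : Fin 2 → ℝ) : ℂ :=
  ((1 / 2 * (1 - Real.sign (bilForm A ν (cvec P t₁) * bilForm A ν (cvec P t₂))) : ℝ) : ℂ)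
    * e (quadForm A ν * τ.re) * e (bilForm A ν b)
    * (besselK0 (2 * Real.pi * quadForm A ν * τ.im) : ℂ)

/-- The summand at `ν` of the second sum in `Φ_{a,b}^{c₁,c₂}`. -/
def PhiTerm₂ (A P : Matrix (Fin 2) (Fin 2) ℝ) (t₁ t₂ : ℝ) (b : Fin 2 → ℝ) (τ : ℍ)
    (ν : Fin 2 → ℝ) : ℂ :=
  ((1 / 2 * (1 - Real.sign (bilForm A ν (cperp P t₁) * bilForm A ν (cperp P t₂))) : ℝ) : ℂ)
    * e (quadForm A ν * τ.re) * e (bilForm A ν b)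
    * (besselK0 (-(2 * Real.pi * quadForm A ν * τ.im)) : ℂ)

/-- The function `Φ_{a,b}^{c₁,c₂}` with `c₁ = c(t₁)`, `c₂ = c(t₂)`. -/
def Phi (A P : Matrix (Fin 2) (Fin 2) ℝ) (t₁ t₂ : ℝ) (a b : Fin 2 → ℝ) (τ : ℍ) : ℂ :=
  (Real.sign (t₂ - t₁) : ℂ) * (Real.sqrt τ.im : ℂ) *
      (∑' n : Fin 2 → ℤ, PhiTerm₁ A P t₁ t₂ b τ (latticePt a n))
    + (Real.sign (t₂ - t₁) : ℂ) * (Real.sqrt τ.im : ℂ) *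
      (∑' n : Fin 2 → ℤ, PhiTerm₂ A P t₁ t₂ b τ (latticePt a n))

/-- The summand at `ν` in `Φ̂_{a,b}^{c₁,c₂}`. -/
def PhiHatTerm (A P : Matrix (Fin 2) (Fin 2) ℝ) (t₁ t₂ : ℝ) (b : Fin 2 → ℝ) (τ : ℍ)
    (ν : Fin 2 → ℝ) : ℂ :=
  e (quadForm A ν * (τ : ℂ)) * e (bilForm A ν b)
    * ((∫ t in t₁..t₂, Real.exp (-Real.pi * τ.im * bilForm A ν (cvec P t) ^ 2) : ℝ) : ℂ)

/-- The function `Φ̂_{a,b}^{c₁,c₂}` with `c₁ = c(t₁)`, `c₂ = c(t₂)`. -/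
def PhiHat (A P : Matrix (Fin 2) (Fin 2) ℝ) (t₁ t₂ : ℝ) (a b : Fin 2 → ℝ) (τ : ℍ) : ℂ :=
  (Real.sqrt τ.im : ℂ) * ∑' n : Fin 2 → ℤ, PhiHatTerm A P t₁ t₂ b τ (latticePt a n)

end IndefiniteTheta

section Example

/-- The matrix `A = diag(3, -2)`. -/
def exA : Matrix (Fin 2) (Fin 2) ℝ := !![3, 0; 0, -2]

def exc₁ : Fin 2 → ℝ := (1 / Real.sqrt 3) • ![-2, 3]

def exc₂ : Fin 2 → ℝ := (1 / Real.sqrt 3) • ![2, 3]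

/-- The vector `(1/6, 0)`. -/
def vec₀ : Fin 2 → ℝ := ![1 / 6, 0]

/-- The vector `(1/6, 1/4)`. -/
def vec₁ : Fin 2 → ℝ := ![1 / 6, 1 / 4]

/-- `P` splits `Q`, i.e. `A = Pᵗ (0 1; 1 0) P`, and `c₁ = c(t₁)`, `c₂ = c(t₂)` for the
parametrization `c` attached to `P`. The latter forces `P⁻¹ (1, -1)ᵗ` to lie in the component of
`{Q = -1}` that contains `c₁` and `c₂`. As `P` is only determined up to left multiplication by
`diag(e^r, e^{-r})` and by the reversal of the parameter `t ↦ -t`, the orientation is fixed by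
`t₁ < t₂`. -/
structure IsSplitting (P : Matrix (Fin 2) (Fin 2) ℝ) (t₁ t₂ : ℝ) : Prop where
  split : exA = Pᵀ * !![0, 1; 1, 0] * P
  left : cvec P t₁ = exc₁
  right : cvec P t₂ = exc₂
  lt : t₁ < t₂

/-- The vector-valued function with the three components
`Φ̂_{(1/6,0),(1/6,1/4)}`, `√2 Φ̂_{(1/6,1/4),(1/6,0)}`, `√2 Φ̂_{(1/6,1/4),(1/6,1/4)}`. -/
def PhiHatVec (P : Matrix (Fin 2) (Fin 2) ℝ) (t₁ t₂ : ℝ) (τ : ℍ) : Fin 3 → ℂ :=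
  ![PhiHat exA P t₁ t₂ vec₀ vec₁ τ,
    (Real.sqrt 2 : ℂ) * PhiHat exA P t₁ t₂ vec₁ vec₀ τ,
    (Real.sqrt 2 : ℂ) * PhiHat exA P t₁ t₂ vec₁ vec₁ τ]

/-- The matrix of `τ ↦ τ + 1`. -/
def matT : Matrix (Fin 3) (Fin 3) ℂ :=
  !![zeta 24, 0, 0; 0, 0, zeta 48 ^ 5; 0, zeta 48 ^ (-7 : ℤ), 0]

/-- The matrix of `τ ↦ -1/τ`. -/
def matS : Matrix (Fin 3) (Fin 3) ℂ := !![0, 1, 0; 1, 0, 0; 0, 0, 1]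

end Example

section Cohen

open PowerSeries

/-- `q^{n(n+1)/2} / ((1+q)(1+q²)⋯(1+qⁿ))` as a formal power series in `q`. -/
def sigmaTerm (n : ℕ) : PowerSeries ℂ :=
  X ^ (n * (n + 1) / 2) * (∏ k ∈ Finset.Icc 1 n, (1 + X ^ k))⁻¹

/-- `2 (-1)ⁿ q^{n²} / ((1-q)(1-q³)⋯(1-q^{2n-1}))` as a formal power series in `q`. -/
def sigmaStarTerm (n : ℕ) : PowerSeries ℂ :=
  2 * (-1) ^ n * X ^ (n ^ 2) * (∏ k ∈ Finset.Icc 1 n, (1 - X ^ (2 * k - 1)))⁻¹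

/-- The terms with `n > m` do not contribute to the coefficient of `q^m` in `σ`. -/
theorem coeff_sigmaTerm_of_lt {m n : ℕ} (h : m < n) : coeff m (sigmaTerm n) = 0 := by
  have h2 : n ≤ n * (n + 1) / 2 := by
    rw [Nat.le_div_iff_mul_le (by norm_num)]
    nlinarith
  rw [sigmaTerm, coeff_X_pow_mul', if_neg (by omega)]

/-- The terms with `n > m` do not contribute to the coefficient of `q^m` in `σ*`. -/
theorem coeff_sigmaStarTerm_of_lt {m n : ℕ} (h : m < n) : coeff m (sigmaStarTerm n) = 0 := by
  have h2 : n ≤ n ^ 2 := Nat.le_self_pow (by norm_num) n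
  have h3 : sigmaStarTerm n = X ^ (n ^ 2) *
      (2 * (-1) ^ n * (∏ k ∈ Finset.Icc 1 n, (1 - X ^ (2 * k - 1)))⁻¹) := by
    rw [sigmaStarTerm]; ring
  rw [h3, coeff_X_pow_mul', if_neg (by omega)]

/-- `σ(q) = ∑_{n ≥ 0} q^{n(n+1)/2} / ((1+q)⋯(1+qⁿ))`, as a formal power series. -/
def sigma : PowerSeries ℂ :=
  PowerSeries.mk fun m => ∑ n ∈ Finset.range (m + 1), coeff m (sigmaTerm n)

/-- `σ*(q) = 2 ∑_{n ≥ 1} (-1)ⁿ q^{n²} / ((1-q)(1-q³)⋯(1-q^{2n-1}))`, as a formal power series. -/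
def sigmaStar : PowerSeries ℂ :=
  PowerSeries.mk fun m => ∑ n ∈ Finset.Icc 1 m, coeff m (sigmaStarTerm n)

/-- Cohen's coefficients, `∑_{n ≡ 1 (24)} T(n) q^{|n|/24} = q^{1/24} σ(q) + q^{-1/24} σ*(q)`.
For `n = 24 k + 1` the exponent `|n|/24` is `k + 1/24` if `k ≥ 0`, and `-k - 1/24` if `k < 0`; so
`T(n)` is the coefficient of `q^k` in `σ`, respectively that of `q^{-k}` in `σ*`. -/
def cohenT (n : ℤ) : ℂ :=
  if n % 24 = 1 then
    if 0 < n then coeff (n / 24).toNat sigma else coeff (-(n / 24)).toNat sigmaStar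
  else 0

/-- The summand of Cohen's function. -/
def phi₀Term (τ : ℍ) (n : {n : ℤ // n ≠ 0}) : ℂ :=
  cohenT n * e (n * τ.re / 24) * (besselK0 (2 * Real.pi * |((n : ℤ) : ℝ)| * τ.im / 24) : ℂ)

/-- Cohen's function `φ₀(τ) = y^{1/2} ∑_{n ≠ 0} T(n) e^{2πinx/24} K₀(2π|n|y/24)`. -/
def phi₀ (τ : ℍ) : ℂ := (Real.sqrt τ.im : ℂ) * ∑' n : {n : ℤ // n ≠ 0}, phi₀Term τ n

end Cohen

section Maass

open scoped ContDiff MatrixGroups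

/-- `f` is a Maass waveform (Maass form of weight `0`) on the subgroup `Γ` of `SL₂(ℤ)` with
multiplier system `v` and eigenvalue `lam`: it is smooth, an eigenfunction of
`Δ₀ = -y² (∂²/∂x² + ∂²/∂y²)`, transforms under `Γ` by `v`, and has at most polynomial growth at
all cusps. -/
structure IsMaassForm (Γ : Subgroup SL(2, ℤ)) (v : Γ →* ℂˣ) (lam : ℂ) (f : ℍ → ℂ) : Prop where
  smooth : ContDiffOn ℝ ∞ (fun z : ℂ => f (ofComplex z)) {z : ℂ | 0 < z.im}
  eigen : ∀ τ : ℍ,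
    -((τ.im : ℂ) ^ 2) * Laplacian.laplacian (fun z : ℂ => f (ofComplex z)) (τ : ℂ) = lam * f τ
  transform : ∀ (γ : Γ) (τ : ℍ), f ((γ : SL(2, ℤ)) • τ) = (v γ : ℂ) * f τ
  growth : ∀ γ : SL(2, ℤ), ∃ N : ℕ,
    (fun τ : ℍ => f (γ • τ)) =O[atImInfty] fun τ : ℍ => τ.im ^ N

/-- The matrix `(1 1; 0 1)` in `SL₂(ℤ)`. -/
def slT : SL(2, ℤ) := ⟨!![1, 1; 0, 1], by simp [Matrix.det_fin_two]⟩

/-- The matrix `(1 0; 2 1)` in `SL₂(ℤ)`. -/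
def slU : SL(2, ℤ) := ⟨!![1, 0; 2, 1], by simp [Matrix.det_fin_two]⟩

/-- The matrix `(1 1; 0 1)` as an element of `Γ₀(2)`. -/
def genT : CongruenceSubgroup.Gamma0 2 :=
  ⟨slT, by rw [CongruenceSubgroup.Gamma0_mem]; simp [slT]⟩

/-- The matrix `(1 0; 2 1)` as an element of `Γ₀(2)`. -/
def genU : CongruenceSubgroup.Gamma0 2 :=
  ⟨slU, by rw [CongruenceSubgroup.Gamma0_mem]; simp [slU]; rfl⟩

end Maass

end CohenMaass

end

noncomputable section
namespace CohenMaass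
open Matrix UpperHalfPlane MeasureTheory

section QSeries

open PowerSeries Finset

theorem le_triangle (n : ℕ) : n ≤ n * (n + 1) / 2 := by
  rw [Nat.le_div_iff_mul_le two_pos]
  rcases n with _ | n <;> nlinarith

theorem triangle_succ (n : ℕ) : (n + 1) * (n + 1 + 1) / 2 = n * (n + 1) / 2 + (n + 1) := by
  rw [show (n + 1) * (n + 1 + 1) = n * (n + 1) + (n + 1) * 2 by ring,
    Nat.add_mul_div_right _ _ two_pos]

/-- The `q`-factorial `(1-q)(1-q²)⋯(1-qⁿ)`. -/
def qfac (q : PowerSeries ℂ) (n : ℕ) : PowerSeries ℂ := ∏ i ∈ range n, (1 - q ^ (i + 1))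

/-- The inverse of the `q`-factorial. -/
def qinv (q : PowerSeries ℂ) (n : ℕ) : PowerSeries ℂ := (qfac q n)⁻¹

variable {q : PowerSeries ℂ}

theorem qfac_zero : qfac q 0 = 1 := by simp [qfac]

theorem qfac_succ (n : ℕ) : qfac q (n + 1) = qfac q n * (1 - q ^ (n + 1)) := by
  simp [qfac, prod_range_succ]

theorem constantCoeff_qfac (hq : constantCoeff q = 0) (n : ℕ) : constantCoeff (qfac q n) = 1 := by
  simp [qfac, map_prod, hq]

theorem qfac_mul_qinv (hq : constantCoeff q = 0) (n : ℕ) : qfac q n * qinv q n = 1 :=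
  PowerSeries.mul_inv_cancel _ (by simp [constantCoeff_qfac hq])

theorem qinv_zero : qinv q 0 = 1 := by
  rw [qinv, qfac_zero, PowerSeries.inv_eq_iff_mul_eq_one (by simp)]; simp

theorem qinv_succ (hq : constantCoeff q = 0) (n : ℕ) :
    (1 - q ^ (n + 1)) * qinv q (n + 1) = qinv q n := by
  have h1 := qfac_mul_qinv hq n
  have h2 := qfac_mul_qinv hq (n + 1)
  rw [qfac_succ] at h2
  linear_combination (qinv q n) * h2 - (1 - q ^ (n + 1)) * qinv q (n + 1) * h1

/-- The normalized Rogers–Szegő polynomial `∑ xⁱ / ((q)ᵢ (q)ⱼ)` over `i + j = M`. -/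
def rogersSzego (q x : PowerSeries ℂ) (M : ℕ) : PowerSeries ℂ :=
  ∑ p ∈ antidiagonal M, x ^ p.1 * qinv q p.1 * qinv q p.2

theorem sum_antidiagonal_one_sub_pow_fst (hq : constantCoeff q = 0) (x : PowerSeries ℂ) (M : ℕ) :
    ∑ p ∈ antidiagonal (M + 1), x ^ p.1 * ((1 - q ^ p.1) * qinv q p.1) * qinv q p.2
      = x * rogersSzego q x M := by
  rw [Nat.sum_antidiagonal_succ]
  simp only [pow_zero, sub_self, zero_mul, mul_zero, zero_add, qinv_succ hq]
  rw [rogersSzego, mul_sum]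
  exact sum_congr rfl fun p _ => by ring

theorem sum_antidiagonal_one_sub_pow_snd (hq : constantCoeff q = 0) (x : PowerSeries ℂ) (M : ℕ) :
    ∑ p ∈ antidiagonal (M + 1), x ^ p.1 * qinv q p.1 * ((1 - q ^ p.2) * qinv q p.2)
      = rogersSzego q x M := by
  rw [Nat.sum_antidiagonal_succ']
  simp only [pow_zero, sub_self, zero_mul, mul_zero, zero_add, qinv_succ hq]
  rfl

theorem rogersSzego_succ_succ (hq : constantCoeff q = 0) (x : PowerSeries ℂ) (M : ℕ) :
    (1 - q ^ (M + 2)) * rogersSzego q x (M + 2)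
      = (1 + x) * rogersSzego q x (M + 1) - x * rogersSzego q x M := by
  have h1 : (1 - q ^ (M + 2)) * rogersSzego q x (M + 2) = x * rogersSzego q x (M + 1)
      + rogersSzego q (x * q) (M + 1) := by
    rw [← sum_antidiagonal_one_sub_pow_fst hq, ← sum_antidiagonal_one_sub_pow_snd hq (x * q),
      rogersSzego, mul_sum, ← sum_add_distrib]
    refine sum_congr rfl fun p hp => ?_
    rw [← (mem_antidiagonal.1 hp), pow_add, mul_pow]
    ring
  have h2 : rogersSzego q (x * q) (M + 1) = rogersSzego q x (M + 1) - x * rogersSzego q x M := by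
    rw [← sum_antidiagonal_one_sub_pow_fst hq, rogersSzego, rogersSzego, ← sum_sub_distrib]
    refine sum_congr rfl fun p hp => ?_
    rw [mul_pow]
    ring
  rw [h1, h2]
  ring

theorem one_sub_pow_ne_zero (hq : constantCoeff q = 0) {n : ℕ} (hn : n ≠ 0) :
    (1 - q ^ n : PowerSeries ℂ) ≠ 0 := by
  intro h
  have := congrArg constantCoeff h
  simp [hq, hn] at this

theorem rogersSzego_zero (x : PowerSeries ℂ) : rogersSzego q x 0 = 1 := by
  simp [rogersSzego, qinv_zero]

theorem rogersSzego_one (hq : constantCoeff q = 0) (x : PowerSeries ℂ) :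
    (1 - q) * rogersSzego q x 1 = 1 + x := by
  have := qinv_succ hq 0
  simp [qinv_zero] at this
  simp [rogersSzego, qinv_zero, Nat.antidiagonal_succ]
  linear_combination (1 + x) * this

theorem rogersSzego_neg_one (hq : constantCoeff q = 0) (n : ℕ) :
    rogersSzego q (-1) (2 * n) = qinv (q ^ 2) n := by
  have hq2 : constantCoeff (q ^ 2) = 0 := by simp [hq]
  induction n with
  | zero => simp [rogersSzego_zero, qinv_zero]
  | succ n ih =>
    have h1 := rogersSzego_succ_succ hq (-1) (2 * n)
    have h2 := qinv_succ hq2 n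
    rw [ih, ← h2] at h1
    apply mul_left_cancel₀ (one_sub_pow_ne_zero hq (show 2 * n + 2 ≠ 0 by omega))
    rw [show 2 * (n + 1) = 2 * n + 2 by ring, h1, ← pow_mul]
    ring_nf

theorem rogersSzego_sq (hq : constantCoeff q = 0) (M : ℕ) :
    rogersSzego (q ^ 2) q M = qinv q M ∧ rogersSzego (q ^ 2) q (M + 1) = qinv q (M + 1) := by
  have hq2 : constantCoeff (q ^ 2) = 0 := by simp [hq]
  induction M with
  | zero =>
    refine ⟨by simp [rogersSzego_zero, qinv_zero], ?_⟩
    have h1 := rogersSzego_one hq2 q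
    have h2 := qinv_succ hq 0
    rw [qinv_zero] at h2
    apply mul_left_cancel₀ (one_sub_pow_ne_zero hq (two_ne_zero))
    simp only [zero_add, pow_one] at h1 h2 ⊢
    linear_combination h1 - (1 + q) * h2
  | succ M ih =>
    refine ⟨ih.2, ?_⟩
    have h1 := rogersSzego_succ_succ hq2 q M
    have h2 := qinv_succ hq M
    have h3 := qinv_succ hq (M + 1)
    rw [ih.1, ih.2] at h1
    apply mul_left_cancel₀ (one_sub_pow_ne_zero hq2 (show M + 2 ≠ 0 by omega))
    rw [show M + 1 + 1 = M + 2 by ring] at h3 ⊢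
    rw [h1, ← h2]
    rw [show (q ^ 2) ^ (M + 2) = q ^ (M + 2) * q ^ (M + 2) by ring]
    linear_combination -(1 + q ^ (M + 2)) * h3

theorem pow_dvd_sum_sub_base (hq : constantCoeff q = 0) (s M : ℕ) :
    q ^ M ∣ ∑ m ∈ range M, (-1) ^ m * q ^ (m * (m + 1) / 2 + s * m) * qinv q (s + 1 + m)
      - qinv q s := by
  have h : ∀ M, ∑ m ∈ range M, (-1) ^ m * q ^ (m * (m + 1) / 2 + s * m) * qinv q (s + 1 + m)
      = qinv q s - (-1) ^ M * q ^ (M * (M + 1) / 2 + s * M) * qinv q (s + M) := by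
    intro M
    induction M with
    | zero => simp
    | succ M ih =>
      rw [sum_range_succ, ih]
      have h1 := qinv_succ hq (s + M)
      rw [triangle_succ, ← h1, show s + 1 + M = s + M + 1 by ring, show s + (M + 1) = s + M + 1 by ring]
      ring
  rw [h, sub_sub_cancel_left]
  refine Dvd.dvd.neg_right ?_
  refine Dvd.dvd.mul_right (Dvd.dvd.mul_left (pow_dvd_pow _ ?_) _) _
  have := le_triangle M
  omega

theorem pow_dvd_sum_sub (hq : constantCoeff q = 0) (k s M : ℕ) :
    q ^ M ∣ ∑ m ∈ range M, (-1) ^ m * q ^ (m * (m + 1) / 2 + s * m) * qfac q (k + m) * qinv q m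
      * qinv q (k + s + 1 + m) - qfac q k * qinv q s := by
  induction k with
  | zero =>
    convert pow_dvd_sum_sub_base hq s M using 2
    · refine sum_congr rfl fun m _ => ?_
      have := qfac_mul_qinv hq m
      simp only [zero_add]
      linear_combination ((-1) ^ m * q ^ (m * (m + 1) / 2 + s * m) * qinv q (s + 1 + m)) * this
    · simp [qfac_zero]
  | succ k ih =>
    have h : ∀ M, ∑ m ∈ range M, ((-1) ^ m * q ^ (m * (m + 1) / 2 + s * m) * qfac q (k + 1 + m)
        * qinv q m * qinv q (k + 1 + s + 1 + m)
        - (1 - q ^ (k + 1)) * ((-1) ^ m * q ^ (m * (m + 1) / 2 + s * m) * qfac q (k + m) * qinv q m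
      * qinv q (k + s + 1 + m))) = - (q ^ (k + 1) * ((-1) ^ M * q ^ (M * (M + 1) / 2 + s * M) *
        qfac q (k + M) * (1 - q ^ M) * qinv q M * qinv q (k + s + 1 + M))) := by
      intro M
      induction M with
      | zero => simp
      | succ M ih =>
        rw [sum_range_succ, ih]
        have h1 := qinv_succ hq (k + s + 1 + M)
        have h3 := qinv_succ hq M
        have h4 := qfac_succ (q := q) (k + M)
        rw [triangle_succ, ← h1, ← h3, show k + 1 + s + 1 + M = k + s + 1 + M + 1 by ring,
          show k + s + 1 + (M + 1) = k + s + 1 + M + 1 by ring,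
          show k + (M + 1) = k + M + 1 by ring, show k + 1 + M = k + M + 1 by ring, h4]
        ring
    have h5 := h M
    rw [sum_sub_distrib, ← mul_sum] at h5
    rw [sub_eq_iff_eq_add.1 h5, qfac_succ]
    obtain ⟨c, hc⟩ := ih
    have h6 : q ^ M ∣ q ^ (M * (M + 1) / 2 + s * M) := by
      refine pow_dvd_pow _ ?_
      have := le_triangle M
      omega
    obtain ⟨d, hd⟩ := h6
    rw [sub_eq_iff_eq_add.1 hc, hd]
    refine ⟨- (q ^ (k + 1) * ((-1) ^ M * d *
        qfac q (k + M) * (1 - q ^ M) * qinv q M * qinv q (k + s + 1 + M)))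
        + (1 - q ^ (k + 1)) * c, by ring⟩

end QSeries
end CohenMaass
end

noncomputable section
namespace CohenMaass
open Matrix UpperHalfPlane MeasureTheory

section QSeries

open PowerSeries Finset

variable {q : PowerSeries ℂ}

theorem sum_range_two_mul_add_one_fold {M : Type*} [AddCommMonoid M] (f : ℕ → M) (n : ℕ) :
    ∑ k ∈ range (2 * n + 1), f k = f n + ∑ r ∈ range n, (f (n - (r + 1)) + f (n + (r + 1))) := by
  rw [show 2 * n + 1 = n + (n + 1) by ring, sum_range_add, sum_range_succ', sum_add_distrib,
    ← sum_range_reflect]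
  simp only [add_zero, Nat.sub_sub, add_comm 1]
  abel

theorem sum_range_two_mul_fold {M : Type*} [AddCommMonoid M] (f : ℕ → M) (n : ℕ) :
    ∑ k ∈ range (2 * n), f k = ∑ r ∈ range n, (f (n - (r + 1)) + f (n + r)) := by
  rw [two_mul, sum_range_add, sum_add_distrib, ← sum_range_reflect]
  simp only [Nat.sub_sub, add_comm 1]

/-- The polynomial `∑_{|j| ≤ r} (-1)ʲ q^{r² - j²}`. -/
def thetaPoly (q : PowerSeries ℂ) (r : ℕ) : PowerSeries ℂ :=
  ∑ j ∈ Icc (-(r : ℤ)) r, (((-1 : ℤˣ) ^ j : ℤˣ) : PowerSeries ℂ) * q ^ (r ^ 2 - j.natAbs ^ 2)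

theorem thetaPoly_zero : thetaPoly q 0 = 1 := by simp [thetaPoly]

theorem thetaPoly_succ (r : ℕ) :
    thetaPoly q (r + 1) = q ^ (2 * r + 1) * thetaPoly q r + 2 * (-1) ^ (r + 1) := by
  have h : Icc (-((r + 1 : ℕ) : ℤ)) (r + 1 : ℕ)
      = insert (-((r : ℤ) + 1)) (insert ((r : ℤ) + 1) (Icc (-(r : ℤ)) r)) := by
    ext j; simp only [mem_Icc, mem_insert]; push_cast; omega
  rw [thetaPoly, h, sum_insert, sum_insert, thetaPoly, mul_sum]
  · have e1 : ((r : ℤ) + 1).natAbs = r + 1 := by omega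
    have e2 : (-((r : ℤ) + 1)).natAbs = r + 1 := by omega
    have e3 : (((-1 : ℤˣ) ^ ((r : ℤ) + 1) : ℤˣ) : PowerSeries ℂ) = (-1) ^ (r + 1) := by
      rw [show (r : ℤ) + 1 = ((r + 1 : ℕ) : ℤ) by push_cast; ring, zpow_natCast]; simp
    rw [e1, e2, _root_.zpow_neg, Int.units_inv_eq_self, e3, Nat.sub_self]
    have : ∀ j ∈ Icc (-(r : ℤ)) r, (((-1 : ℤˣ) ^ j : ℤˣ) : PowerSeries ℂ)
          * q ^ ((r + 1) ^ 2 - j.natAbs ^ 2) = q ^ (2 * r + 1) *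
          ((((-1 : ℤˣ) ^ j : ℤˣ) : PowerSeries ℂ) * q ^ (r ^ 2 - j.natAbs ^ 2)) := by
      intro j hj
      rw [mem_Icc] at hj
      have h1 : j.natAbs ^ 2 ≤ r ^ 2 := Nat.pow_le_pow_left (by omega) 2
      rw [show (r + 1) ^ 2 - j.natAbs ^ 2 = 2 * r + 1 + (r ^ 2 - j.natAbs ^ 2) by
        have : (r + 1) ^ 2 = r ^ 2 + 2 * r + 1 := by ring
        omega, pow_add]
      ring
    rw [sum_congr rfl this]
    ring
  · simp
  · simp only [mem_insert, mem_Icc]; omega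

theorem sum_thetaPoly (hq : constantCoeff q = 0) (n : ℕ) :
    ∑ r ∈ range (n + 1), thetaPoly q r * (1 - q ^ (2 * r + 1)) * qinv q (n - r) * qinv q (n + r + 1)
      = (-1) ^ n * qinv (q ^ 2) n := by
  have key : ∀ R ≤ n, ∑ r ∈ range R,
      thetaPoly q r * (1 - q ^ (2 * r + 1)) * qinv q (n - r) * qinv q (n + r + 1)
      + thetaPoly q R * qinv q (n - R) * qinv q (n + R)
      = qinv q n * qinv q n + ∑ r ∈ range R, 2 * (-1) ^ (r + 1) * qinv q (n - (r + 1))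
          * qinv q (n + (r + 1)) := by
    intro R hR
    induction R with
    | zero => simp [thetaPoly_zero]
    | succ R ih =>
      rw [sum_range_succ, sum_range_succ, ← add_assoc (qinv q n * qinv q n), ← ih (by omega),
        thetaPoly_succ]
      have h1 := qinv_succ hq (n - (R + 1))
      have h2 := qinv_succ hq (n + R)
      rw [show n - (R + 1) + 1 = n - R by omega] at h1
      rw [show n + (R + 1) = n + R + 1 by ring, ← h1, ← h2]
      have h3 : q ^ (n + R + 1) = q ^ (n - R) * q ^ (2 * R + 1) := by
        rw [← pow_add]; congr 1; omega
      rw [h3]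
      ring
  have h4 := key n le_rfl
  have h5 := qinv_succ hq (n + n)
  rw [sum_range_succ, Nat.sub_self, qinv_zero]
  rw [Nat.sub_self, qinv_zero, ← h5] at h4
  have h6 := rogersSzego_neg_one hq n
  rw [rogersSzego, Nat.sum_antidiagonal_eq_sum_range_succ_mk, sum_range_two_mul_add_one_fold] at h6
  have h7 : (-1 : PowerSeries ℂ) ^ n * (-1) ^ n = 1 := by rw [← mul_pow]; simp
  rw [← h6, mul_add, mul_sum]
  rw [show n + n + 1 = 2 * n + 1 by ring] at *
  have h8 : ∀ r ∈ range n, (-1 : PowerSeries ℂ) ^ n * ((-1) ^ (n - (r + 1)) * qinv q (n - (r + 1))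
      * qinv q (2 * n - (n - (r + 1))) + (-1) ^ (n + (r + 1)) * qinv q (n + (r + 1)) *
      qinv q (2 * n - (n + (r + 1)))) = 2 * (-1) ^ (r + 1) * qinv q (n - (r + 1))
          * qinv q (n + (r + 1)) := by
    intro r hr
    rw [mem_range] at hr
    rw [show 2 * n - (n - (r + 1)) = n + (r + 1) by omega,
      show 2 * n - (n + (r + 1)) = n - (r + 1) by omega]
    have e1 : (-1 : PowerSeries ℂ) ^ n * (-1) ^ (n - (r + 1)) = (-1) ^ (r + 1) := by
      rw [← pow_add, show n + (n - (r + 1)) = 2 * (n - (r + 1)) + (r + 1) by omega, pow_add,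
        pow_mul]
      simp
    have e2 : (-1 : PowerSeries ℂ) ^ n * (-1) ^ (n + (r + 1)) = (-1) ^ (r + 1) := by
      rw [pow_add, ← mul_assoc, h7, one_mul]
    linear_combination (qinv q (n - (r + 1)) * qinv q (n + (r + 1))) * (e1 + e2)
  rw [sum_congr rfl h8, show 2 * n - n = n by omega]
  linear_combination h4 - qinv q n * qinv q n * h7


theorem prod_one_add_mul_qfac (n : ℕ) :
    (∏ k ∈ Icc 1 n, (1 + q ^ k)) * qfac q n = qfac (q ^ 2) n := by
  induction n with
  | zero => simp [qfac_zero]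
  | succ n ih =>
    rw [prod_Icc_succ_top (by omega), qfac_succ, qfac_succ, ← ih, ← pow_mul]
    ring

theorem constantCoeff_prod_one_add (n : ℕ) :
    constantCoeff (∏ k ∈ Icc 1 n, (1 + X ^ k : PowerSeries ℂ)) ≠ 0 := by
  rw [map_prod, prod_ne_zero_iff]
  intro k hk
  rw [mem_Icc] at hk
  simp [show k ≠ 0 by omega]

theorem sigmaTerm_eq (n : ℕ) : sigmaTerm n = ∑ r ∈ range (n + 1),
    thetaPoly X r * (1 - X ^ (2 * r + 1)) * ((-1) ^ n * X ^ (n * (n + 1) / 2) *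
      qfac X n * qinv X (n - r) * qinv X (n + r + 1)) := by
  have hq : constantCoeff (X : PowerSeries ℂ) = 0 := by simp
  have hq2 : constantCoeff (X ^ 2 : PowerSeries ℂ) = 0 := by simp
  have h1 : (∏ k ∈ Icc 1 n, (1 + X ^ k : PowerSeries ℂ))⁻¹ = qfac X n * qinv (X ^ 2) n := by
    rw [PowerSeries.inv_eq_iff_mul_eq_one (constantCoeff_prod_one_add n)]
    have := prod_one_add_mul_qfac (q := X) n
    have h2 := qfac_mul_qinv hq2 n
    linear_combination h2 + qinv (X ^ 2) n * this
  have h3 := sum_thetaPoly hq n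
  have h7 : (-1 : PowerSeries ℂ) ^ n * (-1) ^ n = 1 := by rw [← mul_pow]; simp
  have h4 : qinv (X ^ 2) n = (-1) ^ n * ((-1) ^ n * qinv (X ^ 2) n : PowerSeries ℂ) := by
    linear_combination - qinv (X ^ 2) n * h7
  rw [sigmaTerm, h1, h4, ← h3, mul_sum, mul_sum, mul_sum]
  exact sum_congr rfl fun r _ => by ring

theorem triangle_add (r m : ℕ) : (r + m) * (r + m + 1) / 2
    = r * (r + 1) / 2 + (m * (m + 1) / 2 + r * m) := by
  rw [show (r + m) * (r + m + 1) = r * (r + 1) + m * (m + 1) + r * m * 2 by ring,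
    Nat.add_mul_div_right _ _ two_pos, Nat.add_div_of_dvd_right]
  · ring
  · exact (Nat.even_mul_succ_self r).two_dvd

theorem sum_range_sum_range_succ_comm {M : Type*} [AddCommMonoid M] (f : ℕ → ℕ → M) (N : ℕ) :
    ∑ n ∈ range N, ∑ r ∈ range (n + 1), f n r
      = ∑ r ∈ range N, ∑ m ∈ range (N - r), f (r + m) r := by
  rw [sum_sigma', sum_sigma']
  refine sum_nbij' (fun p => ⟨p.2, p.1 - p.2⟩) (fun p => ⟨p.1 + p.2, p.1⟩) ?_ ?_ ?_ ?_ ?_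
  · rintro ⟨a, b⟩ h; simp only [mem_sigma, mem_range] at h ⊢; omega
  · rintro ⟨a, b⟩ h; simp only [mem_sigma, mem_range] at h ⊢; omega
  · rintro ⟨a, b⟩ h
    simp only [mem_sigma, mem_range] at h
    simp only [Sigma.mk.injEq, heq_eq_eq, and_true]; omega
  · rintro ⟨a, b⟩ h
    simp
  · rintro ⟨a, b⟩ h
    simp only [mem_sigma, mem_range] at h
    simp only
    rw [Nat.add_sub_cancel' (by omega)]

theorem X_pow_dvd_sum_sigmaTerm (N : ℕ) : X ^ N ∣ ∑ n ∈ range N, sigmaTerm n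
    - ∑ r ∈ range N, (-1) ^ r * X ^ (r * (r + 1) / 2) * (1 - X ^ (2 * r + 1)) * thetaPoly X r := by
  have hq : constantCoeff (X : PowerSeries ℂ) = 0 := by simp
  simp_rw [sigmaTerm_eq]
  rw [sum_range_sum_range_succ_comm, ← sum_sub_distrib]
  refine dvd_sum fun r hr => ?_
  rw [mem_range] at hr
  obtain ⟨c, hc⟩ := pow_dvd_sum_sub hq r r (N - r)
  rw [qfac_mul_qinv hq, sub_eq_iff_eq_add] at hc
  have h1 : ∑ m ∈ range (N - r), thetaPoly X r * (1 - X ^ (2 * r + 1)) * ((-1) ^ (r + m) *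
      X ^ ((r + m) * (r + m + 1) / 2) *
      qfac X (r + m) * qinv X (r + m - r) * qinv X (r + m + r + 1)) =
      (-1) ^ r * X ^ (r * (r + 1) / 2) * (1 - X ^ (2 * r + 1)) * thetaPoly X r *
      (X ^ (N - r) * c + 1) := by
    rw [← hc, mul_sum]
    refine sum_congr rfl fun m _ => ?_
    rw [triangle_add, pow_add, pow_add, Nat.add_sub_cancel_left,
      show r + m + r + 1 = r + r + 1 + m by ring]
    ring
  rw [h1]
  obtain ⟨d, hd⟩ := pow_dvd_pow (X : PowerSeries ℂ) (le_triangle r)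
  have h2 : (X : PowerSeries ℂ) ^ N = X ^ r * X ^ (N - r) := by
    rw [← pow_add]; congr 1; omega
  rw [hd, h2]
  exact ⟨(-1) ^ r * d * (1 - X ^ (2 * r + 1)) * thetaPoly X r * c, by ring⟩

theorem coeff_sigma (m : ℕ) : coeff m sigma = ∑ r ∈ range (m + 1),
    coeff m ((-1) ^ r * X ^ (r * (r + 1) / 2) * (1 - X ^ (2 * r + 1)) * thetaPoly X r) := by
  have h := X_pow_dvd_iff.1 (X_pow_dvd_sum_sigmaTerm (m + 1)) m (by omega)
  rw [map_sub, map_sum, map_sum, sub_eq_zero] at h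
  rw [sigma, coeff_mk, h]

/-- The polynomial `∑_{j < 2r} q^{r(2r-1) - j(j+1)/2}`. -/
def triangularPoly (q : PowerSeries ℂ) (r : ℕ) : PowerSeries ℂ :=
  ∑ j ∈ range (2 * r), q ^ (r * (2 * r - 1) - j * (j + 1) / 2)

theorem triangularPoly_zero : triangularPoly q 0 = 0 := by simp [triangularPoly]

theorem triangularPoly_succ (r : ℕ) : triangularPoly q (r + 1)
    = q ^ (4 * r + 1) * triangularPoly q r + q ^ (2 * r + 1) + 1 := by
  rw [triangularPoly, show 2 * (r + 1) = 2 * r + 1 + 1 by ring, sum_range_succ, sum_range_succ,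
    triangularPoly, mul_sum]
  have h0 : (r + 1) * (2 * r + 1 + 1 - 1) = 2 * r ^ 2 + 3 * r + 1 := by
    rw [Nat.add_sub_cancel]; ring
  have h1 : (2 * r + 1) * (2 * r + 1 + 1) / 2 = 2 * r ^ 2 + 3 * r + 1 := by
    rw [show (2 * r + 1) * (2 * r + 1 + 1) = (2 * r ^ 2 + 3 * r + 1) * 2 by ring]; simp
  have h2 : (2 * r) * (2 * r + 1) / 2 = 2 * r ^ 2 + r := by
    rw [show (2 * r) * (2 * r + 1) = (2 * r ^ 2 + r) * 2 by ring]; simp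
  rw [h0, h1, h2, Nat.sub_self, pow_zero,
    show 2 * r ^ 2 + 3 * r + 1 - (2 * r ^ 2 + r) = 2 * r + 1 by omega]
  congr 2
  refine sum_congr rfl fun j hj => ?_
  rw [mem_range] at hj
  rw [← pow_add]
  congr 1
  have h3 : j * (j + 1) / 2 ≤ r * (2 * r - 1) := by
    refine (Nat.div_le_iff_le_mul_add_pred two_pos).2 ?_
    obtain ⟨s, rfl⟩ : ∃ s, r = s + 1 := ⟨r - 1, by omega⟩
    rw [show 2 * (s + 1) - 1 = 2 * s + 1 by omega]
    nlinarith [show j ≤ 2 * s + 1 by omega]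
  have h4 : r * (2 * r - 1) + r = 2 * r ^ 2 := by
    obtain ⟨s, rfl⟩ : ∃ s, r = s + 1 := ⟨r - 1, by omega⟩
    rw [show 2 * (s + 1) - 1 = 2 * s + 1 by omega]
    ring
  omega

theorem sum_triangularPoly (hq : constantCoeff q = 0) (n : ℕ) :
    ∑ r ∈ range (n + 1), q ^ (n - r) * (1 - q ^ (4 * (r + 1))) * triangularPoly q (r + 1)
      * qinv (q ^ 2) (n - r) * qinv (q ^ 2) (n + r + 2) = qinv q (2 * n + 1) := by
  have hq2 : constantCoeff (q ^ 2) = 0 := by simp [hq]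
  have key : ∀ R ≤ n, ∑ r ∈ range R, q ^ (n - r) * (1 - q ^ (4 * (r + 1)))
      * triangularPoly q (r + 1) * qinv (q ^ 2) (n - r) * qinv (q ^ 2) (n + r + 2)
      + q ^ (n - R) * triangularPoly q (R + 1) * qinv (q ^ 2) (n - R) * qinv (q ^ 2) (n + R + 1)
      = ∑ r ∈ range (R + 1), q ^ (n - r) * (1 + q ^ (2 * r + 1)) * qinv (q ^ 2) (n - r)
          * qinv (q ^ 2) (n + r + 1) := by
    intro R hR
    induction R with
    | zero =>
      rw [range_zero, sum_empty, sum_range_one, triangularPoly_succ, triangularPoly_zero]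
      simp only [Nat.sub_zero, add_zero]
      ring
    | succ R ih =>
      rw [sum_range_succ, sum_range_succ _ (R + 1), ← ih (by omega), triangularPoly_succ (R + 1)]
      have h1 := qinv_succ hq2 (n - (R + 1))
      have h2 := qinv_succ hq2 (n + R + 1)
      rw [show n - (R + 1) + 1 = n - R by omega, ← pow_mul] at h1
      rw [← pow_mul] at h2
      rw [show n + (R + 1) + 1 = n + R + 1 + 1 by ring, ← h1, ← h2,
        show n - R = n - (R + 1) + 1 by omega]
      have h3 : q ^ (2 * (n + R + 1 + 1)) = q ^ (2 * (n - (R + 1) + 1)) * q ^ (4 * (R + 1)) := by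
        rw [← pow_add]; congr 1; omega
      rw [h3]
      ring
  have h4 := key n le_rfl
  have h5 := qinv_succ hq2 (n + n + 1)
  have h6 := (rogersSzego_sq hq (2 * n + 1)).1
  rw [rogersSzego, Nat.sum_antidiagonal_eq_sum_range_succ_mk,
    show (2 * n + 1).succ = 2 * (n + 1) by simp [Nat.succ_eq_add_one]; ring,
    sum_range_two_mul_fold] at h6
  rw [sum_range_succ, ← h6]
  rw [Nat.sub_self, qinv_zero, ← h5, ← pow_mul] at h4
  rw [Nat.sub_self, qinv_zero]
  have h8 : ∀ r ∈ range (n + 1), q ^ (n + 1 - (r + 1)) * qinv (q ^ 2) (n + 1 - (r + 1)) *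
      qinv (q ^ 2) (2 * n + 1 - (n + 1 - (r + 1))) + q ^ (n + 1 + r) * qinv (q ^ 2) (n + 1 + r) *
      qinv (q ^ 2) (2 * n + 1 - (n + 1 + r)) = q ^ (n - r) * (1 + q ^ (2 * r + 1)) *
      qinv (q ^ 2) (n - r) * qinv (q ^ 2) (n + r + 1) := by
    intro r hr
    rw [mem_range] at hr
    rw [show n + 1 - (r + 1) = n - r by omega, show 2 * n + 1 - (n - r) = n + r + 1 by omega,
      show n + 1 + r = n + r + 1 by ring, show 2 * n + 1 - (n + r + 1) = n - r by omega,
      show q ^ (n + r + 1) = q ^ (n - r) * q ^ (2 * r + 1) by rw [← pow_add]; congr 1; omega]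
    ring
  rw [sum_congr rfl h8, ← h4]
  rw [show 2 * (n + n + 1 + 1) = 4 * (n + 1) by ring]
  ring

theorem prod_one_sub_mul_qfac (n : ℕ) :
    (∏ k ∈ Icc 1 (n + 1), (1 - q ^ (2 * k - 1))) * qfac (q ^ 2) n = qfac q (2 * n + 1) := by
  induction n with
  | zero => simp [qfac_zero, qfac_succ]
  | succ n ih =>
    rw [prod_Icc_succ_top (by omega), qfac_succ, show 2 * (n + 1) + 1 = 2 * n + 1 + 1 + 1 by ring,
      qfac_succ (2 * n + 1 + 1), qfac_succ (2 * n + 1), ← ih, ← pow_mul,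
      show 2 * (n + 1 + 1) - 1 = 2 * n + 1 + 1 + 1 by omega,
      show 2 * (n + 1) = 2 * n + 1 + 1 by ring]
    ring

theorem sigmaStarTerm_eq (n : ℕ) : sigmaStarTerm (n + 1) = ∑ r ∈ range (n + 1),
    (1 - X ^ (4 * (r + 1))) * triangularPoly X (r + 1) * (2 * (-1) ^ (n + 1) * X ^ ((n + 1) ^ 2) *
      X ^ (n - r) * qfac (X ^ 2) n * qinv (X ^ 2) (n - r) * qinv (X ^ 2) (n + r + 2)) := by
  have hq : constantCoeff (X : PowerSeries ℂ) = 0 := by simp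
  have h0 : constantCoeff (∏ k ∈ Icc 1 (n + 1), (1 - X ^ (2 * k - 1) : PowerSeries ℂ)) ≠ 0 := by
    rw [map_prod, prod_ne_zero_iff]
    intro k hk
    rw [mem_Icc] at hk
    simp [show 2 * k - 1 ≠ 0 by omega]
  have h1 : (∏ k ∈ Icc 1 (n + 1), (1 - X ^ (2 * k - 1) : PowerSeries ℂ))⁻¹
      = qfac (X ^ 2) n * qinv X (2 * n + 1) := by
    rw [PowerSeries.inv_eq_iff_mul_eq_one h0]
    have := prod_one_sub_mul_qfac (q := X) n
    have h2 := qfac_mul_qinv hq (2 * n + 1)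
    linear_combination h2 + qinv X (2 * n + 1) * this
  rw [sigmaStarTerm, h1, ← sum_triangularPoly hq, mul_sum, mul_sum]
  exact sum_congr rfl fun r _ => by ring

theorem X_pow_dvd_sum_sigmaStarTerm (N : ℕ) : X ^ N ∣ ∑ n ∈ range N, sigmaStarTerm (n + 1)
    - ∑ r ∈ range N, 2 * (-1) ^ (r + 1) * X ^ ((r + 1) ^ 2) * (1 + X ^ (2 * (r + 1)))
      * triangularPoly X (r + 1) := by
  have hq : constantCoeff (X ^ 2 : PowerSeries ℂ) = 0 := by simp
  simp_rw [sigmaStarTerm_eq]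
  rw [sum_range_sum_range_succ_comm, ← sum_sub_distrib]
  refine dvd_sum fun r hr => ?_
  rw [mem_range] at hr
  obtain ⟨c, hc⟩ := pow_dvd_sum_sub hq r (r + 1) (N - r)
  rw [sub_eq_iff_eq_add] at hc
  have h0 : (1 - X ^ (2 * (r + 1))) * (qfac (X ^ 2) r * qinv (X ^ 2) (r + 1))
      = (1 : PowerSeries ℂ) := by
    have e1 := qinv_succ hq r
    have e2 := qfac_mul_qinv hq r
    rw [← e1, ← pow_mul] at e2
    linear_combination e2
  have h1 : ∑ m ∈ range (N - r), (1 - X ^ (4 * (r + 1))) * triangularPoly X (r + 1) *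
      (2 * (-1) ^ (r + m + 1) * X ^ ((r + m + 1) ^ 2) * X ^ (r + m - r) * qfac (X ^ 2) (r + m) *
      qinv (X ^ 2) (r + m - r) * qinv (X ^ 2) (r + m + r + 2)) =
      (1 - X ^ (4 * (r + 1))) * triangularPoly X (r + 1) * 2 * (-1) ^ (r + 1) * X ^ ((r + 1) ^ 2) *
      ((X ^ 2) ^ (N - r) * c + qfac (X ^ 2) r * qinv (X ^ 2) (r + 1)) := by
    rw [← hc, mul_sum]
    refine sum_congr rfl fun m _ => ?_
    have e1 : (X : PowerSeries ℂ) ^ ((r + m + 1) ^ 2) * X ^ m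
        = X ^ ((r + 1) ^ 2) * (X ^ 2) ^ (m * (m + 1) / 2 + (r + 1) * m) := by
      rw [← pow_mul, ← pow_add, ← pow_add]
      congr 1
      have := Nat.div_mul_cancel (Nat.even_mul_succ_self m).two_dvd
      linarith
    rw [Nat.add_sub_cancel_left, show r + m + r + 2 = r + (r + 1) + 1 + m by ring]
    linear_combination ((1 - X ^ (4 * (r + 1))) * triangularPoly X (r + 1) *
      (2 * (-1) ^ (r + m + 1) * qfac (X ^ 2) (r + m) *
      qinv (X ^ 2) m * qinv (X ^ 2) (r + (r + 1) + 1 + m))) * e1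
  rw [h1]
  have h2 : (X : PowerSeries ℂ) ^ N ∣ X ^ ((r + 1) ^ 2) * (X ^ 2) ^ (N - r) := by
    rw [← pow_mul, ← pow_add]
    refine pow_dvd_pow _ ?_
    have : (r + 1) ^ 2 = r ^ 2 + r + r + 1 := by ring
    omega
  obtain ⟨d, hd⟩ := h2
  refine ⟨(1 - X ^ (4 * (r + 1))) * triangularPoly X (r + 1) * 2 * (-1) ^ (r + 1) * d * c, ?_⟩
  have h3 : (1 - X ^ (4 * (r + 1)) : PowerSeries ℂ)
      = (1 - X ^ (2 * (r + 1))) * (1 + X ^ (2 * (r + 1))) := by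
    rw [show 4 * (r + 1) = 2 * (r + 1) * 2 by ring, pow_mul]; ring
  rw [h3]
  linear_combination ((1 - X ^ (2 * (r + 1))) * (1 + X ^ (2 * (r + 1))) * triangularPoly X (r + 1)
    * 2 * (-1) ^ (r + 1) * c) * hd + (1 + X ^ (2 * (r + 1))) * triangularPoly X (r + 1)
    * 2 * (-1) ^ (r + 1) * X ^ ((r + 1) ^ 2) * h0

theorem coeff_sigmaStar (m : ℕ) : coeff m sigmaStar = ∑ r ∈ range (m + 1),
    coeff m (2 * (-1) ^ (r + 1) * X ^ ((r + 1) ^ 2) * (1 + X ^ (2 * (r + 1)))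
      * triangularPoly X (r + 1)) := by
  have h := X_pow_dvd_iff.1 (X_pow_dvd_sum_sigmaStarTerm (m + 1)) m (by omega)
  rw [map_sub, map_sum, map_sum, sub_eq_zero, sum_range_succ,
    coeff_sigmaStarTerm_of_lt (by omega : m < m + 1), add_zero] at h
  rw [sigmaStar, coeff_mk, ← h, range_eq_Ico, sum_Ico_add' (fun n => coeff m (sigmaStarTerm n))]
  rfl

end QSeries
end CohenMaass
end

noncomputable section
namespace CohenMaass
open Matrix UpperHalfPlane MeasureTheory

section Coefficients

open PowerSeries Finset

/-- The sign `(-1)^{k+j}`. -/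
def latSign (k j : ℤ) : ℂ := (((-1 : ℤˣ) ^ (k + j) : ℤˣ) : ℂ)

/-- The norm `(6k+1)² - 24j²`, that is `24 Q(k + 1/6, j)`. -/
def latNorm (k j : ℤ) : ℤ := (6 * k + 1) ^ 2 - 24 * j ^ 2

theorem latSign_neg_one_sub (r : ℕ) (j : ℤ) : latSign (-1 - r) j = - latSign r j := by
  have : (-1 : ℤˣ) ^ (-1 - (r : ℤ) + j) = - (-1 : ℤˣ) ^ ((r : ℤ) + j) := by
    rcases Int.even_or_odd ((r : ℤ) + j) with h | h
    · rw [h.neg_one_zpow, Odd.neg_one_zpow]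
      rw [Int.odd_iff]; rw [Int.even_iff] at h; omega
    · rw [h.neg_one_zpow, Even.neg_one_zpow]
      · simp
      · rw [Int.even_iff]; rw [Int.odd_iff] at h; omega
  rw [latSign, latSign, this]
  simp

theorem sum_Ico_neg_natCast {M : Type*} [AddCommMonoid M] (f : ℤ → M) (N : ℕ) :
    ∑ k ∈ Ico (-(N : ℤ)) N, f k = ∑ r ∈ range N, (f r + f (-1 - r)) := by
  induction N with
  | zero => simp
  | succ N ih =>
    have h : Ico (-((N + 1 : ℕ) : ℤ)) (N + 1 : ℕ)
      = insert (-1 - (N : ℤ)) (insert (N : ℤ) (Ico (-(N : ℤ)) N)) := by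
      ext j; simp only [mem_Ico, mem_insert]; push_cast; omega
    rw [h, sum_insert, sum_insert, ih, sum_range_succ]
    · abel
    · simp
    · simp only [mem_insert, mem_Ico]; omega

theorem coeff_sigma_summand (m r : ℕ) :
    coeff m ((-1) ^ r * X ^ (r * (r + 1) / 2) * (1 - X ^ (2 * r + 1)) * thetaPoly X r)
    = ∑ j ∈ Icc (-(r : ℤ)) r, ((if latNorm r j = 24 * m + 1 then latSign r j else 0)
        + (if latNorm (-1 - r) j = 24 * m + 1 then latSign (-1 - r) j else 0)) := by
  rw [thetaPoly, mul_sum, map_sum]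
  refine sum_congr rfl fun j hj => ?_
  rw [mem_Icc] at hj
  have h1 : j.natAbs ^ 2 ≤ r ^ 2 := Nat.pow_le_pow_left (by omega) 2
  have hd := Nat.div_mul_cancel (Nat.even_mul_succ_self r).two_dvd
  obtain ⟨E, hE⟩ : ∃ E, E = r * (r + 1) / 2 + (r ^ 2 - j.natAbs ^ 2) := ⟨_, rfl⟩
  have hEz : (24 * E + 1 : ℤ) = latNorm r j := by
    rw [hE, latNorm]
    push_cast [h1]
    rw [sq_abs]
    have : ((r * (r + 1) / 2 : ℕ) : ℤ) * 2 = r * (r + 1) := by exact_mod_cast hd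
    push_cast at this
    linarith
  have hEz' : (24 * (E + 2 * r + 1) + 1 : ℤ) = latNorm (-1 - r) j := by
    rw [latNorm] at hEz ⊢
    linarith
  have hs : (-1 : PowerSeries ℂ) ^ r * (((-1 : ℤˣ) ^ j : ℤˣ) : PowerSeries ℂ)
      = PowerSeries.C (latSign r j) := by
    rw [latSign, _root_.zpow_add, zpow_natCast]
    push_cast
    simp
  have h2 : (-1) ^ r * X ^ (r * (r + 1) / 2) * (1 - X ^ (2 * r + 1)) *
      ((((-1 : ℤˣ) ^ j : ℤˣ) : PowerSeries ℂ) * X ^ (r ^ 2 - j.natAbs ^ 2)) =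
      PowerSeries.C (latSign r j) * (X ^ E - X ^ (E + 2 * r + 1)) := by
    rw [← hs, hE]; ring
  rw [h2, coeff_C_mul, map_sub, coeff_X_pow, coeff_X_pow, ← hEz, ← hEz', latSign_neg_one_sub]
  have c1 : (24 * (E : ℤ) + 1 = 24 * m + 1) ↔ m = E := by omega
  have c2 : (24 * ((E : ℤ) + 2 * r + 1) + 1 = 24 * m + 1) ↔ m = E + 2 * r + 1 := by omega
  simp only [c1, c2]
  split_ifs <;> simp

/-- The indicator of the cone `|6j| < |6k+1|`, where the norm is positive. -/
def PosCone (k j : ℤ) : Prop := |6 * j| < |6 * k + 1|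

/-- The indicator of the cone `|6k+1| < 4|j|`, where the norm is negative. -/
def NegCone (k j : ℤ) : Prop := |6 * k + 1| < 4 * |j|

instance (k j : ℤ) : Decidable (PosCone k j) := inferInstanceAs (Decidable (_ < _))
instance (k j : ℤ) : Decidable (NegCone k j) := inferInstanceAs (Decidable (_ < _))

theorem posCone_natCast (r : ℕ) (j : ℤ) : PosCone r j ↔ j ∈ Icc (-(r : ℤ)) r := by
  rw [PosCone, abs_lt, mem_Icc, abs_of_nonneg (by omega : (0 : ℤ) ≤ 6 * r + 1)]; omega

theorem posCone_neg_one_sub (r : ℕ) (j : ℤ) : PosCone (-1 - r) j ↔ j ∈ Icc (-(r : ℤ)) r := by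
  rw [PosCone, abs_lt, mem_Icc, abs_of_nonpos (by omega : 6 * (-1 - (r : ℤ)) + 1 ≤ 0)]; omega

theorem latNorm_ge_of_posCone {k j : ℤ} (h : PosCone k j) :
    (6 * k + 1) ^ 2 ≤ 3 * latNorm k j := by
  have := sq_lt_sq.2 h
  rw [latNorm]
  nlinarith

theorem latNorm_le_of_negCone {k j : ℤ} (h : NegCone k j) : 8 * j ^ 2 ≤ - latNorm k j := by
  rw [NegCone, ← abs_of_pos (by norm_num : (0 : ℤ) < 4), ← abs_mul] at h
  have := sq_lt_sq.2 h
  rw [latNorm]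
  nlinarith

/-- The Hecke-type double sum for the coefficients of `σ`. -/
theorem hasSum_coeff_sigma (m : ℕ) :
    HasSum (fun p : ℤ × ℤ => if PosCone p.1 p.2 ∧ latNorm p.1 p.2 = 24 * m + 1
      then latSign p.1 p.2 else 0) (coeff m sigma) := by
  set f := fun p : ℤ × ℤ => if PosCone p.1 p.2 ∧ latNorm p.1 p.2 = 24 * m + 1
      then latSign p.1 p.2 else 0 with hf
  have h : coeff m sigma
      = ∑ p ∈ Ico (-((m + 1 : ℕ) : ℤ)) (m + 1 : ℕ) ×ˢ Icc (-(m : ℤ)) m, f p := by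
    rw [coeff_sigma, sum_product, sum_Ico_neg_natCast]
    refine sum_congr rfl fun r hr => ?_
    rw [mem_range] at hr
    rw [coeff_sigma_summand, ← sum_add_distrib]
    have hsub : Icc (-(r : ℤ)) r ⊆ Icc (-(m : ℤ)) m := Icc_subset_Icc (by omega) (by omega)
    rw [← sum_subset hsub]
    · refine sum_congr rfl fun j hj => ?_
      simp only [hf, posCone_natCast, posCone_neg_one_sub, hj, true_and]
    · intro j _ hj
      simp only [hf, posCone_natCast, posCone_neg_one_sub, hj, false_and, if_false, add_zero]
  rw [h]
  refine hasSum_sum_of_ne_finset_zero fun p hp => if_neg fun ⟨h1, h2⟩ => hp ?_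
  have h3 := latNorm_ge_of_posCone h1
  rw [h2] at h3
  have h4 := sq_lt_sq.2 h1
  have hk : |6 * p.1 + 1| ≤ 6 * m + 5 := by
    apply abs_le_of_sq_le_sq _ (by omega)
    nlinarith [sq_nonneg (6 * (m : ℤ) - 1)]
  rw [abs_le] at hk
  have hj : |6 * p.2| < 6 * m + 6 := by
    rw [PosCone] at h1
    have := abs_le.2 hk
    omega
  rw [abs_lt] at hj
  rw [mem_product, mem_Ico, mem_Icc]
  push_cast
  omega

theorem triangularPoly_exponent {r i : ℕ} (h : i < 2 * r) : i * (i + 1) / 2 ≤ r * (2 * r - 1) := by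
  refine (Nat.div_le_iff_le_mul_add_pred two_pos).2 ?_
  obtain ⟨s, rfl⟩ : ∃ s, r = s + 1 := ⟨r - 1, by omega⟩
  rw [show 2 * (s + 1) - 1 = 2 * s + 1 by omega]
  nlinarith [show i ≤ 2 * s + 1 by omega]

theorem latSign_eq_of_even {k j k' j' : ℤ} (h : Even (k + j - (k' + j'))) :
    latSign k j = latSign k' j' := by
  have : (-1 : ℤˣ) ^ (k + j) = (-1 : ℤˣ) ^ (k' + j') := by
    rw [show k + j = (k + j - (k' + j')) + (k' + j') by ring, _root_.zpow_add, h.neg_one_zpow, one_mul]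
  rw [latSign, latSign, this]

theorem coeff_sigmaStar_summand (m r : ℕ) :
    coeff m (2 * (-1) ^ (r + 1) * X ^ ((r + 1) ^ 2) * (1 + X ^ (2 * (r + 1)))
      * triangularPoly X (r + 1)) = 2 * ∑ i ∈ range (2 * (r + 1)),
      ((if latNorm (2 * r + 1 - i) (3 * r + 2 - i) = 1 - 24 * m
        then latSign (2 * r + 1 - i) (3 * r + 2 - i) else 0)
      + (if latNorm (i - 2 * r - 2) (3 * r + 3 - i) = 1 - 24 * m
        then latSign (i - 2 * r - 2) (3 * r + 3 - i) else 0)) := by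
  rw [triangularPoly, mul_sum, map_sum, mul_sum]
  refine sum_congr rfl fun i hi => ?_
  rw [mem_range] at hi
  have h1 := triangularPoly_exponent hi
  have hd := Nat.div_mul_cancel (Nat.even_mul_succ_self i).two_dvd
  obtain ⟨E, hE⟩ : ∃ E, E = (r + 1) ^ 2 + ((r + 1) * (2 * (r + 1) - 1) - i * (i + 1) / 2) :=
    ⟨_, rfl⟩
  have hEz0 : (E : ℤ) = (r + 1) ^ 2 + ((r + 1) * (2 * r + 1) - (i * (i + 1) / 2 : ℕ)) := by
    rw [hE, Nat.cast_add, Nat.cast_sub h1, show 2 * (r + 1) - 1 = 2 * r + 1 by omega]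
    push_cast
    ring
  have hd' : ((i * (i + 1) / 2 : ℕ) : ℤ) * 2 = i * (i + 1) := by exact_mod_cast hd
  have hEz : (1 - 24 * E : ℤ) = latNorm (2 * r + 1 - i) (3 * r + 2 - i) := by
    rw [latNorm]
    linear_combination (-24) * hEz0 + 12 * hd'
  have hEz' : (1 - 24 * (E + 2 * (r + 1)) : ℤ) = latNorm (i - 2 * r - 2) (3 * r + 3 - i) := by
    rw [latNorm]
    linear_combination (-24) * hEz0 + 12 * hd'
  have hs : latSign (2 * r + 1 - i) (3 * r + 2 - i) = (-1) ^ (r + 1) := by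
    rw [latSign_eq_of_even (k' := (r + 1 : ℕ)) (j' := 0), latSign, add_zero, zpow_natCast]
    · simp
    · rw [Int.even_iff]; push_cast; omega
  have hs' : latSign (i - 2 * r - 2) (3 * r + 3 - i) = (-1) ^ (r + 1) := by
    rw [latSign_eq_of_even (k' := (r + 1 : ℕ)) (j' := 0), latSign, add_zero, zpow_natCast]
    · simp
    · rw [Int.even_iff]; push_cast; omega
  have h2 : 2 * (-1) ^ (r + 1) * X ^ ((r + 1) ^ 2) * (1 + X ^ (2 * (r + 1))) *
      X ^ ((r + 1) * (2 * (r + 1) - 1) - i * (i + 1) / 2) =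
      PowerSeries.C (2 * (-1 : ℂ) ^ (r + 1)) * (X ^ E + X ^ (E + 2 * (r + 1))) := by
    rw [hE]; simp only [map_mul, map_ofNat, map_pow, map_neg, map_one]; ring
  rw [h2, coeff_C_mul, map_add, coeff_X_pow, coeff_X_pow, ← hEz, ← hEz', hs, hs']
  have c1 : (1 - 24 * (E : ℤ) = 1 - 24 * m) ↔ m = E := by omega
  have c2 : (1 - 24 * ((E : ℤ) + 2 * (r + 1)) = 1 - 24 * m) ↔ m = E + 2 * (r + 1) := by omega
  simp only [c1, c2]
  split_ifs <;> ring


/-- The Hecke-type double sum for the coefficients of `σ*`. -/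
theorem hasSum_coeff_sigmaStar (m : ℕ) :
    HasSum (fun p : ℤ × ℤ => if NegCone p.1 p.2 ∧ latNorm p.1 p.2 = 1 - 24 * m
      then latSign p.1 p.2 else 0) (coeff m sigmaStar) := by
  set f := fun p : ℤ × ℤ => if NegCone p.1 p.2 ∧ latNorm p.1 p.2 = 1 - 24 * m
      then latSign p.1 p.2 else 0 with hf
  set B : Finset ℤ := Icc (-(3 * m + 3 : ℤ)) (3 * m + 3)
  set T : Finset (ℤ × ℤ) :=
    (B ×ˢ B).filter fun p => NegCone p.1 p.2 ∧ |p.2| - |p.1| ≤ m + 1 with hT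
  have memT : ∀ k j : ℤ, (k, j) ∈ T ↔ ((-(3 * m + 3 : ℤ) ≤ k ∧ k ≤ 3 * m + 3) ∧
      (-(3 * m + 3 : ℤ) ≤ j ∧ j ≤ 3 * m + 3)) ∧ |6 * k + 1| < 4 * |j| ∧ |j| - |k| ≤ m + 1 := by
    intro k j
    rw [hT, mem_filter, mem_product, mem_Icc, mem_Icc, NegCone]
  have hzero : ∀ p ∉ T, f p = 0 := by
    refine fun p hp => if_neg fun ⟨h1, h2⟩ => hp ?_
    have h3 := latNorm_le_of_negCone h1
    rw [h2] at h3
    have hj : |p.2| ≤ m + 1 := by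
      apply abs_le_of_sq_le_sq _ (by omega)
      nlinarith [sq_nonneg (2 * (m : ℤ) - 1)]
    rw [show p = (p.1, p.2) from rfl, memT]
    rw [NegCone] at h1
    have h5 : |6 * p.1 + 1| < 4 * (m + 1) := by omega
    rw [abs_lt] at h5
    have h6 := abs_le.1 hj
    have h7 := abs_nonneg p.1
    refine ⟨⟨?_, ?_⟩, h1, ?_⟩ <;> omega
  have h : coeff m sigmaStar = ∑ p ∈ T, f p := by
    have e1 : ∑ p ∈ T with ¬ 0 < p.2, f p = ∑ p ∈ T with 0 < p.2, f p := by
      refine sum_nbij' (fun p => (p.1, -p.2)) (fun p => (p.1, -p.2)) ?_ ?_ ?_ ?_ ?_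
      · rintro ⟨k, j⟩ h
        rw [mem_filter, memT] at h ⊢
        obtain ⟨⟨h1, h2, h3⟩, h4⟩ := h
        simp only [abs_neg] at *
        have hj : j ≠ 0 := by
          rintro rfl
          simp only [abs_zero, mul_zero] at h2
          exact absurd h2 (not_lt.2 (abs_nonneg _))
        refine ⟨⟨?_, h2, h3⟩, ?_⟩ <;> omega
      · rintro ⟨k, j⟩ h
        rw [mem_filter, memT] at h ⊢
        obtain ⟨⟨h1, h2, h3⟩, h4⟩ := h
        simp only [abs_neg] at *
        refine ⟨⟨?_, h2, h3⟩, ?_⟩ <;> omega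
      · rintro ⟨k, j⟩ _; simp
      · rintro ⟨k, j⟩ _; simp
      · rintro ⟨k, j⟩ _
        have : latSign k (-j) = latSign k j :=
          latSign_eq_of_even (by rw [Int.even_iff]; omega)
        simp only [hf, this]
        exact if_congr (by simp only [NegCone, latNorm, abs_neg, neg_sq]) rfl rfl
    have e2 : ∑ p ∈ (T.filter fun p => 0 < p.2) with 0 ≤ p.1, f p
        = ∑ r ∈ range (m + 1), ∑ i ∈ range (2 * (r + 1)),
          (if latNorm (2 * r + 1 - i) (3 * r + 2 - i) = 1 - 24 * m
            then latSign (2 * r + 1 - i) (3 * r + 2 - i) else 0) := by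
      rw [sum_sigma']
      symm
      refine sum_nbij' (fun x => (2 * (x.1 : ℤ) + 1 - x.2, 3 * (x.1 : ℤ) + 2 - x.2))
        (fun p => ⟨(p.2 - p.1 - 1).toNat, (2 * p.2 - 3 * p.1 - 1).toNat⟩) ?_ ?_ ?_ ?_ ?_
      · rintro ⟨r, i⟩ h
        simp only [mem_sigma, mem_range] at h
        rw [mem_filter, mem_filter, memT]
        simp only
        rw [abs_of_nonneg (by omega : (0 : ℤ) ≤ 3 * r + 2 - i),
          abs_of_nonneg (by omega : (0 : ℤ) ≤ 2 * r + 1 - i),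
          abs_of_nonneg (by omega : (0 : ℤ) ≤ 6 * (2 * r + 1 - i) + 1)]
        omega
      · rintro ⟨k, j⟩ h
        rw [mem_filter, mem_filter, memT] at h
        simp only at h
        obtain ⟨⟨⟨h1, h2, h3⟩, h4⟩, h5⟩ := h
        rw [abs_of_pos h4, abs_of_nonneg h5] at h3
        rw [abs_of_pos h4, abs_of_nonneg (by omega)] at h2
        simp only [mem_sigma, mem_range]
        omega
      · rintro ⟨r, i⟩ h
        simp only [mem_sigma, mem_range] at h
        simp only [Sigma.mk.injEq, heq_eq_eq]
        omega
      · rintro ⟨k, j⟩ h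
        rw [mem_filter, mem_filter, memT] at h
        simp only at h
        obtain ⟨⟨⟨h1, h2, h3⟩, h4⟩, h5⟩ := h
        rw [abs_of_pos h4, abs_of_nonneg h5] at h3
        rw [abs_of_pos h4, abs_of_nonneg (by omega)] at h2
        simp only [Prod.mk.injEq]
        omega
      · rintro ⟨r, i⟩ h
        simp only [mem_sigma, mem_range] at h
        have : NegCone (2 * r + 1 - i) (3 * r + 2 - i) := by
          rw [NegCone, abs_of_nonneg (by omega : (0 : ℤ) ≤ 3 * r + 2 - i),
            abs_of_nonneg (by omega : (0 : ℤ) ≤ 6 * (2 * r + 1 - i) + 1)]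
          omega
        simp only [hf, this, true_and]
    have e3 : ∑ p ∈ (T.filter fun p => 0 < p.2) with ¬ 0 ≤ p.1, f p
        = ∑ r ∈ range (m + 1), ∑ i ∈ range (2 * (r + 1)),
          (if latNorm (i - 2 * r - 2) (3 * r + 3 - i) = 1 - 24 * m
            then latSign (i - 2 * r - 2) (3 * r + 3 - i) else 0) := by
      rw [sum_sigma']
      symm
      refine sum_nbij' (fun x => ((x.2 : ℤ) - 2 * x.1 - 2, 3 * (x.1 : ℤ) + 3 - x.2))
        (fun p => ⟨(p.2 + p.1 - 1).toNat, (2 * p.2 + 3 * p.1).toNat⟩) ?_ ?_ ?_ ?_ ?_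
      · rintro ⟨r, i⟩ h
        simp only [mem_sigma, mem_range] at h
        rw [mem_filter, mem_filter, memT]
        simp only
        rw [abs_of_nonneg (by omega : (0 : ℤ) ≤ 3 * r + 3 - i),
          abs_of_nonpos (by omega : (i : ℤ) - 2 * r - 2 ≤ 0),
          abs_of_nonpos (by omega : 6 * ((i : ℤ) - 2 * r - 2) + 1 ≤ 0)]
        omega
      · rintro ⟨k, j⟩ h
        rw [mem_filter, mem_filter, memT] at h
        simp only at h
        obtain ⟨⟨⟨h1, h2, h3⟩, h4⟩, h5⟩ := h
        rw [abs_of_pos h4, abs_of_neg (not_le.1 h5)] at h3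
        rw [abs_of_pos h4, abs_of_nonpos (by omega)] at h2
        simp only [mem_sigma, mem_range]
        omega
      · rintro ⟨r, i⟩ h
        simp only [mem_sigma, mem_range] at h
        simp only [Sigma.mk.injEq, heq_eq_eq]
        omega
      · rintro ⟨k, j⟩ h
        rw [mem_filter, mem_filter, memT] at h
        simp only at h
        obtain ⟨⟨⟨h1, h2, h3⟩, h4⟩, h5⟩ := h
        rw [abs_of_pos h4, abs_of_neg (not_le.1 h5)] at h3
        rw [abs_of_pos h4, abs_of_nonpos (by omega)] at h2
        simp only [Prod.mk.injEq]
        omega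
      · rintro ⟨r, i⟩ h
        simp only [mem_sigma, mem_range] at h
        have : NegCone (i - 2 * r - 2) (3 * r + 3 - i) := by
          rw [NegCone, abs_of_nonneg (by omega : (0 : ℤ) ≤ 3 * r + 3 - i),
            abs_of_nonpos (by omega : 6 * ((i : ℤ) - 2 * r - 2) + 1 ≤ 0)]
          omega
        simp only [hf, this, true_and]
    rw [← sum_filter_add_sum_filter_not T (fun p => 0 < p.2), e1,
      ← sum_filter_add_sum_filter_not (T.filter fun p => 0 < p.2) (fun p => 0 ≤ p.1), e2, e3,
      coeff_sigmaStar, ← sum_add_distrib, ← two_mul, mul_sum]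
    refine sum_congr rfl fun r _ => ?_
    rw [coeff_sigmaStar_summand, sum_add_distrib]
  rw [h]
  exact hasSum_sum_of_ne_finset_zero hzero

/-- The fibre of the norm over `n ≡ 1 mod 24` computes Cohen's coefficient `T(n)`. -/
theorem hasSum_cohenT (n : ℤ) :
    HasSum (fun p : ℤ × ℤ => if (PosCone p.1 p.2 ∨ NegCone p.1 p.2) ∧ latNorm p.1 p.2 = n
      then latSign p.1 p.2 else 0) (cohenT n) := by
  have hmod : ∀ k j : ℤ, latNorm k j % 24 = 1 := by
    intro k j
    rcases Int.even_mul_succ_self k with ⟨c, hc⟩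
    have h2 : latNorm k j = 24 * (3 * c - k - j ^ 2) + 1 := by
      rw [latNorm]
      linear_combination 36 * hc
    omega
  rw [cohenT]
  split_ifs with h h0
  · refine (congrArg (HasSum · _) (funext fun p => if_congr ?_ rfl rfl)).mpr
      (hasSum_coeff_sigma (n / 24).toNat)
    have e1 : (24 * ((n / 24).toNat : ℤ) + 1) = n := by omega
    rw [e1]
    refine and_congr_left fun h2 => ⟨fun h3 => h3.resolve_right fun h4 => ?_, Or.inl⟩
    have h5 := latNorm_le_of_negCone h4
    nlinarith [sq_nonneg p.2]
  · refine (congrArg (HasSum · _) (funext fun p => if_congr ?_ rfl rfl)).mpr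
      (hasSum_coeff_sigmaStar (-(n / 24)).toNat)
    have e1 : (1 - 24 * ((-(n / 24)).toNat : ℤ)) = n := by omega
    rw [e1]
    refine and_congr_left fun h2 => ⟨fun h3 => h3.resolve_left fun h4 => ?_, Or.inr⟩
    have h5 := latNorm_ge_of_posCone h4
    have h6 : (6 * p.1 + 1) ^ 2 > 0 := by
      have : 6 * p.1 + 1 ≠ 0 := by omega
      positivity
    omega
  · have : (fun p : ℤ × ℤ => if (PosCone p.1 p.2 ∨ NegCone p.1 p.2) ∧ latNorm p.1 p.2 = n
      then latSign p.1 p.2 else 0) = fun _ => (0 : ℂ) := by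
      funext p
      refine if_neg fun h1 => h ?_
      rw [← h1.2, hmod]
    rw [this]
    exact hasSum_zero

end Coefficients
end CohenMaass
end

noncomputable section
namespace CohenMaass
open Matrix UpperHalfPlane MeasureTheory

section Groups

open scoped MatrixGroups
open ModularGroup

theorem slT_eq : slT = ModularGroup.T := rfl

theorem SL_mul_apply (A B : SL(2, ℤ)) (i j : Fin 2) :
    (A * B) i j = A i 0 * B 0 j + A i 1 * B 1 j := by
  change ((A : Matrix (Fin 2) (Fin 2) ℤ) * (B : Matrix (Fin 2) (Fin 2) ℤ)) i j = _
  rw [Matrix.mul_apply, Fin.sum_univ_two]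

theorem coe_S_mul_T_zpow_mul_S_inv (n : ℤ) :
    ((S * T ^ n * S⁻¹ : SL(2, ℤ)) : Matrix (Fin 2) (Fin 2) ℤ) = !![1, 0; -n, 1] := by
  ext i j
  fin_cases i <;> fin_cases j <;> simp [SL_mul_apply, coe_T_zpow, coe_S, adjugate_fin_two]

theorem slU_eq : slU = S * T ^ (-2 : ℤ) * S⁻¹ := by
  ext i j
  rw [coe_S_mul_T_zpow_mul_S_inv]
  rfl

theorem coe_slU_zpow (n : ℤ) : ((slU ^ n : SL(2, ℤ)) : Matrix (Fin 2) (Fin 2) ℤ)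
    = !![1, 0; 2 * n, 1] := by
  rw [slU_eq, conj_zpow, ← _root_.zpow_mul, coe_S_mul_T_zpow_mul_S_inv]
  simp

theorem exists_two_mul_abs_add_mul_le (a : ℤ) {c : ℤ} (hc : c ≠ 0) : ∃ n : ℤ, 2 * |a + n * c| ≤ |c| := by
  refine ⟨-round ((a : ℚ) / c), ?_⟩
  have h := abs_sub_round ((a : ℚ) / c)
  have hc' : (0 : ℚ) < |(c : ℚ)| := by positivity
  have h2 : (c : ℚ) ≠ 0 := by exact_mod_cast hc
  have h1 : |(a : ℚ) + (-round ((a : ℚ) / c) : ℤ) * c| = |(a : ℚ) / c - round ((a : ℚ) / c)| * |(c : ℚ)| := by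
    rw [← abs_mul]; congr 1; push_cast; field_simp; ring
  have h3 : 2 * |(a : ℚ) + (-round ((a : ℚ) / c) : ℤ) * c| ≤ |(c : ℚ)| := by
    rw [h1]; nlinarith
  exact_mod_cast h3

theorem mem_closure_of_mem_Gamma0_two (n : ℕ) : ∀ γ : SL(2, ℤ), (γ 1 0).natAbs ≤ n →
    Even (γ 1 0) → γ ∈ Subgroup.closure {slT, slU} := by
  have hT : slT ∈ Subgroup.closure {slT, slU} := Subgroup.subset_closure (by simp)
  have hU : slU ∈ Subgroup.closure {slT, slU} := Subgroup.subset_closure (by simp)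
  induction n with
  | zero =>
    intro γ h0 _
    have hc : γ 1 0 = 0 := by omega
    have had := γ.det_coe
    replace had : γ 0 0 * γ 1 1 = 1 := by rw [det_fin_two, hc] at had; lia
    have hneg : (-1 : SL(2, ℤ)) ∈ Subgroup.closure {slT, slU} := by
      have : (-1 : SL(2, ℤ)) = slT ^ (-1 : ℤ) * slU ^ (1 : ℤ) * (slT ^ (-1 : ℤ) * slU ^ (1 : ℤ)) := by
        ext i j
        simp only [SL_mul_apply, slT_eq, coe_T_zpow, coe_slU_zpow]
        fin_cases i <;> fin_cases j <;> simp
      rw [this]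
      have h := mul_mem (zpow_mem hT (-1)) (zpow_mem hU 1)
      exact mul_mem h h
    rcases Int.eq_one_or_neg_one_of_mul_eq_one' had with ⟨ha, hd⟩ | ⟨ha, hd⟩
    · have : γ = slT ^ (γ 0 1) := by
        rw [slT_eq]
        ext i j; fin_cases i <;> fin_cases j <;> simp [ha, hc, hd, coe_T_zpow]
      rw [this]
      exact zpow_mem hT _
    · have : γ = (-1) * slT ^ (-(γ 0 1)) := by
        rw [slT_eq, neg_one_mul]
        apply Subtype.ext
        rw [SpecialLinearGroup.coe_neg, coe_T_zpow]
        ext i j; fin_cases i <;> fin_cases j <;> simp [ha, hc, hd]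
      rw [this]
      exact mul_mem hneg (zpow_mem hT _)
  | succ n ih =>
    intro γ h0 he
    by_cases hc : γ 1 0 = 0
    · exact ih γ (by rw [hc]; simp) he
    have hdet : γ 0 0 * γ 1 1 - γ 0 1 * γ 1 0 = 1 := by
      have := γ.det_coe; rwa [det_fin_two] at this
    have hodd : Odd (γ 0 0) := by
      rw [← Int.not_even_iff_odd]
      intro h
      have h1 : Even (γ 0 0 * γ 1 1 - γ 0 1 * γ 1 0) := (h.mul_right _).sub (he.mul_left _)
      rw [hdet] at h1
      exact absurd h1 (by decide)
    obtain ⟨m, hm⟩ := exists_two_mul_abs_add_mul_le (γ 0 0) hc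
    have hodd' : Odd (γ 0 0 + m * γ 1 0) := hodd.add_even (he.mul_left _)
    have hne : 2 * (γ 0 0 + m * γ 1 0) ≠ 0 := by
      obtain ⟨w, hw⟩ := hodd'; omega
    obtain ⟨k, hk⟩ := exists_two_mul_abs_add_mul_le (γ 1 0) hne
    have e1 : (slU ^ k * (slT ^ m * γ)) 1 0 = γ 1 0 + k * (2 * (γ 0 0 + m * γ 1 0)) := by
      rw [slT_eq]
      simp only [SL_mul_apply, coe_slU_zpow, coe_T_zpow]
      simp
      ring
    have h2 := ih (slU ^ k * (slT ^ m * γ)) (by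
      rw [e1]
      rw [abs_mul] at hk
      norm_num at hk
      have h3 : 0 < |γ 1 0| := abs_pos.2 hc
      have h4 : |γ 1 0| = (γ 1 0).natAbs := by simp
      have h5 : |γ 1 0 + k * (2 * (γ 0 0 + m * γ 1 0))|
        = (γ 1 0 + k * (2 * (γ 0 0 + m * γ 1 0))).natAbs := by simp
      omega) (by rw [e1]; exact he.add ((even_two_mul _).mul_left _))
    have h3 : γ = (slT ^ m)⁻¹ * ((slU ^ k)⁻¹ * (slU ^ k * (slT ^ m * γ))) := by group
    rw [h3]
    exact mul_mem (inv_mem (zpow_mem hT _)) (mul_mem (inv_mem (zpow_mem hU _)) h2)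

/-- `Γ₀(2)` is generated by `(1 1; 0 1)` and `(1 0; 2 1)`. -/
theorem closure_genT_genU : Subgroup.closure {genT, genU} = ⊤ := by
  rw [eq_top_iff]
  rintro ⟨γ, hγ⟩ -
  have h1 := mem_closure_of_mem_Gamma0_two _ γ le_rfl (by
    rw [CongruenceSubgroup.Gamma0_mem] at hγ
    exact (ZMod.intCast_eq_zero_iff_even).1 hγ)
  have h2 : ({slT, slU} : Set SL(2, ℤ))
      = (CongruenceSubgroup.Gamma0 2).subtype '' {genT, genU} := by
    simp [Set.image_pair, genT, genU]
  rw [h2, ← MonoidHom.map_closure] at h1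
  obtain ⟨x, hx, hx'⟩ := h1
  have : x = ⟨γ, hγ⟩ := Subtype.ext hx'
  rwa [← this]

theorem genU_smul (τ : ℍ) : (genU : SL(2, ℤ)) • τ = S • (T ^ (-2 : ℤ) • (S⁻¹ • τ)) := by
  rw [smul_smul, smul_smul, ← slU_eq]; rfl

theorem exists_character {f : ℍ → ℂ} (hf : ∃ τ, f τ ≠ 0) {z : ℂ} (hz : z ≠ 0)
    (hT : ∀ τ, f ((genT : SL(2, ℤ)) • τ) = z * f τ)
    (hU : ∀ τ, f ((genU : SL(2, ℤ)) • τ) = z * f τ) :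
    ∃ v : CongruenceSubgroup.Gamma0 2 →* ℂˣ, (v genT : ℂ) = z ∧ (v genU : ℂ) = z ∧
      ∀ (γ : CongruenceSubgroup.Gamma0 2) (τ : ℍ), f ((γ : SL(2, ℤ)) • τ) = (v γ : ℂ) * f τ := by
  have key : ∀ γ : CongruenceSubgroup.Gamma0 2, ∃ c : ℂˣ, ∀ τ : ℍ,
      f ((γ : SL(2, ℤ)) • τ) = (c : ℂ) * f τ := by
    intro γ
    have hγ : γ ∈ Subgroup.closure {genT, genU} := by rw [closure_genT_genU]; trivial
    induction hγ using Subgroup.closure_induction with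
    | mem x hx =>
      rcases hx with rfl | rfl
      · exact ⟨Units.mk0 z hz, hT⟩
      · exact ⟨Units.mk0 z hz, hU⟩
    | one => exact ⟨1, by simp⟩
    | mul x y _ _ hx hy =>
      obtain ⟨c, hc⟩ := hx
      obtain ⟨d, hd⟩ := hy
      refine ⟨c * d, fun τ => ?_⟩
      rw [Subgroup.coe_mul, mul_smul, hc, hd, Units.val_mul, mul_assoc]
    | inv x _ hx =>
      obtain ⟨c, hc⟩ := hx
      refine ⟨c⁻¹, fun τ => ?_⟩
      have := hc ((x : SL(2, ℤ))⁻¹ • τ)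
      rw [smul_inv_smul] at this
      rw [Subgroup.coe_inv, this, ← mul_assoc, Units.inv_mul, one_mul]
  choose v hv using key
  obtain ⟨τ₀, h0⟩ := hf
  have uniq : ∀ (γ : CongruenceSubgroup.Gamma0 2) (c : ℂ),
      (∀ τ, f ((γ : SL(2, ℤ)) • τ) = c * f τ) → (v γ : ℂ) = c := fun γ c h =>
    mul_right_cancel₀ h0 ((hv γ τ₀).symm.trans (h τ₀))
  refine ⟨MonoidHom.mk' v fun a b => Units.ext ?_, uniq _ _ hT, uniq _ _ hU, hv⟩
  refine uniq _ _ fun τ => ?_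
  rw [Subgroup.coe_mul, mul_smul, hv, hv, Units.val_mul, mul_assoc]

theorem character_unique {v w : CongruenceSubgroup.Gamma0 2 →* ℂˣ}
    (hT : (w genT : ℂ) = v genT) (hU : (w genU : ℂ) = v genU) : w = v := by
  refine MonoidHom.eq_of_eqOn_dense closure_genT_genU ?_
  rintro x (rfl | rfl)
  exacts [Units.ext hT, Units.ext hU]

theorem character_norm {v : CongruenceSubgroup.Gamma0 2 →* ℂˣ}
    (hT : ‖(v genT : ℂ)‖ = 1) (hU : ‖(v genU : ℂ)‖ = 1) (γ) : ‖(v γ : ℂ)‖ = 1 := by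
  have hγ : γ ∈ Subgroup.closure {genT, genU} := by rw [closure_genT_genU]; trivial
  induction hγ using Subgroup.closure_induction with
  | mem x hx => rcases hx with rfl | rfl <;> assumption
  | one => simp
  | mul x y _ _ hx hy => simp [hx, hy]
  | inv x _ hx => simp [hx]

theorem zeta_ne_zero (n : ℕ) : zeta n ≠ 0 := Complex.exp_ne_zero _

theorem zeta_pow_eq_e (n k : ℕ) : zeta n ^ k = e (k / n) := by
  rw [zeta, e, ← Complex.exp_nat_mul]; congr 1; ring

theorem zeta_zpow_eq_e (n : ℕ) (k : ℤ) : zeta n ^ k = e (k / n) := by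
  rw [zeta, e, ← Complex.exp_int_mul]; congr 1; ring

theorem e_add (x y : ℂ) : e (x + y) = e x * e y := by
  rw [e, e, e, ← Complex.exp_add]; congr 1; ring

theorem zeta_eq_e (n : ℕ) : zeta n = e (1 / n) := by simpa using zeta_pow_eq_e n 1

theorem norm_zeta (n : ℕ) : ‖zeta n‖ = 1 := by
  rw [zeta, show (2 * Real.pi * Complex.I / n : ℂ) = ((2 * Real.pi / n : ℝ) : ℂ) * Complex.I by
    push_cast; ring]
  exact Complex.norm_exp_ofReal_mul_I _

theorem zeta_48_mul : zeta 48 ^ 5 * zeta 48 ^ (-7 : ℤ) = (zeta 24)⁻¹ := by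
  refine eq_inv_of_mul_eq_one_left ?_
  rw [zeta_pow_eq_e, zeta_zpow_eq_e, zeta_eq_e, ← e_add,
    ← e_add, e]
  norm_num

theorem zeta_24_pow_three_ne_one : zeta 24 ^ 3 ≠ 1 := by
  rw [zeta_pow_eq_e, e]
  intro h
  have h1 := congrArg Complex.re h
  rw [show (2 * Real.pi * Complex.I * ((3 : ℕ) / (24 : ℕ)) : ℂ)
    = ((Real.pi / 4 : ℝ) : ℂ) * Complex.I by push_cast; ring, Complex.exp_ofReal_mul_I_re,
    Real.cos_pi_div_four] at h1
  have h2 : (Real.sqrt 2) ^ 2 = 2 := Real.sq_sqrt (by norm_num)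
  simp at h1
  nlinarith

theorem matT_mulVec (x : Fin 3 → ℂ) :
    matT *ᵥ x = ![zeta 24 * x 0, zeta 48 ^ 5 * x 2, zeta 48 ^ (-7 : ℤ) * x 1] := by
  funext i
  fin_cases i <;> simp [matT, Matrix.mulVec, dotProduct, Fin.sum_univ_three]

theorem matS_mulVec (x : Fin 3 → ℂ) : matS *ᵥ x = ![x 1, x 0, x 2] := by
  funext i
  fin_cases i <;> simp [matS, Matrix.mulVec, dotProduct, Fin.sum_univ_three]

theorem isUnit_matT : IsUnit matT := by
  rw [Matrix.isUnit_iff_isUnit_det, isUnit_iff_ne_zero, det_fin_three]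
  simp [matT, zeta_ne_zero]

theorem matS_mul_self : matS * matS = 1 := by
  ext i j
  fin_cases i <;> fin_cases j <;> simp [matS, Matrix.mul_apply, Fin.sum_univ_three]

theorem vec_T_T {F : ℍ → Fin 3 → ℂ} (hT : ∀ τ : ℍ, F (T • τ) = matT *ᵥ F τ) (τ : ℍ) :
    F (T • (T • τ)) = ![zeta 24 ^ 2 * F τ 0, (zeta 24)⁻¹ * F τ 1, (zeta 24)⁻¹ * F τ 2] := by
  rw [hT, hT, matT_mulVec, matT_mulVec, ← zeta_48_mul]
  funext i
  fin_cases i <;> simp <;> ring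

theorem zeta_24_sq_ne : zeta 24 ^ 2 - (zeta 24)⁻¹ ≠ 0 := by
  intro h
  apply zeta_24_pow_three_ne_one
  have h0 := zeta_ne_zero 24
  field_simp at h
  linear_combination h

/-- The components of a vector-valued form for `matT`, `matS` are linearly independent as soon as
the first one does not vanish identically. -/
theorem vec_linearIndependent {F : ℍ → Fin 3 → ℂ} (hT : ∀ τ : ℍ, F (T • τ) = matT *ᵥ F τ)
    (hS : ∀ τ : ℍ, F (S • τ) = matS *ᵥ F τ) (h0 : ∃ τ, F τ 0 ≠ 0) (r : Fin 3 → ℂ)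
    (hr : ∀ τ, r 0 * F τ 0 + r 1 * F τ 1 + r 2 * F τ 2 = 0) : r = 0 := by
  obtain ⟨τ₀, h0⟩ := h0
  have hc := zeta_24_sq_ne
  have r0 : r 0 = 0 := by
    have h1 := hr (T • (T • τ₀))
    rw [vec_T_T hT] at h1
    simp only [cons_val_zero, cons_val_one, cons_val] at h1
    have h2 : (zeta 24 ^ 2 - (zeta 24)⁻¹) * F τ₀ 0 * r 0 = 0 := by
      linear_combination h1 - (zeta 24)⁻¹ * hr τ₀
    simpa [hc, h0] using h2
  have hr' : ∀ τ, r 1 * F τ 0 + r 2 * F τ 2 = 0 := by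
    intro τ
    have h1 := hr (S • τ)
    rw [hS, matS_mulVec, r0] at h1
    simpa using h1
  have r1 : r 1 = 0 := by
    have h1 := hr' (T • (T • τ₀))
    rw [vec_T_T hT] at h1
    simp only [cons_val_zero, cons_val] at h1
    have h2 : (zeta 24 ^ 2 - (zeta 24)⁻¹) * F τ₀ 0 * r 1 = 0 := by
      linear_combination h1 - (zeta 24)⁻¹ * hr' τ₀
    simpa [hc, h0] using h2
  have r2 : r 2 = 0 := by
    have h1 := hr' (T • (S • τ₀))
    rw [hT, hS, matT_mulVec, matS_mulVec, r1] at h1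
    simpa [zeta_ne_zero, h0] using h1
  funext i
  fin_cases i <;> assumption

theorem exists_representation {F : ℍ → Fin 3 → ℂ} (hT : ∀ τ : ℍ, F (T • τ) = matT *ᵥ F τ)
    (hS : ∀ τ : ℍ, F (S • τ) = matS *ᵥ F τ) (h0 : ∃ τ, F τ 0 ≠ 0) :
    ∃ ρ : SL(2, ℤ) →* Matrix (Fin 3) (Fin 3) ℂ, ρ T = matT ∧ ρ S = matS ∧
      ∀ (γ : SL(2, ℤ)) (τ : ℍ), F (γ • τ) = ρ γ *ᵥ F τ := by
  have key : ∀ γ : SL(2, ℤ), ∃ M : (Matrix (Fin 3) (Fin 3) ℂ)ˣ, ∀ τ : ℍ,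
      F (γ • τ) = (M : Matrix (Fin 3) (Fin 3) ℂ) *ᵥ F τ := by
    intro γ
    have hγ : γ ∈ Subgroup.closure {S, T} := by rw [SpecialLinearGroup.SL2Z_generators]; trivial
    induction hγ using Subgroup.closure_induction with
    | mem x hx =>
      rcases hx with rfl | rfl
      · exact ⟨⟨matS, matS, matS_mul_self, matS_mul_self⟩, hS⟩
      · exact ⟨isUnit_matT.unit, hT⟩
    | one => exact ⟨1, by simp⟩
    | mul x y _ _ hx hy =>
      obtain ⟨c, hc⟩ := hx
      obtain ⟨d, hd⟩ := hy
      refine ⟨c * d, fun τ => ?_⟩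
      rw [mul_smul, hc, hd, Units.val_mul, mulVec_mulVec]
    | inv x _ hx =>
      obtain ⟨c, hc⟩ := hx
      refine ⟨c⁻¹, fun τ => ?_⟩
      have := hc (x⁻¹ • τ)
      rw [smul_inv_smul] at this
      rw [this, mulVec_mulVec, Units.inv_mul, one_mulVec]
  choose v hv using key
  have uniq : ∀ (γ : SL(2, ℤ)) (M : Matrix (Fin 3) (Fin 3) ℂ),
      (∀ τ, F (γ • τ) = M *ᵥ F τ) → (v γ : Matrix (Fin 3) (Fin 3) ℂ) = M := by
    intro γ M hM
    have h1 : ∀ i, (fun j => (v γ : Matrix (Fin 3) (Fin 3) ℂ) i j - M i j) = 0 := by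
      intro i
      refine vec_linearIndependent hT hS h0 _ fun τ => ?_
      have h2 := congrFun ((hv γ τ).symm.trans (hM τ)) i
      simp only [mulVec, dotProduct, Fin.sum_univ_three] at h2
      linear_combination h2
    ext i j
    exact sub_eq_zero.1 (congrFun (h1 i) j)
  refine ⟨⟨⟨fun γ => v γ, uniq _ _ fun τ => by simp⟩, fun a b => uniq _ _ fun τ => ?_⟩,
    uniq _ _ hT, uniq _ _ hS, hv⟩
  rw [mul_smul, hv, hv, mulVec_mulVec]

theorem vec_genU {F : ℍ → Fin 3 → ℂ} (hT : ∀ τ : ℍ, F (T • τ) = matT *ᵥ F τ)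
    (hS : ∀ τ : ℍ, F (S • τ) = matS *ᵥ F τ) (τ : ℍ) :
    F ((genU : SL(2, ℤ)) • τ) 0 = zeta 24 * F τ 0 := by
  rw [genU_smul, hS, matS_mulVec]
  have h1 := congrFun (vec_T_T hT (T ^ (-2 : ℤ) • (S⁻¹ • τ))) 1
  have h2 : T • T • T ^ (-2 : ℤ) • S⁻¹ • τ = S⁻¹ • τ := by
    rw [smul_smul, smul_smul, show T * T * T ^ (-2 : ℤ) = 1 by group, one_smul]
  rw [h2] at h1
  have h3 := congrFun (hS (S⁻¹ • τ)) 0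
  rw [smul_inv_smul, matS_mulVec] at h3
  simp only [cons_val_zero, cons_val_one] at h1 h3 ⊢
  rw [h3, h1, ← mul_assoc, mul_inv_cancel₀ (zeta_ne_zero _), one_mul]

end Groups
end CohenMaass
end

noncomputable section
namespace CohenMaass
open Matrix UpperHalfPlane MeasureTheory

section Bessel

open Set Filter Topology

/-- The moments `∫₀^∞ cosh(u)^m e^{-x cosh u} du`; up to sign these are the derivatives of `K₀`. -/
def besselMoment (m : ℕ) (x : ℝ) : ℝ :=
  ∫ u in Ioi (0 : ℝ), Real.cosh u ^ m * Real.exp (-x * Real.cosh u)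

theorem besselMoment_zero (x : ℝ) : besselMoment 0 x = besselK0 x := by
  simp [besselMoment, besselK0]

theorem pow_mul_exp_neg_le (m : ℕ) {x c : ℝ} (hx : 0 < x) (hc : 0 ≤ c) :
    c ^ m * Real.exp (-x * c) ≤ m.factorial * (2 / x) ^ m * Real.exp (-(x / 2) * c) := by
  have h := Real.pow_div_factorial_le_exp (x / 2 * c) (by positivity) m
  have h1 : c ^ m ≤ m.factorial * (2 / x) ^ m * Real.exp (x / 2 * c) := by
    rw [div_le_iff₀ (by positivity)] at h
    calc c ^ m = (2 / x) ^ m * (x / 2 * c) ^ m := by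
          rw [← mul_pow]; congr 1; field_simp
      _ ≤ (2 / x) ^ m * (Real.exp (x / 2 * c) * m.factorial) := by gcongr
      _ = _ := by ring
  calc c ^ m * Real.exp (-x * c)
      ≤ (m.factorial * (2 / x) ^ m * Real.exp (x / 2 * c)) * Real.exp (-x * c) := by gcongr
    _ = _ := by rw [mul_assoc, ← Real.exp_add]; congr 2; ring

theorem le_cosh_of_nonneg {u : ℝ} (hu : 0 ≤ u) : u ≤ Real.cosh u :=
  (Real.self_le_sinh_iff.2 hu).trans (Real.sinh_lt_cosh u).le

theorem besselMoment_integrand_le (m : ℕ) {x u : ℝ} (hx : 0 < x) (hu : 0 ≤ u) :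
    Real.cosh u ^ m * Real.exp (-x * Real.cosh u)
      ≤ m.factorial * (2 / x) ^ m * Real.exp (-(x / 2) * u) := by
  refine (pow_mul_exp_neg_le m hx (Real.cosh_pos u).le).trans ?_
  have := le_cosh_of_nonneg hu
  gcongr _ * ?_
  apply Real.exp_le_exp.2
  nlinarith

theorem besselMoment_integrableOn (m : ℕ) {x : ℝ} (hx : 0 < x) :
    IntegrableOn (fun u => Real.cosh u ^ m * Real.exp (-x * Real.cosh u)) (Ioi 0) := by
  refine Integrable.mono' ((exp_neg_integrableOn_Ioi 0 (half_pos hx)).const_mul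
    (m.factorial * (2 / x) ^ m)) (Continuous.aestronglyMeasurable (by fun_prop)) ?_
  refine (ae_restrict_mem measurableSet_Ioi).mono fun u hu => ?_
  have h := Real.cosh_pos u
  rw [Real.norm_of_nonneg (by positivity)]
  exact besselMoment_integrand_le m hx (le_of_lt hu)

theorem besselMoment_nonneg (m : ℕ) (x : ℝ) : 0 ≤ besselMoment m x :=
  integral_nonneg fun u => by
    have := Real.cosh_pos u
    simp only [Pi.zero_apply]
    positivity

theorem besselMoment_le (m : ℕ) {δ x : ℝ} (hδ : 0 < δ) (hx : δ ≤ x) :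
    besselMoment m x ≤ besselMoment m (δ / 2) * Real.exp (-(x / 2)) := by
  rw [besselMoment, besselMoment, ← integral_mul_const]
  refine setIntegral_mono_on (besselMoment_integrableOn m (by linarith))
    ((besselMoment_integrableOn m (half_pos hδ)).mul_const _) measurableSet_Ioi fun u _ => ?_
  rw [mul_assoc, ← Real.exp_add]
  have := Real.cosh_pos u
  have h1 := Real.one_le_cosh u
  gcongr _ * ?_
  apply Real.exp_le_exp.2
  nlinarith

theorem hasDerivAt_besselMoment (m : ℕ) {x : ℝ} (hx : 0 < x) :
    HasDerivAt (besselMoment m) (-besselMoment (m + 1) x) x := by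
  have key := hasDerivAt_integral_of_dominated_loc_of_deriv_le (μ := volume.restrict (Ioi (0 : ℝ)))
    (F := fun y u => Real.cosh u ^ m * Real.exp (-y * Real.cosh u))
    (F' := fun y u => -(Real.cosh u ^ (m + 1) * Real.exp (-y * Real.cosh u)))
    (bound := fun u => Real.cosh u ^ (m + 1) * Real.exp (-(x / 2) * Real.cosh u))
    (x₀ := x) (s := Ioi (x / 2)) (Ioi_mem_nhds (by linarith))
    (Eventually.of_forall fun y => Continuous.aestronglyMeasurable (by fun_prop))
    (besselMoment_integrableOn m hx) (Continuous.aestronglyMeasurable (by fun_prop))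
    (Eventually.of_forall fun u y hy => ?_) (besselMoment_integrableOn (m + 1) (half_pos hx))
    (Eventually.of_forall fun u y hy => ?_)
  · have h := key.2
    rwa [integral_neg] at h
  · have h := Real.cosh_pos u
    rw [norm_neg, Real.norm_of_nonneg (by positivity)]
    gcongr _ * ?_
    apply Real.exp_le_exp.2
    have : x / 2 < y := hy
    nlinarith
  · have h1 : HasDerivAt (fun y : ℝ => -y * Real.cosh u) (-1 * Real.cosh u) y :=
      (hasDerivAt_id y).neg.mul_const _
    exact (h1.exp.const_mul (Real.cosh u ^ m)).congr_deriv (by ring)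

/-- The Bessel equation `x (K₀'' - K₀) = -K₀'`. -/
theorem besselMoment_equation {x : ℝ} (hx : 0 < x) :
    x * (besselMoment 2 x - besselMoment 0 x) = besselMoment 1 x := by
  have h0 := besselMoment_integrableOn 0 hx
  have h1 := besselMoment_integrableOn 1 hx
  have h2 := besselMoment_integrableOn 2 hx
  have hd : ∀ u ∈ Ioi (0 : ℝ), HasDerivAt (fun u => Real.sinh u * Real.exp (-x * Real.cosh u))
      (Real.cosh u ^ 1 * Real.exp (-x * Real.cosh u) - x * (Real.cosh u ^ 2
        * Real.exp (-x * Real.cosh u) - Real.cosh u ^ 0 * Real.exp (-x * Real.cosh u))) u := by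
    intro u _
    have e1 : HasDerivAt (fun u : ℝ => -x * Real.cosh u) (-x * Real.sinh u) u :=
      (Real.hasDerivAt_cosh u).const_mul _
    refine ((Real.hasDerivAt_sinh u).mul e1.exp).congr_deriv ?_
    rw [Real.cosh_sq]
    ring
  have hlim : Tendsto (fun u => Real.sinh u * Real.exp (-x * Real.cosh u)) atTop (𝓝 0) := by
    have hg : Tendsto (fun u : ℝ => (Nat.factorial 1) * (2 / x) ^ 1 * Real.exp (-(x / 2) * u))
        atTop (𝓝 0) := by
      have h3 : Tendsto (fun u : ℝ => Real.exp (-(x / 2) * u)) atTop (𝓝 0) :=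
        Real.tendsto_exp_atBot.comp (tendsto_id.const_mul_atTop_of_neg (by linarith))
      simpa only [mul_zero] using h3.const_mul ((Nat.factorial 1 : ℝ) * (2 / x) ^ 1)
    refine squeeze_zero' ?_ ?_ hg
    · filter_upwards [eventually_ge_atTop 0] with u hu
      exact mul_nonneg (Real.sinh_nonneg_iff.2 hu) (Real.exp_pos _).le
    · filter_upwards [eventually_ge_atTop 0] with u hu
      refine le_trans ?_ (besselMoment_integrand_le 1 hx hu)
      rw [pow_one]
      gcongr
      exact (Real.sinh_lt_cosh u).le
  have key := integral_Ioi_of_hasDerivAt_of_tendsto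
    (Continuous.continuousWithinAt (by fun_prop)) hd (h1.sub ((h2.sub h0).const_mul x)) hlim
  have e1 := integral_sub h1 ((h2.sub h0).const_mul x)
  have e2 := integral_sub h2 h0
  simp only [Pi.sub_apply, integral_const_mul] at e1 e2
  rw [e1, e2] at key
  simp only [Real.sinh_zero, zero_mul, sub_zero] at key
  rw [besselMoment, besselMoment, besselMoment]
  linarith

theorem exp_le_besselK0 {x : ℝ} (hx : 0 < x) : Real.exp (-(Real.cosh 1 * x)) ≤ besselK0 x := by
  rw [← besselMoment_zero]
  have h0 := besselMoment_integrableOn 0 hx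
  calc Real.exp (-(Real.cosh 1 * x)) = ∫ _ in Ioc (0 : ℝ) 1, Real.exp (-(Real.cosh 1 * x)) := by
        simp
    _ ≤ ∫ u in Ioc (0 : ℝ) 1, Real.cosh u ^ 0 * Real.exp (-x * Real.cosh u) := by
        refine setIntegral_mono_on (by simp) (h0.mono_set Ioc_subset_Ioi_self)
          measurableSet_Ioc fun u hu => ?_
        rw [pow_zero, one_mul]
        apply Real.exp_le_exp.2
        have : Real.cosh u ≤ Real.cosh 1 := by
          rw [Real.cosh_le_cosh, abs_of_pos hu.1, abs_one]; exact hu.2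
        nlinarith
    _ ≤ _ := by
        refine setIntegral_mono_set h0 (Eventually.of_forall fun u => ?_)
          (Ioc_subset_Ioi_self.eventuallyLE)
        have := Real.cosh_pos u
        simp only [Pi.zero_apply]
        positivity

end Bessel

section BesselSeries

open Set Filter Topology

variable {ι : Type*}

/-- The summand `a e^{iλx} K^{(m)}(|λ|y)` as a function of `z = x + iy`. -/
def besselWave (a : ℂ) (l : ℝ) (m : ℕ) (z : ℂ) : ℂ :=
  a * Complex.exp (Complex.I * l * z.re) * (besselMoment m (|l| * z.im) : ℂ)

/-- `∑ aᵢ e^{iλᵢx} K^{(m)}(|λᵢ|y)` as a function of `z = x + iy`. -/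
def besselSeries (a : ι → ℂ) (l : ι → ℝ) (m : ℕ) (z : ℂ) : ℂ := ∑' i, besselWave (a i) (l i) m z

/-- The real-linear form with partial derivatives `g` and `h`. -/
def partials (g h : ℂ) : ℂ →L[ℝ] ℂ := Complex.reCLM.smulRight g + Complex.imCLM.smulRight h

theorem partials_apply (g h z : ℂ) : partials g h z = z.re * g + z.im * h := by
  simp [partials]

theorem norm_partials_le (g h : ℂ) : ‖partials g h‖ ≤ ‖g‖ + ‖h‖ := by
  refine (norm_add_le _ _).trans ?_
  rw [ContinuousLinearMap.norm_smulRight_apply, ContinuousLinearMap.norm_smulRight_apply]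
  simp

theorem hasSum_partials {g h : ι → ℂ} {G H : ℂ} (hg : HasSum g G) (hh : HasSum h H) :
    HasSum (fun i => partials (g i) (h i)) (partials G H) :=
  (hg.mapL (ContinuousLinearMap.smulRightL ℝ ℂ ℂ Complex.reCLM)).add
    (hh.mapL (ContinuousLinearMap.smulRightL ℝ ℂ ℂ Complex.imCLM))

/-- Coefficients for which the Bessel series and all its derivatives converge. -/
structure Admissible (a : ι → ℂ) (l : ι → ℝ) : Prop where
  summable : ∀ c > 0, Summable fun i => ‖a i‖ * Real.exp (-(c * |l i|))
  gap : ∃ ε > 0, ∀ i, ε ≤ |l i|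

theorem Admissible.mul_left {a : ι → ℂ} {l : ι → ℝ} (h : Admissible a l) {w : ι → ℂ}
    (hw : ∀ i, ‖w i‖ ≤ |l i|) : Admissible (fun i => w i * a i) l := by
  refine ⟨fun c hc => ?_, h.gap⟩
  refine Summable.of_nonneg_of_le (fun i => by positivity) (fun i => ?_)
    ((h.summable (c / 2) (half_pos hc)).mul_left (2 / c))
  have h1 := pow_mul_exp_neg_le 1 hc (abs_nonneg (l i))
  simp only [pow_one, Nat.factorial_one, Nat.cast_one, one_mul, neg_mul] at h1
  calc ‖w i * a i‖ * Real.exp (-(c * |l i|))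
      ≤ |l i| * ‖a i‖ * Real.exp (-(c * |l i|)) := by rw [norm_mul]; gcongr; exact hw i
    _ = ‖a i‖ * (|l i| * Real.exp (-(c * |l i|))) := by ring
    _ ≤ ‖a i‖ * (2 / c * Real.exp (-(c / 2 * |l i|))) := by gcongr
    _ = _ := by ring

theorem norm_besselWave (a : ℂ) (l : ℝ) (m : ℕ) (z : ℂ) :
    ‖besselWave a l m z‖ = ‖a‖ * besselMoment m (|l| * z.im) := by
  rw [besselWave, norm_mul, norm_mul, Complex.norm_real, Real.norm_of_nonneg (besselMoment_nonneg _ _),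
    show Complex.I * l * z.re = ((l * z.re : ℝ) : ℂ) * Complex.I by push_cast; ring,
    Complex.norm_exp_ofReal_mul_I, mul_one]

theorem norm_besselWave_le (a : ℂ) {l : ℝ} (m : ℕ) {z : ℂ} {ε δ : ℝ} (hε : 0 < ε) (hl : ε ≤ |l|)
    (hδ : 0 < δ) (hz : δ ≤ z.im) : ‖besselWave a l m z‖
      ≤ besselMoment m (ε * δ / 2) * (‖a‖ * Real.exp (-(δ / 2 * |l|))) := by
  rw [norm_besselWave]
  have h1 : ε * δ ≤ |l| * z.im := by gcongr
  have h2 := besselMoment_le m (mul_pos hε hδ) h1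
  have h3 : Real.exp (-(|l| * z.im / 2)) ≤ Real.exp (-(δ / 2 * |l|)) := by
    apply Real.exp_le_exp.2; nlinarith [abs_nonneg l]
  have h4 := besselMoment_nonneg m (ε * δ / 2)
  calc ‖a‖ * besselMoment m (|l| * z.im)
      ≤ ‖a‖ * (besselMoment m (ε * δ / 2) * Real.exp (-(|l| * z.im / 2))) := by gcongr
    _ ≤ ‖a‖ * (besselMoment m (ε * δ / 2) * Real.exp (-(δ / 2 * |l|))) := by gcongr
    _ = _ := by ring

theorem hasFDerivAt_besselWave (a : ℂ) {l : ℝ} (hl : l ≠ 0) (m : ℕ) {z : ℂ} (hz : 0 < z.im) :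
    HasFDerivAt (besselWave a l m) (partials (besselWave (Complex.I * l * a) l m z)
      (besselWave (-(|l| : ℝ) * a) l (m + 1) z)) z := by
  have hre : HasFDerivAt (fun z : ℂ => (z.re : ℂ)) (Complex.ofRealCLM.comp Complex.reCLM) z :=
    (Complex.ofRealCLM.comp Complex.reCLM).hasFDerivAt
  have h1 : HasFDerivAt (fun z : ℂ => Complex.exp (Complex.I * l * z.re)) _ z :=
    (hre.const_mul (Complex.I * l)).cexp
  have h2 : HasFDerivAt (fun z : ℂ => |l| * z.im) (|l| • Complex.imCLM) z :=
    (Complex.imCLM.hasFDerivAt (x := z)).const_mul |l|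
  have h3 := (hasDerivAt_besselMoment m (by positivity : 0 < |l| * z.im)).comp_hasFDerivAt z h2
  have h4 : HasFDerivAt (fun z : ℂ => (besselMoment m (|l| * z.im) : ℂ)) _ z :=
    (Complex.ofRealCLM.hasFDerivAt).comp z h3
  refine ((h1.const_mul a).mul h4).congr_fderiv ?_
  ext w
  simp [partials_apply, besselWave]
  ring

theorem Admissible.summable_besselWave {a : ι → ℂ} {l : ι → ℝ} (h : Admissible a l) (m : ℕ) {z : ℂ}
    (hz : 0 < z.im) : Summable fun i => besselWave (a i) (l i) m z := by
  obtain ⟨ε, hε, hl⟩ := h.gap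
  exact Summable.of_norm_bounded ((h.summable _ (half_pos hz)).mul_left _)
    fun i => norm_besselWave_le (a i) m hε (hl i) hz le_rfl

theorem Admissible.dx {a : ι → ℂ} {l : ι → ℝ} (h : Admissible a l) :
    Admissible (fun i => Complex.I * l i * a i) l := h.mul_left fun i => by simp

theorem Admissible.dy {a : ι → ℂ} {l : ι → ℝ} (h : Admissible a l) :
    Admissible (fun i => -(|l i| : ℝ) * a i) l := h.mul_left fun i => by simp

theorem Admissible.hasFDerivAt_besselSeries {a : ι → ℂ} {l : ι → ℝ} (h : Admissible a l) (m : ℕ)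
    {z : ℂ} (hz : 0 < z.im) : HasFDerivAt (besselSeries a l m)
      (partials (besselSeries (fun i => Complex.I * l i * a i) l m z)
        (besselSeries (fun i => -(|l i| : ℝ) * a i) l (m + 1) z)) z := by
  obtain ⟨ε, hε, hl⟩ := h.gap
  have hsum := hasSum_partials (h.dx.summable_besselWave m hz).hasSum
    (h.dy.summable_besselWave (m + 1) hz).hasSum
  rw [besselSeries, besselSeries, ← hsum.tsum_eq]
  have hδ : 0 < z.im / 2 := half_pos hz
  have hl0 : ∀ i, l i ≠ 0 := fun i => abs_pos.1 (hε.trans_le (hl i))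
  refine hasFDerivAt_tsum_of_isPreconnected (s := {w : ℂ | z.im / 2 < w.im})
    (f := fun i => besselWave (a i) (l i) m)
    (f' := fun i w => partials (besselWave (Complex.I * l i * a i) (l i) m w)
      (besselWave (-(|l i| : ℝ) * a i) (l i) (m + 1) w)) (x₀ := z)
    (((h.dx.summable _ (half_pos hδ)).mul_left (besselMoment m (ε * (z.im / 2) / 2))).add
      ((h.dy.summable _ (half_pos hδ)).mul_left (besselMoment (m + 1) (ε * (z.im / 2) / 2))))
    (isOpen_lt continuous_const Complex.continuous_im)
    (convex_halfSpace_im_gt _).isPreconnected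
    (fun i w hw => hasFDerivAt_besselWave _ (hl0 i) m (hδ.trans hw))
    (fun i w hw => (norm_partials_le _ _).trans (add_le_add ?_ ?_))
    (by simp [hz]) (h.summable_besselWave m hz) (by simp [hz])
  · exact norm_besselWave_le _ m hε (hl i) hδ (le_of_lt hw)
  · exact norm_besselWave_le _ (m + 1) hε (hl i) hδ (le_of_lt hw)

theorem isOpen_upperHalf : IsOpen {z : ℂ | 0 < z.im} :=
  isOpen_lt continuous_const Complex.continuous_im

theorem contDiffOn_partials {g h : ℂ → ℂ} {s : Set ℂ} {n : WithTop ℕ∞} (hg : ContDiffOn ℝ n g s)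
    (hh : ContDiffOn ℝ n h s) : ContDiffOn ℝ n (fun z => partials (g z) (h z)) s :=
  ((ContinuousLinearMap.smulRightL ℝ ℂ ℂ Complex.reCLM).contDiff.comp_contDiffOn hg).add
    ((ContinuousLinearMap.smulRightL ℝ ℂ ℂ Complex.imCLM).contDiff.comp_contDiffOn hh)

theorem Admissible.contDiffOn_besselSeries (n : ℕ) : ∀ {a : ι → ℂ} {l : ι → ℝ}
    (_ : Admissible a l) (m : ℕ), ContDiffOn ℝ n (besselSeries a l m) {z : ℂ | 0 < z.im} := by
  induction n with
  | zero =>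
    intro a l h m
    rw [Nat.cast_zero, contDiffOn_zero]
    exact fun z hz => (h.hasFDerivAt_besselSeries m hz).continuousAt.continuousWithinAt
  | succ n ih =>
    intro a l h m
    rw [Nat.cast_succ, contDiffOn_succ_iff_fderiv_of_isOpen isOpen_upperHalf]
    refine ⟨fun z hz =>
      (h.hasFDerivAt_besselSeries m hz).differentiableAt.differentiableWithinAt, by simp, ?_⟩
    refine (contDiffOn_partials (ih h.dx m) (ih h.dy (m + 1))).congr fun z hz => ?_
    exact (h.hasFDerivAt_besselSeries m hz).fderiv

theorem laplacian_eq_of_partials {f g h : ℂ → ℂ} {z g₁ g₂ h₁ h₂ : ℂ} (hz : 0 < z.im)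
    (hf : ∀ w : ℂ, 0 < w.im → HasFDerivAt f (partials (g w) (h w)) w)
    (hg : HasFDerivAt g (partials g₁ g₂) z) (hh : HasFDerivAt h (partials h₁ h₂) z) :
    Laplacian.laplacian f z = g₁ + h₂ := by
  have h1 : fderiv ℝ f =ᶠ[𝓝 z] fun w => partials (g w) (h w) := by
    filter_upwards [isOpen_upperHalf.mem_nhds hz] with w hw
    exact (hf w hw).fderiv
  have h2 : HasFDerivAt (fun w => partials (g w) (h w))
      ((ContinuousLinearMap.smulRightL ℝ ℂ ℂ Complex.reCLM).comp (partials g₁ g₂)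
        + (ContinuousLinearMap.smulRightL ℝ ℂ ℂ Complex.imCLM).comp (partials h₁ h₂)) z :=
    ((ContinuousLinearMap.smulRightL ℝ ℂ ℂ Complex.reCLM).hasFDerivAt.comp z hg).add
      ((ContinuousLinearMap.smulRightL ℝ ℂ ℂ Complex.imCLM).hasFDerivAt.comp z hh)
  rw [InnerProductSpace.laplacian_eq_iteratedFDeriv_complexPlane]
  simp only [iteratedFDeriv_two_apply, h1.fderiv_eq, h2.fderiv]
  simp [partials_apply]

theorem hasFDerivAt_sqrt_im {z : ℂ} (hz : 0 < z.im) :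
    HasFDerivAt (fun w : ℂ => (Real.sqrt w.im : ℂ)) (partials 0 (1 / (2 * Real.sqrt z.im))) z := by
  have h1 := (Real.hasDerivAt_sqrt hz.ne').comp_hasFDerivAt z (Complex.imCLM.hasFDerivAt (x := z))
  have h2 : HasFDerivAt (fun w : ℂ => (Real.sqrt w.im : ℂ)) _ z :=
    (Complex.ofRealCLM.hasFDerivAt).comp z h1
  refine h2.congr_fderiv ?_
  ext w
  simp [partials_apply]
  ring

theorem hasFDerivAt_mul_partials {f g : ℂ → ℂ} {z f₁ f₂ g₁ g₂ : ℂ}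
    (hf : HasFDerivAt f (partials f₁ f₂) z) (hg : HasFDerivAt g (partials g₁ g₂) z) :
    HasFDerivAt (fun w => f w * g w) (partials (f z * g₁ + f₁ * g z) (f z * g₂ + f₂ * g z)) z := by
  refine (hf.mul hg).congr_fderiv ?_
  ext w
  simp [partials_apply]
  ring

theorem hasFDerivAt_add_partials {f g : ℂ → ℂ} {z f₁ f₂ g₁ g₂ : ℂ}
    (hf : HasFDerivAt f (partials f₁ f₂) z) (hg : HasFDerivAt g (partials g₁ g₂) z) :
    HasFDerivAt (fun w => f w + g w) (partials (f₁ + g₁) (f₂ + g₂)) z := by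
  refine (hf.add hg).congr_fderiv ?_
  ext w
  simp [partials_apply]
  ring

theorem hasFDerivAt_half_inv_sqrt_im {z : ℂ} (hz : 0 < z.im) :
    HasFDerivAt (fun w : ℂ => (1 / (2 * Real.sqrt w.im) : ℂ))
      (partials 0 (-1 / (4 * z.im * Real.sqrt z.im))) z := by
  have hs : Real.sqrt z.im ≠ 0 := (Real.sqrt_pos.2 hz).ne'
  have h0 : HasDerivAt (fun y : ℝ => 1 / (2 * Real.sqrt y)) (-1 / (4 * z.im * Real.sqrt z.im)) z.im := by
    have := ((Real.hasDerivAt_sqrt hz.ne').const_mul 2).inv (by positivity)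
    simp only [one_div]
    refine this.congr_deriv ?_
    have h2 : z.im = Real.sqrt z.im ^ 2 := (Real.sq_sqrt hz.le).symm
    rw [show 4 * z.im * Real.sqrt z.im = 4 * Real.sqrt z.im ^ 2 * Real.sqrt z.im by rw [← h2]]
    field_simp
    ring
  have h1 := h0.comp_hasFDerivAt z (Complex.imCLM.hasFDerivAt (x := z))
  have h2 : HasFDerivAt (fun w : ℂ => ((1 / (2 * Real.sqrt w.im) : ℝ) : ℂ)) _ z :=
    (Complex.ofRealCLM.hasFDerivAt).comp z h1
  push_cast at h2
  refine h2.congr_fderiv ?_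
  ext w
  simp [partials_apply]
  ring

/-- `√y ∑ aᵢ e^{iλᵢx} K₀(|λᵢ|y)` is an eigenfunction of the hyperbolic Laplacian. -/
theorem Admissible.laplacian_besselSeries {a : ι → ℂ} {l : ι → ℝ} (h : Admissible a l) {z : ℂ}
    (hz : 0 < z.im) : -((z.im : ℂ) ^ 2) * Laplacian.laplacian
      (fun w : ℂ => (Real.sqrt w.im : ℂ) * besselSeries a l 0 w) z
      = 1 / 4 * ((Real.sqrt z.im : ℂ) * besselSeries a l 0 z) := by
  have hf : ∀ w : ℂ, 0 < w.im →
      HasFDerivAt (fun w : ℂ => (Real.sqrt w.im : ℂ) * besselSeries a l 0 w) (partials _ _) w :=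
    fun w hw => hasFDerivAt_mul_partials (hasFDerivAt_sqrt_im hw) (h.hasFDerivAt_besselSeries 0 hw)
  simp only [zero_mul, add_zero] at hf
  have hg := hasFDerivAt_mul_partials (hasFDerivAt_sqrt_im hz) (h.dx.hasFDerivAt_besselSeries 0 hz)
  have hh := hasFDerivAt_add_partials
    (hasFDerivAt_mul_partials (hasFDerivAt_sqrt_im hz) (h.dy.hasFDerivAt_besselSeries 1 hz))
    (hasFDerivAt_mul_partials (hasFDerivAt_half_inv_sqrt_im hz) (h.hasFDerivAt_besselSeries 0 hz))
  rw [laplacian_eq_of_partials hz hf hg hh]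
  have key : (z.im : ℂ) * (besselSeries (fun i => Complex.I * l i * (Complex.I * l i * a i)) l 0 z
      + besselSeries (fun i => -(|l i| : ℝ) * (-(|l i| : ℝ) * a i)) l 2 z)
      + besselSeries (fun i => -(|l i| : ℝ) * a i) l 1 z = 0 := by
    rw [besselSeries, besselSeries, besselSeries, ← (h.dx.dx.summable_besselWave 0 hz).tsum_add
      (h.dy.dy.summable_besselWave 2 hz), ← tsum_mul_left,
      ← (((h.dx.dx.summable_besselWave 0 hz).add
      (h.dy.dy.summable_besselWave 2 hz)).mul_left _).tsum_add (h.dy.summable_besselWave 1 hz)]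
    convert tsum_zero with i
    obtain ⟨ε, hε, hl⟩ := h.gap
    have hpos : 0 < |l i| := hε.trans_le (hl i)
    have e1 := besselMoment_equation (mul_pos hpos hz)
    have e2 : ((|l i| : ℝ) : ℂ) * z.im * ((besselMoment 2 (|l i| * z.im) : ℂ)
      - besselMoment 0 (|l i| * z.im)) = besselMoment 1 (|l i| * z.im) := by
      rw [← e1]; push_cast; ring
    have e3 : ((|l i| : ℝ) : ℂ) ^ 2 = (l i : ℂ) ^ 2 := by rw [← Complex.ofReal_pow, sq_abs]; simp
    simp only [besselWave]
    rw [← e2]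
    linear_combination (besselMoment 0 (|l i| * z.im) * z.im * a i *
        Complex.exp (Complex.I * l i * z.re)) * e3
      + (z.im * l i ^ 2 * a i * Complex.exp (Complex.I * l i * z.re) *
        besselMoment 0 (|l i| * z.im)) * Complex.I_sq
  have hs : ((Real.sqrt z.im : ℝ) : ℂ) ≠ 0 := by exact_mod_cast (Real.sqrt_pos.2 hz).ne'
  have hy : (z.im : ℂ) = (Real.sqrt z.im : ℂ) ^ 2 := by
    rw [← Complex.ofReal_pow, Real.sq_sqrt hz.le]
  simp only [add_zero, zero_mul, zero_add, Nat.reduceAdd]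
  rw [hy] at key ⊢
  generalize besselSeries a l 0 z = A at *
  generalize besselSeries (fun i => -(|l i| : ℝ) * a i) l 1 z = B at *
  generalize besselSeries (fun i => Complex.I * l i * (Complex.I * l i * a i)) l 0 z = C at *
  generalize besselSeries (fun i => -(|l i| : ℝ) * (-(|l i| : ℝ) * a i)) l 2 z = D at *
  field_simp
  linear_combination (-8 * (Real.sqrt z.im : ℂ) ^ 2) * key

end BesselSeries
end CohenMaass
end

noncomputable section
namespace CohenMaass
open Matrix UpperHalfPlane MeasureTheory

section Gaussian

open Set Filter Topology

theorem summable_exp_neg_mul_int_sq {k : ℝ} (hk : 0 < k) :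
    Summable fun n : ℤ => Real.exp (-(k * (n : ℝ) ^ 2)) := by
  have h0 : Summable fun n : ℕ => Real.exp (-(k * (n : ℝ) ^ 2)) := by
    refine Summable.of_nonneg_of_le (fun n => (Real.exp_pos _).le) (fun n => ?_)
      (Real.summable_exp_nat_mul_iff.2 (neg_lt_zero.2 hk))
    apply Real.exp_le_exp.2
    have h : (n : ℝ) ≤ (n : ℝ) ^ 2 := by exact_mod_cast Nat.le_self_pow (by norm_num) n
    nlinarith
  refine Summable.of_nat_of_neg ?_ ?_
  · simpa using h0
  · simpa using h0

theorem summable_exp_neg_mul_affine_sq {k : ℝ} (hk : 0 < k) {c : ℝ} (hc : c ≠ 0) (a : ℝ) :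
    Summable fun n : ℤ => Real.exp (-(k * (c * n + a) ^ 2)) := by
  refine Summable.of_nonneg_of_le (fun n => (Real.exp_pos _).le) (fun n => ?_)
    ((summable_exp_neg_mul_int_sq (k := k * c ^ 2 / 2) (by positivity)).mul_left
      (Real.exp (k * a ^ 2)))
  rw [← Real.exp_add]
  apply Real.exp_le_exp.2
  nlinarith [mul_nonneg hk.le (sq_nonneg (c * n + 2 * a))]

/-- Lattice sums of Gaussians of a positive definite binary quadratic form converge. -/
theorem summable_exp_neg_quadratic {A B C : ℝ} (hA : 0 < A) (hdet : 0 < A * C - B ^ 2)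
    {c₁ c₂ : ℝ} (hc₁ : c₁ ≠ 0) (hc₂ : c₂ ≠ 0) (a₁ a₂ : ℝ) :
    Summable fun n : ℤ × ℤ => Real.exp (-(A * (c₁ * n.1 + a₁) ^ 2
      + 2 * B * (c₁ * n.1 + a₁) * (c₂ * n.2 + a₂) + C * (c₂ * n.2 + a₂) ^ 2)) := by
  have hC : 0 < C := by
    by_contra h
    nlinarith [sq_nonneg B]
  set κ := (A * C - B ^ 2) / (A + C) with hκ
  have hκ0 : 0 < κ := by positivity
  refine Summable.of_nonneg_of_le (fun n => (Real.exp_pos _).le) (fun n => ?_)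
    ((summable_exp_neg_mul_affine_sq hκ0 hc₁ a₁).mul_of_nonneg
      (summable_exp_neg_mul_affine_sq hκ0 hc₂ a₂) (fun n => (Real.exp_pos _).le)
      (fun n => (Real.exp_pos _).le))
  rw [← Real.exp_add]
  apply Real.exp_le_exp.2
  generalize c₁ * (n.1 : ℝ) + a₁ = u
  generalize c₂ * (n.2 : ℝ) + a₂ = v
  have h : A * u ^ 2 + 2 * B * u * v + C * v ^ 2 - κ * (u ^ 2 + v ^ 2)
      = ((A * u + B * v) ^ 2 + (B * u + C * v) ^ 2) / (A + C) := by
    rw [hκ]; field_simp; ring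
  have h2 : 0 ≤ ((A * u + B * v) ^ 2 + (B * u + C * v) ^ 2) / (A + C) := by positivity
  linarith

theorem tsum_gauss_shift {p : ℂ} (hp : 0 < p.re) (a w : ℂ) :
    ∑' m : ℤ, Complex.exp (-Real.pi * p * (m + a) ^ 2 + 2 * Real.pi * w * (m + a))
      = 1 / p ^ (1 / 2 : ℂ) * ∑' m : ℤ, Complex.exp (-Real.pi / p * (m + Complex.I * w) ^ 2
        + 2 * Real.pi * Complex.I * a * m) := by
  have hp0 : p ≠ 0 := by rintro rfl; simp at hp
  have h := Complex.tsum_exp_neg_quadratic hp (w - p * a)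
  have h1 : ∀ m : ℤ, Complex.exp (-Real.pi * p * (m + a) ^ 2 + 2 * Real.pi * w * (m + a))
      = Complex.exp (-Real.pi * p * a ^ 2 + 2 * Real.pi * w * a)
        * Complex.exp (-Real.pi * p * m ^ 2 + 2 * Real.pi * (w - p * a) * m) := fun m => by
    rw [← Complex.exp_add]; congr 1; ring
  simp_rw [h1]
  rw [tsum_mul_left, h, mul_left_comm, ← tsum_mul_left]
  congr 2
  funext m
  rw [← Complex.exp_add]
  congr 1
  field_simp
  ring_nf
  rw [Complex.I_sq]
  ring

theorem cpow_half_re_pos {z : ℂ} (hz : 0 < z.re) :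
    (z ^ (1 / 2 : ℂ)) ^ 2 = z ∧ |(z ^ (1 / 2 : ℂ)).im| < (z ^ (1 / 2 : ℂ)).re := by
  have hz0 : z ≠ 0 := by rintro rfl; simp at hz
  have h1 : (z ^ (1 / 2 : ℂ)) ^ 2 = z := by
    rw [← Complex.cpow_nat_mul]; simp
  have h2 : 0 < (z ^ (1 / 2 : ℂ)).re := by
    rw [Complex.cpow_def_of_ne_zero hz0, Complex.exp_re]
    refine mul_pos (Real.exp_pos _) ?_
    have e1 : (Complex.log z * (1 / 2)).im = Complex.arg z / 2 := by
      rw [show Complex.log z * (1 / 2) = Complex.log z / ((2 : ℝ) : ℂ) by push_cast; ring,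
        Complex.div_ofReal_im, Complex.log_im]
    rw [e1]
    have e2 := Complex.neg_pi_lt_arg z
    have e3 := Complex.arg_le_pi z
    have e4 : Complex.arg z < Real.pi := by
      refine lt_of_le_of_ne e3 fun h => ?_
      have := (Complex.arg_eq_pi_iff.1 h).1
      linarith
    exact Real.cos_pos_of_mem_Ioo ⟨by linarith, by linarith⟩
  refine ⟨h1, ?_⟩
  have h3 := congrArg Complex.re h1
  rw [pow_two, Complex.mul_re] at h3
  refine abs_lt_of_sq_lt_sq ?_ h2.le
  nlinarith

theorem cpow_half_mul_cpow_half {z w : ℂ} (hz : 0 < z.re) (hw : 0 < w.re) {d : ℝ} (hd : 0 ≤ d)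
    (h : z * w = (d : ℂ) ^ 2) : z ^ (1 / 2 : ℂ) * w ^ (1 / 2 : ℂ) = d := by
  obtain ⟨h1, h2⟩ := cpow_half_re_pos hz
  obtain ⟨h3, h4⟩ := cpow_half_re_pos hw
  have h5 : (z ^ (1 / 2 : ℂ) * w ^ (1 / 2 : ℂ)) ^ 2 = (d : ℂ) ^ 2 := by rw [mul_pow, h1, h3, h]
  rcases sq_eq_sq_iff_eq_or_eq_neg.1 h5 with h6 | h6
  · exact h6
  · have h7 := congrArg Complex.re h6
    rw [Complex.mul_re, Complex.neg_re, Complex.ofReal_re] at h7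
    have h8 : |(z ^ (1 / 2 : ℂ)).im * (w ^ (1 / 2 : ℂ)).im|
        < (z ^ (1 / 2 : ℂ)).re * (w ^ (1 / 2 : ℂ)).re := by
      rw [abs_mul]
      exact mul_lt_mul'' h2 h4 (abs_nonneg _) (abs_nonneg _)
    have h9 := le_abs_self ((z ^ (1 / 2 : ℂ)).im * (w ^ (1 / 2 : ℂ)).im)
    linarith

/-- Poisson summation for a complex Gaussian in two variables. -/
theorem tsum_gauss_two {p r : ℂ} {s d : ℝ} (hp : 0 < p.re) (hd : 0 < d)
    (hD : p * r - s ^ 2 = d ^ 2) (h₁ : 0 < p.re * r.re - s ^ 2)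
    (h₂ : 0 < d ^ 2 * p.re ^ 2 - s ^ 2 * p.im ^ 2) (a₁ a₂ z₁ z₂ : ℝ) :
    ∑' n : ℤ × ℤ, Complex.exp (-Real.pi * (p * (n.1 + a₁) ^ 2 + 2 * s * (n.1 + a₁) * (n.2 + a₂)
        + r * (n.2 + a₂) ^ 2) + 2 * Real.pi * Complex.I * (z₁ * (n.1 + a₁) + z₂ * (n.2 + a₂)))
    = 1 / d * ∑' n : ℤ × ℤ,
      Complex.exp (-Real.pi / d ^ 2 * (r * (n.1 - z₁) ^ 2
        - 2 * s * (n.1 - z₁) * (n.2 - z₂) + p * (n.2 - z₂) ^ 2)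
        + 2 * Real.pi * Complex.I * (a₁ * n.1 + a₂ * n.2)) := by
  have hp0 : p ≠ 0 := by rintro rfl; simp at hp
  have hN := Complex.normSq_pos.2 hp0
  have hd0 : (d : ℂ) ≠ 0 := by exact_mod_cast hd.ne'
  have hrs : r - s ^ 2 / p = d ^ 2 / p := by rw [← hD]; field_simp
  have hpi := Real.pi_pos
  have hinv : 0 < (1 / p).re := by
    rw [one_div, Complex.inv_re]; exact div_pos hp hN
  have hdp : (d ^ 2 / p : ℂ).re = d ^ 2 * (1 / p).re := by
    rw [show (d ^ 2 / p : ℂ) = ((d ^ 2 : ℝ) : ℂ) * (1 / p) by push_cast; ring,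
      Complex.re_ofReal_mul]
  have hdp' : 0 < (d ^ 2 / p : ℂ).re := by rw [hdp]; positivity
  -- the original sum
  set f : ℤ → ℤ → ℂ := fun m n => Complex.exp (-Real.pi * (p * (m + a₁) ^ 2
    + 2 * s * (m + a₁) * (n + a₂) + r * (n + a₂) ^ 2)
    + 2 * Real.pi * Complex.I * (z₁ * (m + a₁) + z₂ * (n + a₂))) with hf
  have hfs : Summable (Function.uncurry f) := by
    rw [← summable_norm_iff]
    refine (summable_exp_neg_quadratic (A := Real.pi * p.re) (B := Real.pi * s)
      (C := Real.pi * r.re) (by positivity) ?_ one_ne_zero one_ne_zero a₁ a₂).congr fun n => ?_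
    · rw [show Real.pi * p.re * (Real.pi * r.re) - (Real.pi * s) ^ 2
        = Real.pi ^ 2 * (p.re * r.re - s ^ 2) by ring]
      positivity
    · simp only [Function.uncurry, hf, Complex.norm_exp]
      congr 1
      have e1 : (-Real.pi * (p * (n.1 + a₁) ^ 2
        + 2 * s * (n.1 + a₁) * (n.2 + a₂) + r * (n.2 + a₂) ^ 2)
        + 2 * Real.pi * Complex.I * (z₁ * (n.1 + a₁) + z₂ * (n.2 + a₂)) : ℂ)
        = p * ((-Real.pi * (n.1 + a₁) ^ 2 : ℝ) : ℂ)
          + r * ((-Real.pi * (n.2 + a₂) ^ 2 : ℝ) : ℂ)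
          + ((-Real.pi * (2 * s * (n.1 + a₁) * (n.2 + a₂)) : ℝ) : ℂ)
          + Complex.I * ((2 * Real.pi * (z₁ * (n.1 + a₁) + z₂ * (n.2 + a₂)) : ℝ) : ℂ) := by
        push_cast; ring
      rw [e1]
      simp only [Complex.add_re, Complex.re_mul_ofReal, Complex.I_re, Complex.ofReal_re]
      ring
  -- the sum after the first transformation
  set g : ℤ → ℤ → ℂ := fun m n => Complex.exp (-Real.pi * (1 / p) * ((m - z₁) ^ 2
      - 2 * Complex.I * s * (m - z₁) * (n + a₂) - s ^ 2 * (n + a₂) ^ 2)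
      + 2 * Real.pi * Complex.I * a₁ * m
      - Real.pi * r * (n + a₂) ^ 2 + 2 * Real.pi * Complex.I * z₂ * (n + a₂)) with hg
  have hgs : Summable (Function.uncurry g) := by
    rw [← summable_norm_iff]
    refine (summable_exp_neg_quadratic (A := Real.pi * (1 / p).re)
      (B := Real.pi * (s * (1 / p).im)) (C := Real.pi * (d ^ 2 * (1 / p).re)) (by positivity) ?_
      one_ne_zero one_ne_zero (-z₁) a₂).congr fun n => ?_
    · have e2 : Real.pi * (1 / p).re * (Real.pi * (d ^ 2 * (1 / p).re))
        - (Real.pi * (s * (1 / p).im)) ^ 2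
        = Real.pi ^ 2 * (d ^ 2 * p.re ^ 2 - s ^ 2 * p.im ^ 2) / Complex.normSq p ^ 2 := by
        rw [one_div, Complex.inv_re, Complex.inv_im]; field_simp
      rw [e2]
      positivity
    · simp only [Function.uncurry, hg, Complex.norm_exp]
      congr 1
      have e1 : (-Real.pi * (1 / p) * ((n.1 - z₁) ^ 2
          - 2 * Complex.I * s * (n.1 - z₁) * (n.2 + a₂) - s ^ 2 * (n.2 + a₂) ^ 2)
          + 2 * Real.pi * Complex.I * a₁ * n.1
          - Real.pi * r * (n.2 + a₂) ^ 2 + 2 * Real.pi * Complex.I * z₂ * (n.2 + a₂) : ℂ)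
        = (1 / p) * ((-Real.pi * (n.1 - z₁) ^ 2 : ℝ) : ℂ)
          + (d ^ 2 / p) * ((-Real.pi * (n.2 + a₂) ^ 2 : ℝ) : ℂ)
          + (1 / p) * Complex.I * ((2 * Real.pi * s * (n.1 - z₁) * (n.2 + a₂) : ℝ) : ℂ)
          + Complex.I * ((2 * Real.pi * (a₁ * n.1 + z₂ * (n.2 + a₂)) : ℝ) : ℂ) := by
        rw [← hrs]
        push_cast
        ring
      rw [e1]
      simp only [Complex.add_re, Complex.re_mul_ofReal, Complex.I_re, Complex.mul_I_re, hdp]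
      ring
  have step1 : ∀ n : ℤ, ∑' m : ℤ, f m n = 1 / p ^ (1 / 2 : ℂ) * ∑' m : ℤ, g m n := by
    intro n
    have h := tsum_gauss_shift hp a₁ (-s * (n + a₂) + Complex.I * z₁)
    have e1 : ∀ m : ℤ, f m n = Complex.exp (-Real.pi * r * (n + a₂) ^ 2
        + 2 * Real.pi * Complex.I * z₂ * (n + a₂)) * Complex.exp (-Real.pi * p * (m + a₁) ^ 2
        + 2 * Real.pi * (-s * (n + a₂) + Complex.I * z₁) * (m + a₁)) := fun m => by
      simp only [hf]; rw [← Complex.exp_add]; congr 1; ring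
    simp_rw [e1]
    rw [tsum_mul_left, h, mul_left_comm, ← tsum_mul_left]
    congr 2
    funext m
    simp only [hg]
    rw [← Complex.exp_add]
    congr 1
    have e2 : ((m : ℂ) + Complex.I * (-s * (n + a₂) + Complex.I * z₁)) ^ 2 = (m - z₁) ^ 2
      - 2 * Complex.I * s * (m - z₁) * (n + a₂) - s ^ 2 * (n + a₂) ^ 2 := by
      have e3 : (m : ℂ) + Complex.I * (-s * (n + a₂) + Complex.I * z₁)
        = (m - z₁) - Complex.I * s * (n + a₂) := by linear_combination z₁ * Complex.I_sq
      rw [e3]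
      linear_combination (s * (n + a₂)) ^ 2 * Complex.I_sq
    rw [e2]
    ring
  set k : ℤ → ℤ → ℂ := fun m n => Complex.exp (-Real.pi / d ^ 2 * (r * (m - z₁) ^ 2
        - 2 * s * (m - z₁) * (n - z₂) + p * (n - z₂) ^ 2)
        + 2 * Real.pi * Complex.I * (a₁ * m + a₂ * n)) with hk
  have hks : Summable (Function.uncurry k) := by
    rw [← summable_norm_iff]
    have hr : 0 < r.re := by
      by_contra h
      nlinarith [sq_nonneg s]
    refine (summable_exp_neg_quadratic (A := Real.pi / d ^ 2 * r.re)
      (B := - (Real.pi / d ^ 2 * s)) (C := Real.pi / d ^ 2 * p.re) (by positivity) ?_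
      one_ne_zero one_ne_zero (-z₁) (-z₂)).congr fun n => ?_
    · rw [show Real.pi / d ^ 2 * r.re * (Real.pi / d ^ 2 * p.re) - (-(Real.pi / d ^ 2 * s)) ^ 2
        = (Real.pi / d ^ 2) ^ 2 * (p.re * r.re - s ^ 2) by ring]
      positivity
    · simp only [Function.uncurry, hk, Complex.norm_exp]
      congr 1
      have e1 : (-Real.pi / d ^ 2 * (r * (n.1 - z₁) ^ 2
        - 2 * s * (n.1 - z₁) * (n.2 - z₂) + p * (n.2 - z₂) ^ 2)
        + 2 * Real.pi * Complex.I * (a₁ * n.1 + a₂ * n.2) : ℂ)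
        = r * ((-Real.pi / d ^ 2 * (n.1 - z₁) ^ 2 : ℝ) : ℂ)
          + p * ((-Real.pi / d ^ 2 * (n.2 - z₂) ^ 2 : ℝ) : ℂ)
          + ((Real.pi / d ^ 2 * (2 * s * (n.1 - z₁) * (n.2 - z₂)) : ℝ) : ℂ)
          + Complex.I * ((2 * Real.pi * (a₁ * n.1 + a₂ * n.2) : ℝ) : ℂ) := by
        push_cast; ring
      rw [e1]
      simp only [Complex.add_re, Complex.re_mul_ofReal, Complex.I_re, Complex.ofReal_re]
      ring
  have step2 : ∀ m : ℤ, ∑' n : ℤ, g m n = 1 / (d ^ 2 / p) ^ (1 / 2 : ℂ) * ∑' n : ℤ, k m n := by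
    intro m
    have h := tsum_gauss_shift hdp' a₂ (Complex.I * (z₂ + s / p * (m - z₁)))
    have e1 : ∀ n : ℤ, g m n = Complex.exp (-Real.pi / p * (m - z₁) ^ 2
        + 2 * Real.pi * Complex.I * a₁ * m) * Complex.exp (-Real.pi * (d ^ 2 / p) * (n + a₂) ^ 2
        + 2 * Real.pi * (Complex.I * (z₂ + s / p * (m - z₁))) * (n + a₂)) := fun n => by
      simp only [hg]
      rw [← Complex.exp_add, ← hrs]
      congr 1
      ring
    simp_rw [e1]
    rw [tsum_mul_left, h, mul_left_comm, ← tsum_mul_left]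
    congr 2
    funext n
    simp only [hk]
    rw [← Complex.exp_add]
    congr 1
    have e2 : (n : ℂ) + Complex.I * (Complex.I * (z₂ + s / p * (m - z₁)))
        = n - z₂ - s / p * (m - z₁) := by
      linear_combination (z₂ + s / p * (m - z₁)) * Complex.I_sq
    rw [e2]
    field_simp
    linear_combination (m - z₁ : ℂ) ^ 2 * hD
  calc ∑' n : ℤ × ℤ, f n.1 n.2 = ∑' (n : ℤ) (m : ℤ), f m n := by
        rw [hfs.tsum_comm]; exact hfs.tsum_prod
    _ = 1 / p ^ (1 / 2 : ℂ) * ∑' (n : ℤ) (m : ℤ), g m n := by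
        simp_rw [step1]; rw [tsum_mul_left]
    _ = 1 / p ^ (1 / 2 : ℂ) * ∑' (m : ℤ) (n : ℤ), g m n := by rw [hgs.tsum_comm]
    _ = 1 / d * ∑' n : ℤ × ℤ, k n.1 n.2 := by
        simp_rw [step2]
        rw [tsum_mul_left, ← mul_assoc, one_div_mul_one_div,
          cpow_half_mul_cpow_half hp hdp' hd.le (by field_simp)]
        congr 1
        exact hks.tsum_prod.symm

end Gaussian
end CohenMaass
end

noncomputable section
namespace CohenMaass
open Matrix UpperHalfPlane MeasureTheory
section GaussianKernel

/-- Half the length of the interval of integration: `sinh T₀ = √2`, `cosh T₀ = √3`. -/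
def halfLength : ℝ := Real.arsinh (Real.sqrt 2)

theorem sinh_halfLength : Real.sinh halfLength = Real.sqrt 2 := Real.sinh_arsinh _

theorem cosh_halfLength : Real.cosh halfLength = Real.sqrt 3 := by
  rw [halfLength, Real.cosh_arsinh, Real.sq_sqrt (by norm_num)]
  norm_num

theorem halfLength_pos : 0 < halfLength := by
  rw [halfLength, Real.arsinh_pos_iff]
  positivity

/-- The integrand `q^{Q(ν)} e^{-π y B(ν, c(t))²}` for `c(t) = (√(2/3) sinh t, cosh t)`. -/
def gaussKer (τ : ℍ) (t v₁ v₂ : ℝ) : ℂ :=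
  e (((3 * v₁ ^ 2 - 2 * v₂ ^ 2) / 2 : ℝ) * (τ : ℂ)) *
    (Real.exp (-Real.pi * τ.im *
      (Real.sqrt 6 * v₁ * Real.sinh t - 2 * v₂ * Real.cosh t) ^ 2) : ℂ)

/-- The integral of the kernel over `[-T₀, T₀]`. -/
def stdTerm (τ : ℍ) (v₁ v₂ : ℝ) : ℂ := ∫ t in (-halfLength)..halfLength, gaussKer τ t v₁ v₂

theorem gaussKer_eq_cexp (τ : ℍ) (t v₁ v₂ : ℝ) : gaussKer τ t v₁ v₂ =
    Complex.exp (-Real.pi *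
      (3 * (τ.im * Real.cosh (2 * t) - Complex.I * τ.re) * v₁ ^ 2
        + 2 * ((-(Real.sqrt 6 * τ.im * Real.sinh (2 * t)) : ℝ) : ℂ) * v₁ * v₂
        + 2 * (τ.im * Real.cosh (2 * t) + Complex.I * τ.re) * v₂ ^ 2)) := by
  have h1 : (τ : ℂ) = τ.re + τ.im * Complex.I := (Complex.re_add_im _).symm
  have h2 : (Real.sqrt 6 : ℂ) ^ 2 = 6 := by
    rw [← Complex.ofReal_pow, Real.sq_sqrt (by norm_num)]; norm_num
  have h3 := Complex.cosh_sq_sub_sinh_sq (t : ℂ)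
  rw [gaussKer, e, Complex.ofReal_exp, ← Complex.exp_add, Real.cosh_two_mul, Real.sinh_two_mul, h1]
  congr 1
  push_cast
  linear_combination (Real.pi * τ.im * (3 * v₁ ^ 2 - 2 * v₂ ^ 2) : ℂ) * Complex.I_sq
    - (Real.pi * τ.im * v₁ ^ 2 * Complex.sinh t ^ 2 : ℂ) * h2
    + (Real.pi * τ.im * (3 * v₁ ^ 2 - 2 * v₂ ^ 2) : ℂ) * h3

theorem norm_gaussKer (τ : ℍ) (t v₁ v₂ : ℝ) : ‖gaussKer τ t v₁ v₂‖ =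
    Real.exp (-(Real.pi * τ.im * (Real.cosh (2 * t) * (3 * v₁ ^ 2 + 2 * v₂ ^ 2)
      - 2 * Real.sqrt 6 * Real.sinh (2 * t) * v₁ * v₂))) := by
  rw [gaussKer_eq_cexp, Complex.norm_exp]
  congr 1
  rw [show (-Real.pi *
      (3 * (τ.im * Real.cosh (2 * t) - Complex.I * τ.re) * v₁ ^ 2
        + 2 * ((-(Real.sqrt 6 * τ.im * Real.sinh (2 * t)) : ℝ) : ℂ) * v₁ * v₂
        + 2 * (τ.im * Real.cosh (2 * t) + Complex.I * τ.re) * v₂ ^ 2) : ℂ)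
      = ((-(Real.pi * τ.im * (Real.cosh (2 * t) * (3 * v₁ ^ 2 + 2 * v₂ ^ 2)
      - 2 * Real.sqrt 6 * Real.sinh (2 * t) * v₁ * v₂)) : ℝ) : ℂ)
      + ((Real.pi * τ.re * (3 * v₁ ^ 2 - 2 * v₂ ^ 2) : ℝ) : ℂ) * Complex.I by push_cast; ring]
  simp only [Complex.add_re, Complex.ofReal_re, Complex.re_ofReal_mul, Complex.I_re]
  ring

theorem norm_gaussKer_le (τ : ℍ) {t : ℝ} (ht : |t| ≤ halfLength) (v₁ v₂ : ℝ) :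
    ‖gaussKer τ t v₁ v₂‖ ≤
      Real.exp (-(Real.pi * τ.im * Real.exp (-2 * halfLength) * (3 * v₁ ^ 2 + 2 * v₂ ^ 2))) := by
  rw [norm_gaussKer, Real.exp_le_exp, neg_le_neg_iff, mul_assoc (Real.pi * τ.im)]
  have hτ := τ.im_pos
  refine mul_le_mul_of_nonneg_left ?_ (by positivity)
  rw [abs_le] at ht
  have h6 : Real.sqrt 6 ^ 2 = 6 := Real.sq_sqrt (by norm_num)
  have h1 : Real.exp (-2 * halfLength) ≤ Real.exp (2 * t) := Real.exp_le_exp.2 (by linarith)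
  have h2 : Real.exp (-2 * halfLength) ≤ Real.exp (-(2 * t)) := Real.exp_le_exp.2 (by linarith)
  rw [Real.cosh_eq, Real.sinh_eq]
  have h3 := mul_nonneg (sub_nonneg.2 h1) (sq_nonneg (Real.sqrt 6 * v₁ - 2 * v₂))
  have h4 := mul_nonneg (sub_nonneg.2 h2) (sq_nonneg (Real.sqrt 6 * v₁ + 2 * v₂))
  have h5 : (Real.exp (2 * t) + Real.exp (-(2 * t))) / 2 * (3 * v₁ ^ 2 + 2 * v₂ ^ 2)
      - 2 * Real.sqrt 6 * ((Real.exp (2 * t) - Real.exp (-(2 * t))) / 2) * v₁ * v₂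
      - Real.exp (-2 * halfLength) * (3 * v₁ ^ 2 + 2 * v₂ ^ 2)
      = ((Real.exp (2 * t) - Real.exp (-2 * halfLength)) * (Real.sqrt 6 * v₁ - 2 * v₂) ^ 2
      + (Real.exp (-(2 * t)) - Real.exp (-2 * halfLength)) * (Real.sqrt 6 * v₁ + 2 * v₂) ^ 2)
        / 4 := by
    linear_combination -(Real.exp (2 * t) + Real.exp (-(2 * t))
      - 2 * Real.exp (-2 * halfLength)) * v₁ ^ 2 / 4 * h6
  linarith

theorem continuous_gaussKer (τ : ℍ) (v₁ v₂ : ℝ) : Continuous fun t => gaussKer τ t v₁ v₂ := by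
  unfold gaussKer
  fun_prop

theorem norm_stdTerm_le (τ : ℍ) (v₁ v₂ : ℝ) : ‖stdTerm τ v₁ v₂‖ ≤
    Real.exp (-(Real.pi * τ.im * Real.exp (-2 * halfLength) * (3 * v₁ ^ 2 + 2 * v₂ ^ 2)))
      * (2 * halfLength) := by
  have h := halfLength_pos
  refine (intervalIntegral.norm_integral_le_of_norm_le_const (C := Real.exp
    (-(Real.pi * τ.im * Real.exp (-2 * halfLength) * (3 * v₁ ^ 2 + 2 * v₂ ^ 2))))
    fun t ht => ?_).trans_eq ?_
  · rw [Set.uIoc_of_le (by linarith)] at ht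
    exact norm_gaussKer_le τ (abs_le.2 ⟨ht.1.le, ht.2⟩) v₁ v₂
  · rw [abs_of_pos (by linarith)]; ring

theorem gaussKer_neg_neg (τ : ℍ) (t v₁ v₂ : ℝ) :
    gaussKer τ t (-v₁) (-v₂) = gaussKer τ t v₁ v₂ := by
  unfold gaussKer
  congr 3
  · ring_nf
  · congr 1; ring

theorem gaussKer_neg_left (τ : ℍ) (t v₁ v₂ : ℝ) :
    gaussKer τ t (-v₁) v₂ = gaussKer τ (-t) v₁ v₂ := by
  unfold gaussKer
  rw [Real.sinh_neg, Real.cosh_neg]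
  congr 3
  · ring_nf
  · congr 1; ring

theorem stdTerm_neg_left (τ : ℍ) (v₁ v₂ : ℝ) : stdTerm τ (-v₁) v₂ = stdTerm τ v₁ v₂ := by
  unfold stdTerm
  simp_rw [gaussKer_neg_left]
  rw [intervalIntegral.integral_comp_neg fun t => gaussKer τ t v₁ v₂, neg_neg]

theorem stdTerm_neg_right (τ : ℍ) (v₁ v₂ : ℝ) : stdTerm τ v₁ (-v₂) = stdTerm τ v₁ v₂ := by
  rw [← stdTerm_neg_left]
  simp only [stdTerm, gaussKer_neg_neg]

theorem summable_gauss_bound (τ : ℍ) {c₁ c₂ : ℝ} (hc₁ : c₁ ≠ 0) (hc₂ : c₂ ≠ 0) (a₁ a₂ : ℝ) :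
    Summable fun n : ℤ × ℤ => Real.exp (-(Real.pi * τ.im * Real.exp (-2 * halfLength)
      * (3 * (c₁ * n.1 + a₁) ^ 2 + 2 * (c₂ * n.2 + a₂) ^ 2))) := by
  have hτ := τ.im_pos
  refine (summable_exp_neg_quadratic
    (A := Real.pi * τ.im * Real.exp (-2 * halfLength) * 3) (B := 0)
    (C := Real.pi * τ.im * Real.exp (-2 * halfLength) * 2) (by positivity) (by
      rw [zero_pow (by norm_num), sub_zero]; positivity) hc₁ hc₂ a₁ a₂).congr fun n => ?_
  congr 1
  ring

theorem summable_norm_stdTerm (τ : ℍ) {c₁ c₂ : ℝ} (hc₁ : c₁ ≠ 0) (hc₂ : c₂ ≠ 0) (a₁ a₂ : ℝ) :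
    Summable fun n : ℤ × ℤ => ‖stdTerm τ (c₁ * n.1 + a₁) (c₂ * n.2 + a₂)‖ :=
  Summable.of_nonneg_of_le (fun _ => norm_nonneg _) (fun _ => norm_stdTerm_le _ _ _)
    ((summable_gauss_bound τ hc₁ hc₂ a₁ a₂).mul_right _)

theorem summable_stdTerm_mul (τ : ℍ) {c₁ c₂ : ℝ} (hc₁ : c₁ ≠ 0) (hc₂ : c₂ ≠ 0) (a₁ a₂ : ℝ)
    {χ : ℤ × ℤ → ℂ} (hχ : ∀ n, ‖χ n‖ = 1) :
    Summable fun n : ℤ × ℤ => stdTerm τ (c₁ * n.1 + a₁) (c₂ * n.2 + a₂) * χ n := by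
  rw [← summable_norm_iff]
  refine (summable_norm_stdTerm τ hc₁ hc₂ a₁ a₂).congr fun n => ?_
  rw [norm_mul, hχ, mul_one]

theorem hasSum_stdTerm_mul (τ : ℍ) {c₁ c₂ : ℝ} (hc₁ : c₁ ≠ 0) (hc₂ : c₂ ≠ 0) (a₁ a₂ : ℝ)
    {χ : ℤ × ℤ → ℂ} (hχ : ∀ n, ‖χ n‖ = 1) :
    HasSum (fun n : ℤ × ℤ => stdTerm τ (c₁ * n.1 + a₁) (c₂ * n.2 + a₂) * χ n)
      (∫ t in (-halfLength)..halfLength,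
        ∑' n : ℤ × ℤ, gaussKer τ t (c₁ * n.1 + a₁) (c₂ * n.2 + a₂) * χ n) := by
  have h := halfLength_pos
  have hb := summable_gauss_bound τ hc₁ hc₂ a₁ a₂
  have key := intervalIntegral.hasSum_integral_of_dominated_convergence (μ := volume)
    (a := -halfLength) (b := halfLength)
    (F := fun (n : ℤ × ℤ) t => gaussKer τ t (c₁ * n.1 + a₁) (c₂ * n.2 + a₂) * χ n)
    (f := fun t => ∑' n : ℤ × ℤ, gaussKer τ t (c₁ * n.1 + a₁) (c₂ * n.2 + a₂) * χ n)
    (fun (n : ℤ × ℤ) _ => Real.exp (-(Real.pi * τ.im * Real.exp (-2 * halfLength)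
      * (3 * (c₁ * n.1 + a₁) ^ 2 + 2 * (c₂ * n.2 + a₂) ^ 2))))
    (fun n => ((continuous_gaussKer _ _ _).mul continuous_const).aestronglyMeasurable)
    (fun n => Filter.Eventually.of_forall fun t ht => ?_)
    (Filter.Eventually.of_forall fun t _ => hb) intervalIntegrable_const
    (Filter.Eventually.of_forall fun t ht => ?_)
  · simpa only [stdTerm, intervalIntegral.integral_mul_const] using key
  · rw [Set.uIoc_of_le (by linarith)] at ht
    rw [norm_mul, hχ, mul_one]
    exact norm_gaussKer_le τ (abs_le.2 ⟨ht.1.le, ht.2⟩) _ _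
  · rw [Set.uIoc_of_le (by linarith)] at ht
    refine Summable.hasSum (Summable.of_norm_bounded hb fun n => ?_)
    rw [norm_mul, hχ, mul_one]
    exact norm_gaussKer_le τ (abs_le.2 ⟨ht.1.le, ht.2⟩) _ _

theorem im_of_eq_neg_one_div {τ τ' : ℍ} (h : (τ' : ℂ) = -1 / (τ : ℂ)) :
    τ'.im = τ.im / Complex.normSq τ ∧ τ'.re = -τ.re / Complex.normSq τ := by
  have h1 : (τ' : ℂ) = -(τ : ℂ)⁻¹ := by rw [h]; ring
  constructor
  · have := congrArg Complex.im h1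
    simpa [Complex.inv_im, neg_div] using this
  · have := congrArg Complex.re h1
    simpa [Complex.inv_re, neg_div] using this

/-- Poisson summation for the kernel. -/
theorem tsum_gaussKer {τ τ' : ℍ} (h : (τ' : ℂ) = -1 / (τ : ℂ)) (t a₁ a₂ b₁ b₂ : ℝ) :
    ∑' n : ℤ × ℤ, gaussKer τ t (1 * n.1 + a₁) (1 * n.2 + a₂)
        * e ((3 * b₁ * (n.1 + a₁) - 2 * b₂ * (n.2 + a₂) : ℝ))
    = ((1 / (Real.sqrt 6 * ‖(τ : ℂ)‖) : ℝ) : ℂ) * ∑' n : ℤ × ℤ,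
        gaussKer τ' t (1 / 3 * n.1 + b₁) (1 / 2 * n.2 + b₂) * e ((-a₁ * n.1 + a₂ * n.2 : ℝ)) := by
  obtain ⟨him, hre⟩ := im_of_eq_neg_one_div h
  have hτ := τ.im_pos
  have hN : 0 < Complex.normSq τ := Complex.normSq_pos.2 τ.ne_zero
  have hN' : Complex.normSq τ = τ.re ^ 2 + τ.im ^ 2 := by
    rw [Complex.normSq_apply]; simp only [UpperHalfPlane.coe_re, UpperHalfPlane.coe_im]; ring
  have h6 : Real.sqrt 6 ^ 2 = 6 := Real.sq_sqrt (by norm_num)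
  have hCS := Real.cosh_sq (2 * t)
  set C := Real.cosh (2 * t) with hC
  set S := Real.sinh (2 * t) with hS
  have hCpos : 0 < C := Real.cosh_pos _
  have hd2 : (Real.sqrt 6 * ‖(τ : ℂ)‖) ^ 2 = 6 * (τ.re ^ 2 + τ.im ^ 2) := by
    rw [mul_pow, h6, ← Complex.normSq_eq_norm_sq, hN']
  have hd2c : (((Real.sqrt 6 * ‖(τ : ℂ)‖ : ℝ) : ℂ)) ^ 2 = 6 * (τ.re ^ 2 + τ.im ^ 2) := by
    rw [← Complex.ofReal_pow, hd2]; push_cast; ring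
  have hpre : (3 * (τ.im * C - Complex.I * τ.re) : ℂ).re = 3 * (τ.im * C) := by simp
  have hpim : (3 * (τ.im * C - Complex.I * τ.re) : ℂ).im = -(3 * τ.re) := by simp
  have hrre : (2 * (τ.im * C + Complex.I * τ.re) : ℂ).re = 2 * (τ.im * C) := by simp
  have hCSc : (C : ℂ) ^ 2 = S ^ 2 + 1 := by exact_mod_cast hCS
  have h6c : (Real.sqrt 6 : ℂ) ^ 2 = 6 := by
    rw [← Complex.ofReal_pow, h6]; norm_num
  have key := tsum_gauss_two (p := 3 * (τ.im * C - Complex.I * τ.re))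
    (r := 2 * (τ.im * C + Complex.I * τ.re)) (s := -(Real.sqrt 6 * τ.im * S))
    (d := Real.sqrt 6 * ‖(τ : ℂ)‖) (by rw [hpre]; positivity)
    (mul_pos (by positivity) (norm_pos_iff.2 τ.ne_zero))
    (by
      rw [hd2c]; push_cast
      linear_combination 6 * (τ.im : ℂ) ^ 2 * hCSc - (τ.im * S : ℂ) ^ 2 * h6c
        - 6 * (τ.re : ℂ) ^ 2 * Complex.I_sq)
    (by
      rw [hpre, hrre]
      have : 3 * (τ.im * C) * (2 * (τ.im * C)) - (-(Real.sqrt 6 * τ.im * S)) ^ 2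
        = 6 * τ.im ^ 2 := by linear_combination 6 * τ.im ^ 2 * hCS - (τ.im * S) ^ 2 * h6
      rw [this]; positivity)
    (by
      rw [hpre, hpim, hd2]
      have : 6 * (τ.re ^ 2 + τ.im ^ 2) * (3 * (τ.im * C)) ^ 2
          - (-(Real.sqrt 6 * τ.im * S)) ^ 2 * (-(3 * τ.re)) ^ 2
        = 54 * τ.im ^ 2 * (τ.re ^ 2 + τ.im ^ 2 * C ^ 2) := by
        linear_combination 54 * τ.im ^ 2 * τ.re ^ 2 * hCS - 9 * (τ.im * S * τ.re) ^ 2 * h6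
      rw [this]; positivity) a₁ a₂ (3 * b₁) (-2 * b₂)
  rw [show ((1 / (Real.sqrt 6 * ‖(τ : ℂ)‖) : ℝ) : ℂ)
    = 1 / ((Real.sqrt 6 * ‖(τ : ℂ)‖ : ℝ) : ℂ) by push_cast; rfl]
  calc _ = _ := ?_
    _ = _ := key
    _ = _ := ?_
  · refine tsum_congr fun n => ?_
    rw [gaussKer_eq_cexp, e, ← Complex.exp_add, ← hC, ← hS]
    congr 1
    push_cast
    ring
  · congr 1
    rw [← (Equiv.prodCongr (Equiv.neg ℤ) (Equiv.refl ℤ)).tsum_eq]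
    refine tsum_congr fun n => ?_
    rw [gaussKer_eq_cexp, e, ← Complex.exp_add, hd2c, him, hre, hN', ← hC, ← hS]
    congr 1
    have hNc : ((τ.re : ℂ) ^ 2 + (τ.im : ℂ) ^ 2) ≠ 0 := by
      have := hN.ne'
      rw [hN'] at this
      exact_mod_cast this
    simp only [Equiv.prodCongr_apply, Prod.map, Equiv.neg_apply, Equiv.refl_apply]
    push_cast
    field_simp
    ring

end GaussianKernel
end CohenMaass
end

noncomputable section
namespace CohenMaass
open Matrix UpperHalfPlane MeasureTheory
section ThetaSeries

/-- The theta series `Φ̂_{a,b}` for the standard parametrization. -/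
def stdTheta (a₁ a₂ b₁ b₂ : ℝ) (τ : ℍ) : ℂ :=
  (Real.sqrt τ.im : ℂ) * ∑' n : ℤ × ℤ, stdTerm τ (n.1 + a₁) (n.2 + a₂)
    * e ((3 * b₁ * (n.1 + a₁) - 2 * b₂ * (n.2 + a₂) : ℝ))

theorem norm_e_ofReal (x : ℝ) : ‖e (x : ℂ)‖ = 1 := by
  rw [e, show (2 * Real.pi * Complex.I * x : ℂ) = ((2 * Real.pi * x : ℝ) : ℂ) * Complex.I by
    push_cast; ring, Complex.norm_exp_ofReal_mul_I]

theorem e_intCast (n : ℤ) : e (n : ℂ) = 1 := by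
  rw [e, mul_comm]
  exact_mod_cast Complex.exp_int_mul_two_pi_mul_I n

theorem e_half_intCast (n : ℤ) : e ((n : ℂ) / 2) = (-1) ^ n := by
  rw [e, ← Complex.exp_pi_mul_I, ← Complex.exp_int_mul]
  congr 1
  ring

theorem e_zero : e 0 = 1 := by simp [e]

theorem stdTheta_neg_one_div {τ τ' : ℍ} (h : (τ' : ℂ) = -1 / (τ : ℂ)) (a₁ a₂ b₁ b₂ : ℝ) :
    stdTheta a₁ a₂ b₁ b₂ τ = ((Real.sqrt τ'.im / Real.sqrt 6 : ℝ) : ℂ) *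
      ∑' n : ℤ × ℤ, stdTerm τ' (1 / 3 * n.1 + b₁) (1 / 2 * n.2 + b₂)
        * e ((-a₁ * n.1 + a₂ * n.2 : ℝ)) := by
  have h1 := (hasSum_stdTerm_mul τ one_ne_zero one_ne_zero a₁ a₂
    (χ := fun n => e ((3 * b₁ * (n.1 + a₁) - 2 * b₂ * (n.2 + a₂) : ℝ)))
    fun _ => norm_e_ofReal _).tsum_eq
  have h2 := (hasSum_stdTerm_mul τ' (c₁ := 1 / 3) (c₂ := 1 / 2) (by norm_num) (by norm_num) b₁ b₂
    (χ := fun n => e ((-a₁ * n.1 + a₂ * n.2 : ℝ))) fun _ => norm_e_ofReal _).tsum_eq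
  simp_rw [tsum_gaussKer h, intervalIntegral.integral_const_mul] at h1
  rw [← h2] at h1
  simp only [one_mul] at h1
  rw [stdTheta, h1, ← mul_assoc, ← Complex.ofReal_mul]
  congr 2
  obtain ⟨him, -⟩ := im_of_eq_neg_one_div h
  have hn : 0 < ‖(τ : ℂ)‖ := norm_pos_iff.2 τ.ne_zero
  rw [him, Complex.normSq_eq_norm_sq, Real.sqrt_div τ.im_pos.le, Real.sqrt_sq hn.le]
  field_simp

theorem tsum_int_mod {N : ℕ} [NeZero N] {f : ℤ → ℂ} (hf : Summable f) :
    ∑' n, f n = ∑ r : Fin N, ∑' p : ℤ, f (p * N + (r : ℕ)) := by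
  have hs : Summable (Function.uncurry fun (p : ℤ) (r : Fin N) => f (p * N + (r : ℕ))) :=
    (Int.divModEquiv N).symm.summable_iff.2 hf
  calc ∑' n, f n = ∑' q : ℤ × Fin N, f (q.1 * N + (q.2 : ℕ)) :=
        ((Int.divModEquiv N).symm.tsum_eq f).symm
    _ = ∑' (r : Fin N) (p : ℤ), f (p * N + (r : ℕ)) := by
        rw [hs.tsum_comm]; exact hs.tsum_prod
    _ = _ := tsum_fintype _

theorem tsum_int_neg_one_sub (f : ℤ → ℂ) : ∑' p : ℤ, f (-1 - p) = ∑' p : ℤ, f p :=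
  (Equiv.subLeft (-1 : ℤ)).tsum_eq f

theorem tsum_quarter {g : ℝ → ℂ} (hg : ∀ v, g (-v) = g v)
    (hs : Summable fun n : ℤ => g (1 / 2 * n + 1 / 4)) :
    ∑' n : ℤ, g (1 / 2 * n + 1 / 4) = 2 * ∑' n : ℤ, g (n + 1 / 4) := by
  rw [tsum_int_mod (N := 2) hs, Fin.sum_univ_two, two_mul]
  congr 1
  · refine tsum_congr fun p => congrArg g ?_
    simp; ring
  · rw [← tsum_int_neg_one_sub]
    refine tsum_congr fun p => ?_
    rw [← hg]
    refine congrArg g ?_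
    simp; ring

theorem neg_one_zpow_neg_one_sub (p : ℤ) : (-1 : ℂ) ^ (-1 - p) = -(-1) ^ p := by
  rw [zpow_sub₀ (by norm_num), _root_.zpow_neg_one]
  rcases Int.even_or_odd p with h | h
  · rw [h.neg_one_zpow]; norm_num
  · rw [h.neg_one_zpow]; norm_num

theorem e_neg_quarter : e (-(1 / 4)) = -Complex.I := by
  rw [e, show (2 * Real.pi * Complex.I * -(1 / 4) : ℂ) = -(Real.pi / 2 * Complex.I) by ring,
    Complex.exp_neg, Complex.exp_pi_div_two_mul_I, Complex.inv_I]

theorem tsum_quarter_twist {g : ℝ → ℂ} (hg : ∀ v, g (-v) = g v)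
    (hs : Summable fun n : ℤ => g (1 / 2 * n + 1 / 4) * e ((1 / 4 * n : ℝ))) :
    ∑' n : ℤ, g (1 / 2 * n + 1 / 4) * e ((1 / 4 * n : ℝ))
      = (1 - Complex.I) * ∑' n : ℤ, g (n + 1 / 4) * (-1) ^ n := by
  rw [tsum_int_mod (N := 2) hs, Fin.sum_univ_two, sub_mul, one_mul, sub_eq_add_neg]
  congr 1
  · refine tsum_congr fun p => ?_
    congr 1
    · refine congrArg g ?_
      simp; ring
    · rw [← e_half_intCast]
      congr 1
      simp; ring
  · rw [← tsum_int_neg_one_sub, ← neg_mul, ← tsum_mul_left]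
    refine tsum_congr fun p => ?_
    rw [mul_left_comm, ← hg]
    congr 1
    · refine congrArg g ?_
      simp; ring
    · have : ((1 / 4 * (((-1 - p) * (2 : ℕ) + ((1 : Fin 2) : ℕ) : ℤ) : ℝ) : ℝ) : ℂ)
        = -(1 / 4) + ((-p : ℤ) : ℂ) / 2 := by simp; ring
      rw [this, e_add, e_neg_quarter, e_half_intCast, _root_.zpow_neg]
      congr 1
      rcases Int.even_or_odd p with h | h <;> rw [h.neg_one_zpow] <;> norm_num

theorem tsum_sixth {g : ℝ → ℂ} (hg : ∀ v, g (-v) = g v)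
    (hs : Summable fun n : ℤ => g (1 / 3 * n + 1 / 6) * e ((-(1 / 6) * n : ℝ))) :
    ∑' n : ℤ, g (1 / 3 * n + 1 / 6) * e ((-(1 / 6) * n : ℝ))
      = (1 + e (1 / 6)) * ∑' n : ℤ, g (n + 1 / 6) * (-1) ^ n := by
  have hsign : ∀ p : ℤ, ((-1 : ℂ) ^ p)⁻¹ = (-1) ^ p := fun p => by
    rcases Int.even_or_odd p with h | h <;> rw [h.neg_one_zpow] <;> norm_num
  rw [tsum_int_mod (N := 3) hs, Fin.sum_univ_three, add_mul, one_mul]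
  have h1 : ∑' p : ℤ, g (1 / 3 * ((p * (3 : ℕ) + ((1 : Fin 3) : ℕ) : ℤ) : ℝ) + 1 / 6)
      * e ((-(1 / 6) * ((p * (3 : ℕ) + ((1 : Fin 3) : ℕ) : ℤ) : ℝ) : ℝ)) = 0 := by
    have h2 : ∀ p : ℤ, g (1 / 3 * ((p * (3 : ℕ) + ((1 : Fin 3) : ℕ) : ℤ) : ℝ) + 1 / 6)
        * e ((-(1 / 6) * ((p * (3 : ℕ) + ((1 : Fin 3) : ℕ) : ℤ) : ℝ) : ℝ))
        = e (-(1 / 6)) * (g (p + 1 / 2) * (-1) ^ p) := fun p => by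
      have : ((-(1 / 6) * ((p * (3 : ℕ) + ((1 : Fin 3) : ℕ) : ℤ) : ℝ) : ℝ) : ℂ)
        = -(1 / 6) + ((-p : ℤ) : ℂ) / 2 := by simp; ring
      rw [this, e_add, e_half_intCast, _root_.zpow_neg, hsign, mul_left_comm]
      congr 3
      simp; ring
    simp_rw [h2]
    rw [tsum_mul_left]
    have h3 := tsum_int_neg_one_sub fun p => g (p + 1 / 2) * (-1) ^ p
    have h4 : ∀ p : ℤ, g (((-1 - p : ℤ) : ℝ) + 1 / 2) * (-1 : ℂ) ^ (-1 - p)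
        = -(g (p + 1 / 2) * (-1) ^ p) := fun p => by
      rw [neg_one_zpow_neg_one_sub, mul_neg, ← hg]
      congr 3
      push_cast; ring
    simp_rw [h4] at h3
    rw [tsum_neg] at h3
    have h5 : ∑' p : ℤ, g (p + 1 / 2) * (-1 : ℂ) ^ p = 0 := by linear_combination -(1 / 2 : ℂ) * h3
    rw [h5, mul_zero]
  rw [h1, add_zero]
  congr 1
  · refine tsum_congr fun p => ?_
    congr 1
    · refine congrArg g ?_
      simp; ring
    · rw [← hsign, ← _root_.zpow_neg, ← e_half_intCast]
      congr 1
      simp; ring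
  · rw [← tsum_int_neg_one_sub, ← tsum_mul_left]
    refine tsum_congr fun p => ?_
    rw [mul_left_comm, ← hg]
    congr 1
    · refine congrArg g ?_
      simp; ring
    · have : ((-(1 / 6) * (((-1 - p) * (3 : ℕ) + ((2 : Fin 3) : ℕ) : ℤ) : ℝ) : ℝ) : ℂ)
        = 1 / 6 + (p : ℂ) / 2 := by simp; ring
      rw [this, e_add, e_half_intCast]

theorem one_sub_I_eq : 1 - Complex.I = (Real.sqrt 2 : ℂ) * e (-(1 / 8)) := by
  have h2 : (Real.sqrt 2 : ℂ) ^ 2 = 2 := by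
    rw [← Complex.ofReal_pow, Real.sq_sqrt (by norm_num)]; norm_num
  rw [e, show (2 * Real.pi * Complex.I * -(1 / 8) : ℂ)
    = ((-(Real.pi / 4) : ℝ) : ℂ) * Complex.I by push_cast; ring, Complex.exp_mul_I,
    ← Complex.ofReal_cos, ← Complex.ofReal_sin, Real.cos_neg, Real.sin_neg, Real.cos_pi_div_four,
    Real.sin_pi_div_four]
  push_cast
  linear_combination (-1 / 2 + Complex.I / 2) * h2

theorem one_add_e_sixth : 1 + e (1 / 6) = (Real.sqrt 3 : ℂ) * e (1 / 12) := by
  have h3 : (Real.sqrt 3 : ℂ) ^ 2 = 3 := by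
    rw [← Complex.ofReal_pow, Real.sq_sqrt (by norm_num)]; norm_num
  rw [e, e, show (2 * Real.pi * Complex.I * (1 / 6) : ℂ)
    = ((Real.pi / 3 : ℝ) : ℂ) * Complex.I by push_cast; ring,
    show (2 * Real.pi * Complex.I * (1 / 12) : ℂ)
    = ((Real.pi / 6 : ℝ) : ℂ) * Complex.I by push_cast; ring, Complex.exp_mul_I, Complex.exp_mul_I,
    ← Complex.ofReal_cos, ← Complex.ofReal_sin, ← Complex.ofReal_cos, ← Complex.ofReal_sin,
    Real.cos_pi_div_three, Real.sin_pi_div_three, Real.cos_pi_div_six, Real.sin_pi_div_six]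
  push_cast
  linear_combination (-1 / 2 : ℂ) * h3

theorem norm_neg_one_zpow (n : ℤ) : ‖(-1 : ℂ) ^ n‖ = 1 := by simp

/-- The dual lattice sum, with its second variable already reduced to a sum over `ℤ + 1/4`,
reduces to a sum over `w + ℤ²`. -/
theorem tsum_stdTerm_dual (τ : ℍ) {ψ χ : ℤ → ℂ} {κ : ℂ} (hψ : ∀ n, ‖ψ n‖ = 1)
    (hχ : ∀ n, ‖χ n‖ = 1)
    (hκ : ∀ g : ℝ → ℂ, (∀ v, g (-v) = g v) → (Summable fun n : ℤ => g (1 / 2 * n + 1 / 4) * ψ n) →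
      ∑' n : ℤ, g (1 / 2 * n + 1 / 4) * ψ n = κ * ∑' n : ℤ, g (n + 1 / 4) * χ n) :
    ∑' n : ℤ × ℤ, stdTerm τ (1 / 3 * n.1 + 1 / 6) (1 / 2 * n.2 + 1 / 4)
        * (e ((-(1 / 6) * n.1 : ℝ)) * ψ n.2)
      = κ * (1 + e (1 / 6)) * ∑' n : ℤ × ℤ, stdTerm τ (n.1 + 1 / 6) (n.2 + 1 / 4)
        * ((-1) ^ n.1 * χ n.2) := by
  have s1 := summable_stdTerm_mul τ (c₁ := 1 / 3) (c₂ := 1 / 2) (by norm_num) (by norm_num)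
    (1 / 6) (1 / 4) (χ := fun n => e ((-(1 / 6) * n.1 : ℝ)) * ψ n.2)
    fun n => by rw [norm_mul, norm_e_ofReal, hψ, one_mul]
  have s2 := summable_stdTerm_mul τ (c₁ := 1 / 3) (c₂ := 1) (by norm_num) (by norm_num)
    (1 / 6) (1 / 4) (χ := fun n => e ((-(1 / 6) * n.1 : ℝ)) * χ n.2)
    fun n => by rw [norm_mul, norm_e_ofReal, hχ, one_mul]
  have s3 := summable_stdTerm_mul τ (c₁ := 1) (c₂ := 1) (by norm_num) (by norm_num)
    (1 / 6) (1 / 4) (χ := fun n => (-1) ^ n.1 * χ n.2)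
    fun n => by rw [norm_mul, norm_neg_one_zpow, hχ, one_mul]
  simp only [one_mul] at s2 s3
  rw [s1.tsum_prod, s3.tsum_prod]
  have e1 : ∀ m : ℤ, ∑' n : ℤ, stdTerm τ (1 / 3 * m + 1 / 6) (1 / 2 * n + 1 / 4)
      * (e ((-(1 / 6) * m : ℝ)) * ψ n)
      = κ * ((∑' n : ℤ, stdTerm τ (1 / 3 * m + 1 / 6) (n + 1 / 4) * χ n)
        * e ((-(1 / 6) * m : ℝ))) := fun m => by
    have e0 : e ((-(1 / 6) * m : ℝ)) ≠ 0 := Complex.exp_ne_zero _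
    have s4 : Summable fun n : ℤ => stdTerm τ (1 / 3 * m + 1 / 6) (1 / 2 * n + 1 / 4) * ψ n := by
      refine ((s1.prod_factor m).mul_left (e ((-(1 / 6) * m : ℝ)))⁻¹).congr fun n => ?_
      rw [mul_left_comm (stdTerm _ _ _), inv_mul_cancel_left₀ e0]
    rw [← mul_assoc, ← hκ _ (fun v => stdTerm_neg_right _ _ _) s4, ← tsum_mul_right]
    exact tsum_congr fun n => by ring
  rw [tsum_congr e1, tsum_mul_left,
    tsum_sixth (g := fun v => ∑' n : ℤ, stdTerm τ v (n + 1 / 4) * χ n)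
      (fun v => by simp_rw [stdTerm_neg_left]), mul_assoc]
  · congr 2
    refine tsum_congr fun m => ?_
    rw [← tsum_mul_right]
    exact tsum_congr fun n => by ring
  · refine s2.prod.congr fun m => ?_
    rw [← tsum_mul_right]
    exact tsum_congr fun n => by ring

theorem neg_one_zpow_neg (l : ℤ) : (-1 : ℂ) ^ (-l) = (-1) ^ l := by
  rw [_root_.zpow_neg]
  rcases Int.even_or_odd l with h | h <;> rw [h.neg_one_zpow] <;> norm_num

theorem stdTheta_uw_S {τ τ' : ℍ} (h : (τ' : ℂ) = -1 / (τ : ℂ)) :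
    stdTheta (1 / 6) 0 (1 / 6) (1 / 4) τ
      = (Real.sqrt 2 : ℂ) * stdTheta (1 / 6) (1 / 4) (1 / 6) 0 τ' := by
  have h1 := tsum_stdTerm_dual τ' (ψ := fun _ => 1) (χ := fun _ => 1) (κ := 2) (by simp) (by simp)
    fun g hg hs => by
      simp only [mul_one] at hs ⊢
      exact tsum_quarter hg hs
  rw [stdTheta_neg_one_div h, stdTheta]
  have e1 : ∀ n : ℤ × ℤ, e ((-(1 / 6) * n.1 + 0 * n.2 : ℝ)) = e ((-(1 / 6) * n.1 : ℝ)) * 1 :=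
    fun n => by rw [zero_mul, add_zero, mul_one]
  have e2 : ∀ n : ℤ × ℤ, e ((3 * (1 / 6) * (n.1 + 1 / 6) - 2 * 0 * (n.2 + 1 / 4) : ℝ))
      = ((-1) ^ n.1 * 1) * e (1 / 12) := fun n => by
    rw [mul_one, ← e_half_intCast, ← e_add]
    congr 1
    push_cast
    ring
  simp_rw [e1, e2]
  simp_rw [← mul_assoc (stdTerm _ _ _) _ (e (1 / 12))]
  rw [h1, one_add_e_sixth, tsum_mul_right]
  generalize ∑' n : ℤ × ℤ, stdTerm τ' (n.1 + 1 / 6) (n.2 + 1 / 4) * ((-1) ^ n.1 * 1) = Z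
  have h2 : (Real.sqrt 2 : ℂ) ^ 2 = 2 := by
    rw [← Complex.ofReal_pow, Real.sq_sqrt (by norm_num)]; norm_num
  have h3 : Real.sqrt 6 = Real.sqrt 2 * Real.sqrt 3 := by
    rw [← Real.sqrt_mul (by norm_num)]; norm_num
  have h4 : (Real.sqrt 3 : ℂ) ≠ 0 := by
    exact_mod_cast (Real.sqrt_pos.2 (by norm_num : (0 : ℝ) < 3)).ne'
  have h5 : (Real.sqrt 2 : ℂ) ≠ 0 := by
    exact_mod_cast (Real.sqrt_pos.2 (by norm_num : (0 : ℝ) < 2)).ne'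
  rw [h3]
  push_cast
  field_simp
  rw [h2]

theorem stdTheta_ww_S {τ τ' : ℍ} (h : (τ' : ℂ) = -1 / (τ : ℂ)) :
    stdTheta (1 / 6) (1 / 4) (1 / 6) (1 / 4) τ = stdTheta (1 / 6) (1 / 4) (1 / 6) (1 / 4) τ' := by
  have h1 := tsum_stdTerm_dual τ' (ψ := fun n => e ((1 / 4 * n : ℝ))) (χ := fun n => (-1) ^ n)
    (fun _ => norm_e_ofReal _) norm_neg_one_zpow fun g hg hs => tsum_quarter_twist hg hs
  rw [stdTheta_neg_one_div h, stdTheta]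
  have e1 : ∀ n : ℤ × ℤ, e ((-(1 / 6) * n.1 + 1 / 4 * n.2 : ℝ))
      = e ((-(1 / 6) * n.1 : ℝ)) * e ((1 / 4 * n.2 : ℝ)) :=
    fun n => by rw [Complex.ofReal_add, e_add]
  have e2 : ∀ n : ℤ × ℤ, e ((3 * (1 / 6) * (n.1 + 1 / 6) - 2 * (1 / 4) * (n.2 + 1 / 4) : ℝ))
      = ((-1) ^ n.1 * (-1) ^ n.2) * (e (1 / 12) * e (-(1 / 8))) := fun n => by
    rw [← neg_one_zpow_neg n.2, ← e_half_intCast, ← e_half_intCast, ← e_add, ← e_add, ← e_add]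
    congr 1
    push_cast
    ring
  simp_rw [e1, e2]
  simp_rw [← mul_assoc (stdTerm _ _ _) _ (e (1 / 12) * e (-(1 / 8)))]
  rw [h1, one_add_e_sixth, one_sub_I_eq, tsum_mul_right]
  generalize ∑' n : ℤ × ℤ, stdTerm τ' (n.1 + 1 / 6) (n.2 + 1 / 4) * ((-1) ^ n.1 * (-1) ^ n.2) = Z
  have h3 : Real.sqrt 6 = Real.sqrt 2 * Real.sqrt 3 := by
    rw [← Real.sqrt_mul (by norm_num)]; norm_num
  have h4 : (Real.sqrt 3 : ℂ) ≠ 0 := by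
    exact_mod_cast (Real.sqrt_pos.2 (by norm_num : (0 : ℝ) < 3)).ne'
  have h5 : (Real.sqrt 2 : ℂ) ≠ 0 := by
    exact_mod_cast (Real.sqrt_pos.2 (by norm_num : (0 : ℝ) < 2)).ne'
  rw [h3]
  push_cast
  field_simp

theorem gaussKer_vadd_one (τ : ℍ) (t v₁ v₂ : ℝ) : gaussKer ((1 : ℝ) +ᵥ τ) t v₁ v₂
    = e (((3 * v₁ ^ 2 - 2 * v₂ ^ 2) / 2 : ℝ)) * gaussKer τ t v₁ v₂ := by
  rw [gaussKer, gaussKer, ← mul_assoc, ← e_add, UpperHalfPlane.vadd_im, UpperHalfPlane.coe_vadd]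
  congr 2
  push_cast
  ring

theorem stdTerm_vadd_one (τ : ℍ) (v₁ v₂ : ℝ) : stdTerm ((1 : ℝ) +ᵥ τ) v₁ v₂
    = e (((3 * v₁ ^ 2 - 2 * v₂ ^ 2) / 2 : ℝ)) * stdTerm τ v₁ v₂ := by
  simp only [stdTerm, gaussKer_vadd_one, intervalIntegral.integral_const_mul]

theorem stdTheta_vadd_one (τ : ℍ) {a₁ a₂ b₁ b₂ b₁' b₂' : ℝ} {z : ℂ}
    (h : ∀ m n : ℤ, e (((3 * (m + a₁) ^ 2 - 2 * (n + a₂) ^ 2) / 2 : ℝ))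
      * e ((3 * b₁ * (m + a₁) - 2 * b₂ * (n + a₂) : ℝ))
      = z * e ((3 * b₁' * (m + a₁) - 2 * b₂' * (n + a₂) : ℝ))) :
    stdTheta a₁ a₂ b₁ b₂ ((1 : ℝ) +ᵥ τ) = z * stdTheta a₁ a₂ b₁' b₂' τ := by
  rw [stdTheta, stdTheta, UpperHalfPlane.vadd_im, mul_left_comm z, ← tsum_mul_left (a := z)]
  congr 1
  refine tsum_congr fun n => ?_
  rw [stdTerm_vadd_one, mul_comm (e _) (stdTerm _ _ _), mul_assoc, h]
  ring

theorem exists_pentagonal (m : ℤ) : ∃ k : ℤ, m * (3 * m + 1) = 2 * k := by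
  rcases Int.even_or_odd' m with ⟨k, rfl | rfl⟩
  · exact ⟨k * (3 * (2 * k) + 1), by ring⟩
  · exact ⟨(2 * k + 1) * (3 * k + 2), by ring⟩

theorem e_add_intCast (x : ℂ) (k : ℤ) : e (x + k) = e x := by
  rw [e_add, e_intCast, mul_one]

theorem stdTheta_uw_T (τ : ℍ) : stdTheta (1 / 6) 0 (1 / 6) (1 / 4) ((1 : ℝ) +ᵥ τ)
    = zeta 24 * stdTheta (1 / 6) 0 (1 / 6) (1 / 4) τ := by
  refine stdTheta_vadd_one τ fun m n => ?_
  congr 1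
  obtain ⟨k, hk⟩ := exists_pentagonal m
  have hk' : (m : ℂ) * (3 * m + 1) = 2 * k := by exact_mod_cast hk
  rw [zeta_eq_e, ← e_add_intCast _ (n ^ 2 - k)]
  congr 1
  push_cast
  linear_combination (1 / 2 : ℂ) * hk'

theorem stdTheta_wu_T (τ : ℍ) : stdTheta (1 / 6) (1 / 4) (1 / 6) 0 ((1 : ℝ) +ᵥ τ)
    = zeta 48 ^ 5 * stdTheta (1 / 6) (1 / 4) (1 / 6) (1 / 4) τ := by
  refine stdTheta_vadd_one τ fun m n => ?_
  obtain ⟨k, hk⟩ := exists_pentagonal m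
  have hk' : (m : ℂ) * (3 * m + 1) = 2 * k := by exact_mod_cast hk
  rw [zeta_pow_eq_e, ← e_add, ← e_add, ← e_add_intCast (_ + _) (n ^ 2 - k)]
  congr 1
  push_cast
  linear_combination (1 / 2 : ℂ) * hk'

theorem stdTheta_ww_T (τ : ℍ) : stdTheta (1 / 6) (1 / 4) (1 / 6) (1 / 4) ((1 : ℝ) +ᵥ τ)
    = zeta 48 ^ (-7 : ℤ) * stdTheta (1 / 6) (1 / 4) (1 / 6) 0 τ := by
  refine stdTheta_vadd_one τ fun m n => ?_
  obtain ⟨k, hk⟩ := exists_pentagonal m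
  have hk' : (m : ℂ) * (3 * m + 1) = 2 * k := by exact_mod_cast hk
  rw [zeta_zpow_eq_e, ← e_add, ← e_add, ← e_add_intCast (_ + _) (n ^ 2 + n - k)]
  congr 1
  push_cast
  linear_combination (1 / 2 : ℂ) * hk'

theorem exists_norm_stdTheta_le (a₁ a₂ b₁ b₂ : ℝ) :
    ∃ K, ∀ τ : ℍ, 1 ≤ τ.im → ‖stdTheta a₁ a₂ b₁ b₂ τ‖ ≤ K * Real.sqrt τ.im := by
  have hs := (summable_gauss_bound UpperHalfPlane.I one_ne_zero one_ne_zero a₁ a₂).mul_right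
    (2 * halfLength)
  have hL := halfLength_pos
  have ⟨K, hK⟩ : ∃ K, HasSum _ K := ⟨_, hs.hasSum⟩
  refine ⟨K, fun τ hτ => ?_⟩
  rw [stdTheta, norm_mul, Complex.norm_real, Real.norm_of_nonneg (Real.sqrt_nonneg _), mul_comm]
  refine mul_le_mul_of_nonneg_right (tsum_of_norm_bounded hK fun n => ?_)
    (Real.sqrt_nonneg _)
  rw [norm_mul, norm_e_ofReal, mul_one]
  refine (norm_stdTerm_le _ _ _).trans (mul_le_mul_of_nonneg_right ?_ (by positivity))
  rw [one_mul, one_mul, UpperHalfPlane.I_im, Real.exp_le_exp, neg_le_neg_iff]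
  gcongr

end ThetaSeries
end CohenMaass
end

noncomputable section
namespace CohenMaass
open Matrix UpperHalfPlane MeasureTheory
section Unfolding

/-- The first light-cone coordinate of the lattice point `(k + 1/6, j)`. -/
def lightX (p : ℤ × ℤ) : ℝ := Real.sqrt 6 * (p.1 + 1 / 6) - 2 * p.2

/-- The second light-cone coordinate of the lattice point `(k + 1/6, j)`. -/
def lightY (p : ℤ × ℤ) : ℝ := Real.sqrt 6 * (p.1 + 1 / 6) + 2 * p.2

/-- The rapidity `log |Y/X|` of a lattice point. -/
def rapidity (p : ℤ × ℤ) : ℝ := Real.log |lightY p| - Real.log |lightX p|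

/-- The action on indices of the automorphism `-(5 4; 6 5)` of the lattice coset. -/
def unitStep : Equiv.Perm (ℤ × ℤ) where
  toFun p := (-5 * p.1 - 4 * p.2 - 1, -6 * p.1 - 5 * p.2 - 1)
  invFun p := (-5 * p.1 + 4 * p.2 - 1, 6 * p.1 - 5 * p.2 + 1)
  left_inv p := by ext <;> simp <;> ring
  right_inv p := by ext <;> simp <;> ring

/-- The fundamental domain for the powers of `unitStep`. -/
def coneDomain : Set (ℤ × ℤ) := {p | PosCone p.1 p.2 ∨ NegCone p.1 p.2}

theorem sq_sqrt_six : Real.sqrt 6 ^ 2 = 6 := Real.sq_sqrt (by norm_num)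

theorem exp_two_mul_halfLength : Real.exp (2 * halfLength) = 5 + 2 * Real.sqrt 6 := by
  have h2 : Real.sqrt 2 ^ 2 = 2 := Real.sq_sqrt (by norm_num)
  have h3 : Real.sqrt 3 ^ 2 = 3 := Real.sq_sqrt (by norm_num)
  have h6 : Real.sqrt 6 = Real.sqrt 3 * Real.sqrt 2 := by
    rw [← Real.sqrt_mul (by norm_num)]; norm_num
  rw [two_mul, Real.exp_add, ← Real.cosh_add_sinh, cosh_halfLength, sinh_halfLength, h6]
  linear_combination h2 + h3

theorem exp_neg_two_mul_halfLength : Real.exp (-(2 * halfLength)) = 5 - 2 * Real.sqrt 6 := by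
  have h : (5 + 2 * Real.sqrt 6) * (5 - 2 * Real.sqrt 6) = 1 := by
    linear_combination -4 * sq_sqrt_six
  have h' : 0 < 5 + 2 * Real.sqrt 6 := by positivity
  rw [Real.exp_neg, exp_two_mul_halfLength]
  exact inv_eq_of_mul_eq_one_right h

theorem cosh_two_mul_halfLength : Real.cosh (2 * halfLength) = 5 := by
  rw [Real.cosh_eq, exp_two_mul_halfLength, exp_neg_two_mul_halfLength]; ring

theorem lightX_mul_lightY (p : ℤ × ℤ) : lightX p * lightY p = latNorm p.1 p.2 / 6 := by
  rw [lightX, lightY, latNorm]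
  push_cast
  linear_combination ((p.1 : ℝ) + 1 / 6) ^ 2 * sq_sqrt_six

theorem lightX_sq_add_lightY_sq (p : ℤ × ℤ) :
    lightX p ^ 2 + lightY p ^ 2 = 12 * (p.1 + 1 / 6) ^ 2 + 8 * p.2 ^ 2 := by
  rw [lightX, lightY]
  linear_combination 2 * ((p.1 : ℝ) + 1 / 6) ^ 2 * sq_sqrt_six

theorem latNorm_ne_zero (k j : ℤ) : latNorm k j ≠ 0 := by
  intro h
  have h1 : latNorm k j = 2 * (18 * k ^ 2 + 6 * k - 12 * j ^ 2) + 1 := by rw [latNorm]; ring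
  omega

theorem lightX_ne_zero (p : ℤ × ℤ) : lightX p ≠ 0 := by
  intro h
  have := lightX_mul_lightY p
  rw [h, zero_mul, eq_comm, div_eq_zero_iff] at this
  rcases this with h1 | h1
  · exact latNorm_ne_zero _ _ (by exact_mod_cast h1)
  · norm_num at h1

theorem lightY_ne_zero (p : ℤ × ℤ) : lightY p ≠ 0 := by
  intro h
  have := lightX_mul_lightY p
  rw [h, mul_zero, eq_comm, div_eq_zero_iff] at this
  rcases this with h1 | h1
  · exact latNorm_ne_zero _ _ (by exact_mod_cast h1)
  · norm_num at h1

theorem exp_rapidity (p : ℤ × ℤ) : Real.exp (rapidity p) = |lightY p| / |lightX p| := by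
  rw [rapidity, Real.exp_sub, Real.exp_log (abs_pos.2 (lightY_ne_zero p)),
    Real.exp_log (abs_pos.2 (lightX_ne_zero p))]

theorem abs_latNorm_mul_exp (p : ℤ × ℤ) :
    |(latNorm p.1 p.2 : ℝ)| * Real.exp (rapidity p) = 6 * lightY p ^ 2 := by
  have hX := abs_pos.2 (lightX_ne_zero p)
  rw [exp_rapidity, show (latNorm p.1 p.2 : ℝ) = 6 * (lightX p * lightY p) by
    rw [lightX_mul_lightY]; ring, abs_mul, abs_mul, abs_of_pos (by norm_num : (0 : ℝ) < 6),
    ← sq_abs (lightY p)]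
  field_simp

theorem abs_latNorm_mul_exp_neg (p : ℤ × ℤ) :
    |(latNorm p.1 p.2 : ℝ)| * Real.exp (-rapidity p) = 6 * lightX p ^ 2 := by
  have hX := abs_pos.2 (lightX_ne_zero p)
  have hY := abs_pos.2 (lightY_ne_zero p)
  rw [Real.exp_neg, exp_rapidity, show (latNorm p.1 p.2 : ℝ) = 6 * (lightX p * lightY p) by
    rw [lightX_mul_lightY]; ring, abs_mul, abs_mul, abs_of_pos (by norm_num : (0 : ℝ) < 6),
    ← sq_abs (lightX p)]
  field_simp

theorem abs_latNorm_mul_cosh_rapidity (p : ℤ × ℤ) :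
    |(latNorm p.1 p.2 : ℝ)| * Real.cosh (rapidity p)
      = (6 * (p.1 : ℝ) + 1) ^ 2 + 24 * (p.2 : ℝ) ^ 2 := by
  rw [Real.cosh_eq]
  linear_combination (1 / 2 : ℝ) * (abs_latNorm_mul_exp p + abs_latNorm_mul_exp_neg p)
    + 3 * lightX_sq_add_lightY_sq p

theorem unitStep_apply (p : ℤ × ℤ) :
    unitStep p = (-5 * p.1 - 4 * p.2 - 1, -6 * p.1 - 5 * p.2 - 1) := rfl

theorem latNorm_unitStep (p : ℤ × ℤ) :
    latNorm (unitStep p).1 (unitStep p).2 = latNorm p.1 p.2 := by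
  simp only [unitStep_apply, latNorm]; ring

theorem latSign_unitStep (p : ℤ × ℤ) :
    latSign (unitStep p).1 (unitStep p).2 = latSign p.1 p.2 := by
  refine latSign_eq_of_even ⟨-6 * p.1 - 5 * p.2 - 1, ?_⟩
  simp only [unitStep_apply]; ring

theorem rapidity_unitStep (p : ℤ × ℤ) : rapidity (unitStep p) = rapidity p + 4 * halfLength := by
  have hX : lightX (unitStep p) = -(Real.exp (-(2 * halfLength)) * lightX p) := by
    rw [exp_neg_two_mul_halfLength]
    simp only [lightX, unitStep_apply]
    push_cast
    linear_combination (-2 * ((p.1 : ℝ) + 1 / 6)) * sq_sqrt_six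
  have hY : lightY (unitStep p) = -(Real.exp (2 * halfLength) * lightY p) := by
    rw [exp_two_mul_halfLength]
    simp only [lightY, unitStep_apply]
    push_cast
    linear_combination (2 * ((p.1 : ℝ) + 1 / 6)) * sq_sqrt_six
  rw [rapidity, rapidity, hX, hY, abs_neg, abs_neg, abs_mul, abs_mul, Real.abs_exp, Real.abs_exp,
    Real.log_mul (Real.exp_ne_zero _) (abs_pos.2 (lightY_ne_zero p)).ne',
    Real.log_mul (Real.exp_ne_zero _) (abs_pos.2 (lightX_ne_zero p)).ne', Real.log_exp,
    Real.log_exp]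
  ring

theorem apply_perm_zpow {α M : Type*} [AddCommGroup M] {σ : Equiv.Perm α} {f : α → M} {c : M}
    (h : ∀ p, f (σ p) = f p + c) (k : ℤ) : ∀ p, f ((σ ^ k) p) = f p + k • c := by
  induction k with
  | zero => simp
  | succ n ih =>
    intro p
    rw [_root_.zpow_add_one, Equiv.Perm.mul_apply, ih, h, add_smul, one_smul]
    abel
  | pred n ih =>
    intro p
    have h1 := h (σ⁻¹ p)
    rw [show σ (σ⁻¹ p) = p from σ.apply_symm_apply p] at h1
    rw [_root_.zpow_sub_one, Equiv.Perm.mul_apply, ih, h1, sub_smul, one_smul]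
    abel

theorem latNorm_unitStep_zpow (k : ℤ) (p : ℤ × ℤ) :
    latNorm ((unitStep ^ k) p).1 ((unitStep ^ k) p).2 = latNorm p.1 p.2 := by
  simpa using apply_perm_zpow (f := fun p => latNorm p.1 p.2) (c := 0)
    (fun p => by rw [latNorm_unitStep, add_zero]) k p

theorem latSign_unitStep_zpow (k : ℤ) (p : ℤ × ℤ) :
    latSign ((unitStep ^ k) p).1 ((unitStep ^ k) p).2 = latSign p.1 p.2 := by
  simpa using apply_perm_zpow (f := fun p => latSign p.1 p.2) (c := 0)
    (fun p => by rw [latSign_unitStep, add_zero]) k p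

theorem rapidity_unitStep_zpow (k : ℤ) (p : ℤ × ℤ) :
    rapidity ((unitStep ^ k) p) = rapidity p + k * (4 * halfLength) := by
  simpa using apply_perm_zpow rapidity_unitStep k p

theorem abs_rapidity_lt_iff (p : ℤ × ℤ) : |rapidity p| < 2 * halfLength ↔
    (6 * p.1 + 1) ^ 2 + 24 * p.2 ^ 2 < 5 * |latNorm p.1 p.2| := by
  have hL := halfLength_pos
  have hN : 0 < |(latNorm p.1 p.2 : ℝ)| :=
    abs_pos.2 (by exact_mod_cast latNorm_ne_zero p.1 p.2)
  rw [← abs_of_pos (by linarith : 0 < 2 * halfLength), ← Real.cosh_lt_cosh,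
    cosh_two_mul_halfLength, ← mul_lt_mul_iff_right₀ hN, abs_latNorm_mul_cosh_rapidity,
    mul_comm _ (5 : ℝ)]
  exact_mod_cast Iff.rfl

theorem abs_rapidity_le_iff (p : ℤ × ℤ) : |rapidity p| ≤ 2 * halfLength ↔
    (6 * p.1 + 1) ^ 2 + 24 * p.2 ^ 2 ≤ 5 * |latNorm p.1 p.2| := by
  have hL := halfLength_pos
  have hN : 0 < |(latNorm p.1 p.2 : ℝ)| :=
    abs_pos.2 (by exact_mod_cast latNorm_ne_zero p.1 p.2)
  rw [← abs_of_pos (by linarith : 0 < 2 * halfLength), ← Real.cosh_le_cosh,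
    cosh_two_mul_halfLength, ← mul_le_mul_iff_right₀ hN, abs_latNorm_mul_cosh_rapidity,
    mul_comm _ (5 : ℝ)]
  exact_mod_cast Iff.rfl

theorem abs_rapidity_lt_of_mem {p : ℤ × ℤ} (hp : p ∈ coneDomain) :
    |rapidity p| < 2 * halfLength := by
  rw [abs_rapidity_lt_iff]
  rcases hp with h | h
  · rw [PosCone, ← sq_lt_sq] at h
    refine lt_of_lt_of_le ?_ (mul_le_mul_of_nonneg_left (le_abs_self _) (by norm_num))
    rw [latNorm]
    nlinarith
  · rw [NegCone, ← abs_of_pos (by norm_num : (0 : ℤ) < 4), ← abs_mul, ← sq_lt_sq] at h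
    refine lt_of_lt_of_le ?_ (mul_le_mul_of_nonneg_left (neg_le_abs _) (by norm_num))
    rw [latNorm]
    nlinarith

theorem mem_of_abs_rapidity_le {p : ℤ × ℤ} (hp : |rapidity p| ≤ 2 * halfLength) :
    p ∈ coneDomain := by
  rw [abs_rapidity_le_iff] at hp
  rcases le_or_gt 0 (latNorm p.1 p.2) with h | h
  · left
    rw [abs_of_nonneg h, latNorm] at hp
    have h1 : |6 * p.2| ≤ |6 * p.1 + 1| := sq_le_sq.1 (by nlinarith)
    refine lt_of_le_of_ne h1 fun h2 => ?_
    rcases abs_eq_abs.1 h2 with h3 | h3 <;> omega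
  · right
    rw [abs_of_neg h, latNorm] at hp
    have h1 : |6 * p.1 + 1| ≤ |4 * p.2| := sq_le_sq.1 (by nlinarith)
    rw [NegCone, ← abs_of_pos (by norm_num : (0 : ℤ) < 4), ← abs_mul]
    refine lt_of_le_of_ne h1 fun h2 => ?_
    rcases abs_eq_abs.1 h2 with h3 | h3 <;> omega

theorem bijective_unitStep_zpow :
    Function.Bijective fun q : ℤ × coneDomain => (unitStep ^ q.1) (q.2 : ℤ × ℤ) := by
  have hL := halfLength_pos
  constructor
  · rintro ⟨k, p, hp⟩ ⟨l, r, hr⟩ h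
    simp only at h
    have h1 : k = l := by
      have h2 := congrArg rapidity h
      rw [rapidity_unitStep_zpow, rapidity_unitStep_zpow] at h2
      have h3 := abs_lt.1 (abs_rapidity_lt_of_mem hp)
      have h4 := abs_lt.1 (abs_rapidity_lt_of_mem hr)
      have h5 : |((k - l : ℤ) : ℝ)| < 1 := by
        rw [abs_lt]
        push_cast
        constructor <;> nlinarith
      have h6 : |k - l| < 1 := by exact_mod_cast h5
      rw [Int.abs_lt_one_iff] at h6
      omega
    subst h1
    have h2 := (unitStep ^ k).injective h
    simp only [h2]
  · intro p
    set x := rapidity p / (4 * halfLength) with hx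
    have h1 := abs_sub_round x
    have h2 : (unitStep ^ (-round x)) p ∈ coneDomain := by
      apply mem_of_abs_rapidity_le
      rw [rapidity_unitStep_zpow]
      have h3 : rapidity p + ((-round x : ℤ) : ℝ) * (4 * halfLength)
          = (x - round x) * (4 * halfLength) := by
        rw [hx]; push_cast; field_simp; ring
      rw [h3, abs_mul, abs_of_pos (by linarith : 0 < 4 * halfLength)]
      nlinarith
    refine ⟨(round x, ⟨_, h2⟩), ?_⟩
    simp only [← Equiv.Perm.mul_apply, ← _root_.zpow_add]
    simp

/-- The lattice coset is the disjoint union of the translates of the fundamental domain. -/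
def unfoldEquiv : ℤ × coneDomain ≃ ℤ × ℤ := Equiv.ofBijective _ bijective_unitStep_zpow

theorem unfoldEquiv_apply (q : ℤ × coneDomain) :
    unfoldEquiv q = (unitStep ^ q.1) (q.2 : ℤ × ℤ) := rfl

theorem gaussKer_eq_cosh (τ : ℍ) (t : ℝ) (p : ℤ × ℤ) : gaussKer τ t (p.1 + 1 / 6) (p.2 + 0)
    = e ((latNorm p.1 p.2 * τ.re / 24 : ℝ)) * (Real.exp
      (-(2 * Real.pi * |(latNorm p.1 p.2 : ℝ)| * τ.im / 24) * Real.cosh (2 * t - rapidity p)) : ℂ) := by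
  rw [gaussKer_eq_cexp, Complex.ofReal_exp, e, ← Complex.exp_add]
  congr 1
  have h : |(latNorm p.1 p.2 : ℝ)| * Real.cosh (2 * t - rapidity p)
      = 3 * (Real.exp (2 * t) * lightX p ^ 2 + Real.exp (-(2 * t)) * lightY p ^ 2) := by
    rw [Real.cosh_eq, show -(2 * t - rapidity p) = -(2 * t) + rapidity p by ring,
      sub_eq_add_neg (2 * t), Real.exp_add, Real.exp_add]
    linear_combination (Real.exp (2 * t) / 2) * abs_latNorm_mul_exp_neg p
      + (Real.exp (-(2 * t)) / 2) * abs_latNorm_mul_exp p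
  have h' : -(2 * Real.pi * |(latNorm p.1 p.2 : ℝ)| * τ.im / 24) * Real.cosh (2 * t - rapidity p)
      = -Real.pi * τ.im * (Real.cosh (2 * t) * (3 * (p.1 + 1 / 6) ^ 2 + 2 * p.2 ^ 2)
        - 2 * Real.sqrt 6 * Real.sinh (2 * t) * (p.1 + 1 / 6) * p.2) := by
    rw [Real.cosh_eq (2 * t), Real.sinh_eq (2 * t)]
    rw [lightX, lightY] at h
    linear_combination (-(2 * Real.pi * τ.im / 24)) * h
      - Real.pi * τ.im / 4 * (Real.exp (2 * t) + Real.exp (-(2 * t))) * (p.1 + 1 / 6) ^ 2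
        * sq_sqrt_six
  rw [h', latNorm]
  push_cast
  ring

theorem gaussKer_unitStep_zpow (τ : ℍ) (t : ℝ) (k : ℤ) (p : ℤ × ℤ) :
    gaussKer τ t (((unitStep ^ k) p).1 + 1 / 6) (((unitStep ^ k) p).2 + 0)
      = gaussKer τ (t - k * (2 * halfLength)) (p.1 + 1 / 6) (p.2 + 0) := by
  rw [gaussKer_eq_cosh, gaussKer_eq_cosh, latNorm_unitStep_zpow, rapidity_unitStep_zpow]
  congr 5
  ring

end Unfolding
end CohenMaass
end

noncomputable section
namespace CohenMaass
open Matrix UpperHalfPlane MeasureTheory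
section ConeSum

theorem besselK0_pos {x : ℝ} (hx : 0 < x) : 0 < besselK0 x :=
  (Real.exp_pos _).trans_le (exp_le_besselK0 hx)

theorem integral_exp_neg_mul_cosh (x : ℝ) :
    ∫ u, Real.exp (-x * Real.cosh u) = 2 * besselK0 x := by
  rw [besselK0, ← integral_comp_abs (f := fun u => Real.exp (-x * Real.cosh u))]
  simp only [Real.cosh_abs]

theorem integrable_exp_neg_mul_cosh {x : ℝ} (hx : 0 < x) :
    Integrable fun u => Real.exp (-x * Real.cosh u) := by
  by_contra h
  have h1 := integral_exp_neg_mul_cosh x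
  rw [integral_undef h] at h1
  linarith [besselK0_pos hx]

theorem integrable_exp_neg_mul_cosh_affine {x : ℝ} (hx : 0 < x) (l : ℝ) :
    Integrable fun t => Real.exp (-x * Real.cosh (2 * t - l)) :=
  ((integrable_exp_neg_mul_cosh hx).comp_sub_right l).comp_mul_left' two_ne_zero

theorem integral_exp_neg_mul_cosh_affine (x l : ℝ) :
    ∫ t, Real.exp (-x * Real.cosh (2 * t - l)) = besselK0 x := by
  rw [Measure.integral_comp_mul_left (fun u => Real.exp (-x * Real.cosh (u - l))) 2,
    integral_sub_right_eq_self fun u => Real.exp (-x * Real.cosh u), integral_exp_neg_mul_cosh,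
    abs_of_pos (by norm_num), smul_eq_mul]
  ring

/-- The integral of an integrable function is the sum of its integrals over the translates of
`[-c, c]` by `2cℤ`. -/
theorem hasSum_integral_translates {f : ℝ → ℂ} (hf : Integrable f) {c : ℝ} (hc : 0 < c) :
    HasSum (fun k : ℤ => ∫ t in (-c)..c, f (t - k * (2 * c))) (∫ t, f t) := by
  have hg : Integrable fun u => f (2 * c * u) := hf.comp_mul_left' (by positivity)
  have h := (hg.hasSum_intervalIntegral (-(1 / 2))).mul_left ((2 * c : ℝ) : ℂ)
  rw [Measure.integral_comp_mul_left f, abs_of_pos (by positivity), Complex.real_smul,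
    ← mul_assoc, ← Complex.ofReal_mul, mul_inv_cancel₀ (by positivity), Complex.ofReal_one,
    one_mul] at h
  refine (Equiv.neg ℤ).hasSum_iff.1 ((congrArg (HasSum · _) (funext fun k => ?_)).mpr h)
  simp only [Function.comp_apply, Equiv.neg_apply]
  rw [intervalIntegral.integral_comp_sub_right f, ← Complex.real_smul,
    intervalIntegral.smul_integral_comp_mul_left]
  congr 1 <;> push_cast <;> ring

theorem hasSum_stdTerm_unitStep (τ : ℍ) (p : ℤ × ℤ) :
    HasSum (fun k : ℤ => stdTerm τ (((unitStep ^ k) p).1 + 1 / 6) (((unitStep ^ k) p).2 + 0))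
      (e ((latNorm p.1 p.2 * τ.re / 24 : ℝ))
        * (besselK0 (2 * Real.pi * |(latNorm p.1 p.2 : ℝ)| * τ.im / 24) : ℂ)) := by
  have hN : 0 < |(latNorm p.1 p.2 : ℝ)| :=
    abs_pos.2 (by exact_mod_cast latNorm_ne_zero p.1 p.2)
  have hτ := τ.im_pos
  have hx : 0 < 2 * Real.pi * |(latNorm p.1 p.2 : ℝ)| * τ.im / 24 := by positivity
  have h := hasSum_integral_translates (f := fun t => gaussKer τ t (p.1 + 1 / 6) (p.2 + 0)) (by
    simp_rw [gaussKer_eq_cosh]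
    exact (integrable_exp_neg_mul_cosh_affine hx _).ofReal.const_mul _) halfLength_pos
  simp only [stdTerm, gaussKer_unitStep_zpow]
  simp_rw [gaussKer_eq_cosh] at h ⊢
  rwa [integral_const_mul, integral_complex_ofReal, integral_exp_neg_mul_cosh_affine] at h

/-- The terms of the theta series after unfolding. -/
def coneTerm (τ : ℍ) (p : ℤ × ℤ) : ℂ :=
  latSign p.1 p.2 * (e ((latNorm p.1 p.2 * τ.re / 24 : ℝ))
    * (besselK0 (2 * Real.pi * |(latNorm p.1 p.2 : ℝ)| * τ.im / 24) : ℂ))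

theorem latSign_eq (k j : ℤ) : latSign k j = (-1) ^ (k + j) := by
  rw [latSign]
  rcases Int.even_or_odd (k + j) with h | h <;> rw [h.neg_one_zpow, h.neg_one_zpow] <;> simp

theorem norm_latSign (k j : ℤ) : ‖latSign k j‖ = 1 := by
  rw [latSign_eq, norm_neg_one_zpow]

theorem e_pairing (k j : ℤ) : e ((3 * (1 / 6) * (k + 1 / 6) - 2 * (1 / 4) * (j + 0) : ℝ))
    = zeta 12 * latSign k j := by
  rw [zeta_eq_e, latSign_eq, zpow_add₀ (by norm_num), ← neg_one_zpow_neg j, ← e_half_intCast,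
    ← e_half_intCast, ← e_add, ← e_add]
  congr 1
  push_cast
  ring

theorem hasSum_coneTerm (τ : ℍ) : HasSum (fun p : coneDomain => coneTerm τ p)
    (∑' n : ℤ × ℤ, stdTerm τ (n.1 + 1 / 6) (n.2 + 0) * latSign n.1 n.2) := by
  have hs := summable_stdTerm_mul τ one_ne_zero one_ne_zero (1 / 6) 0
    (χ := fun n => latSign n.1 n.2) fun n => norm_latSign _ _
  simp only [one_mul] at hs
  have h1 := (unfoldEquiv.hasSum_iff (f := fun n : ℤ × ℤ =>
    stdTerm τ (n.1 + 1 / 6) (n.2 + 0) * latSign n.1 n.2)).2 hs.hasSum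
  have h2 := (Equiv.prodComm coneDomain ℤ).hasSum_iff.2 h1
  refine h2.prod_fiberwise fun p => ?_
  have h3 := (hasSum_stdTerm_unitStep τ p).mul_right (latSign (p : ℤ × ℤ).1 (p : ℤ × ℤ).2)
  rw [coneTerm, mul_comm (latSign _ _)]
  refine (congrArg (HasSum · _) (funext fun k => ?_)).mpr h3
  simp only [Function.comp_apply, Equiv.prodComm_apply, Prod.swap, unfoldEquiv_apply,
    latSign_unitStep_zpow]

theorem stdTheta_uw_eq (τ : ℍ) : stdTheta (1 / 6) 0 (1 / 6) (1 / 4) τ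
    = zeta 12 * ((Real.sqrt τ.im : ℂ) * ∑' p : coneDomain, coneTerm τ p) := by
  rw [(hasSum_coneTerm τ).tsum_eq, stdTheta]
  simp_rw [e_pairing]
  rw [mul_left_comm, ← tsum_mul_left (a := zeta 12)]
  congr 1
  exact tsum_congr fun n => by ring

theorem hasSum_cohenT_fiber (n : ℤ) :
    HasSum (fun p : {p : coneDomain // latNorm (p : ℤ × ℤ).1 (p : ℤ × ℤ).2 = n} =>
      latSign (p : ℤ × ℤ).1 (p : ℤ × ℤ).2) (cohenT n) := by
  have hinj : Function.Injective
      fun p : {p : coneDomain // latNorm (p : ℤ × ℤ).1 (p : ℤ × ℤ).2 = n} => (p : ℤ × ℤ) :=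
    Subtype.val_injective.comp Subtype.val_injective
  have h := (hinj.hasSum_iff (f := fun p : ℤ × ℤ =>
    if (PosCone p.1 p.2 ∨ NegCone p.1 p.2) ∧ latNorm p.1 p.2 = n then latSign p.1 p.2 else 0)
    (a := cohenT n) fun p hp => if_neg fun h => hp ⟨⟨⟨p, h.1⟩, h.2⟩, rfl⟩).2 (hasSum_cohenT n)
  refine (congrArg (HasSum · _) (funext fun p => ?_)).mpr h
  simp only [Function.comp_apply]
  rw [if_pos ⟨p.1.2, p.2⟩]

theorem cohenT_zero : cohenT 0 = 0 := by
  rw [cohenT, if_neg (by norm_num)]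

theorem hasSum_phi₀Term (τ : ℍ) : HasSum (phi₀Term τ) (∑' p : coneDomain, coneTerm τ p) := by
  have h1 := (Equiv.sigmaFiberEquiv
    fun p : coneDomain => latNorm (p : ℤ × ℤ).1 (p : ℤ × ℤ).2).hasSum_iff.2
    (hasSum_coneTerm τ).summable.hasSum
  have h2 := h1.sigma (g := fun n : ℤ => cohenT n * (e ((n * τ.re / 24 : ℝ))
    * (besselK0 (2 * Real.pi * |(n : ℝ)| * τ.im / 24) : ℂ))) fun n => by
      refine (congrArg (HasSum · _) (funext fun p => ?_)).mpr
        ((hasSum_cohenT_fiber n).mul_right _)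
      simp only [Function.comp_apply, Equiv.sigmaFiberEquiv_apply, coneTerm, p.2]
  have h3 := (hasSum_subtype_iff_of_support_subset (s := {n : ℤ | n ≠ 0}) fun n hn h0 => hn (by
    simp only [h0, cohenT_zero, zero_mul])).2 h2
  refine (congrArg (HasSum · _) (funext fun n => ?_)).mpr h3
  simp only [phi₀Term, Function.comp_apply]
  push_cast
  ring

theorem summable_phi₀Term (τ : ℍ) : Summable (phi₀Term τ) := (hasSum_phi₀Term τ).summable

theorem stdTheta_uw_eq_phi₀ (τ : ℍ) :
    stdTheta (1 / 6) 0 (1 / 6) (1 / 4) τ = zeta 12 * phi₀ τ := by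
  rw [stdTheta_uw_eq, phi₀, (hasSum_phi₀Term τ).tsum_eq]

end ConeSum
end CohenMaass
end

noncomputable section
namespace CohenMaass
open Matrix UpperHalfPlane MeasureTheory
section CohenFunction

theorem phi₀Term_eq_besselWave (τ : ℍ) (n : {n : ℤ // n ≠ 0}) :
    phi₀Term τ n = besselWave (cohenT n) (2 * Real.pi * (n : ℤ) / 24) 0 τ := by
  rw [phi₀Term, besselWave, besselMoment_zero, e, abs_div, abs_mul,
    abs_of_pos (by positivity : 0 < 2 * Real.pi), abs_of_pos (by norm_num : (0 : ℝ) < 24),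
    UpperHalfPlane.coe_re, UpperHalfPlane.coe_im]
  congr 2
  · refine congrArg Complex.exp ?_
    push_cast
    ring
  · congr 1
    ring

theorem admissible_cohenT : Admissible (fun n : {n : ℤ // n ≠ 0} => cohenT n)
    fun n => 2 * Real.pi * (n : ℤ) / 24 := by
  have hpi := Real.pi_pos
  have hgap : ∀ n : {n : ℤ // n ≠ 0}, 2 * Real.pi / 24 ≤ |2 * Real.pi * (n : ℤ) / 24| := by
    intro n
    rw [abs_div, abs_mul, abs_of_pos (by positivity : 0 < 2 * Real.pi),
      abs_of_pos (by norm_num : (0 : ℝ) < 24)]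
    have : (1 : ℝ) ≤ |((n : ℤ) : ℝ)| := by exact_mod_cast Int.one_le_abs n.2
    exact div_le_div_of_nonneg_right (le_mul_of_one_le_right (by positivity) this) (by norm_num)
  refine ⟨fun c hc => ?_, 2 * Real.pi / 24, by positivity, hgap⟩
  have hy : 0 < c / Real.cosh 1 := div_pos hc (Real.cosh_pos 1)
  have hs := (summable_phi₀Term ⟨⟨0, c / Real.cosh 1⟩, hy⟩).norm
  refine Summable.of_nonneg_of_le (fun n => by positivity) (fun n => ?_) hs
  rw [phi₀Term_eq_besselWave, norm_besselWave]
  refine mul_le_mul_of_nonneg_left ?_ (norm_nonneg _)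
  rw [besselMoment_zero]
  have hl : 0 < |2 * Real.pi * ((n : ℤ) : ℝ) / 24| := lt_of_lt_of_le (by positivity) (hgap n)
  refine le_trans (le_of_eq ?_) (exp_le_besselK0 (mul_pos hl hy))
  have := (Real.cosh_pos 1).ne'
  congr 1
  field_simp

theorem phi₀_eq_besselSeries (τ : ℍ) : phi₀ τ = (Real.sqrt (τ : ℂ).im : ℂ) *
    besselSeries (fun n : {n : ℤ // n ≠ 0} => cohenT n) (fun n => 2 * Real.pi * (n : ℤ) / 24) 0 τ := by
  simp only [phi₀, phi₀Term_eq_besselWave, besselSeries, UpperHalfPlane.coe_im]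

theorem phi₀_ofComplex {z : ℂ} (hz : 0 < z.im) : phi₀ (ofComplex z) = (Real.sqrt z.im : ℂ) *
    besselSeries (fun n : {n : ℤ // n ≠ 0} => cohenT n) (fun n => 2 * Real.pi * (n : ℤ) / 24) 0 z := by
  rw [ofComplex_apply_of_im_pos hz, phi₀_eq_besselSeries]

theorem contDiffOn_phi₀ :
    ContDiffOn ℝ (⊤ : ℕ∞) (fun z : ℂ => phi₀ (ofComplex z)) {z : ℂ | 0 < z.im} := by
  refine ContDiffOn.congr ?_ fun z hz => phi₀_ofComplex hz
  refine ContDiffOn.mul ?_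
    (contDiffOn_infty.2 fun n => admissible_cohenT.contDiffOn_besselSeries n 0)
  exact Complex.ofRealCLM.contDiff.comp_contDiffOn
    (Complex.imCLM.contDiff.contDiffOn.sqrt fun z hz => ne_of_gt hz)

theorem laplacian_phi₀ (τ : ℍ) :
    -((τ.im : ℂ) ^ 2) * Laplacian.laplacian (fun z : ℂ => phi₀ (ofComplex z)) (τ : ℂ)
      = 1 / 4 * phi₀ τ := by
  have h1 : (fun z : ℂ => phi₀ (ofComplex z)) =ᶠ[nhds (τ : ℂ)] fun z => (Real.sqrt z.im : ℂ) *
      besselSeries (fun n : {n : ℤ // n ≠ 0} => cohenT n)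
        (fun n => 2 * Real.pi * (n : ℤ) / 24) 0 z := by
    filter_upwards [isOpen_upperHalf.mem_nhds τ.im_pos] with z hz using phi₀_ofComplex hz
  rw [(InnerProductSpace.laplacian_congr_nhds h1).eq_of_nhds, phi₀_eq_besselSeries]
  exact admissible_cohenT.laplacian_besselSeries τ.im_pos

theorem cohenT_one : cohenT 1 = 1 := by
  rw [cohenT, if_pos (by norm_num), if_pos (by norm_num)]
  simp [sigma, sigmaTerm]

/-- An absolutely convergent trigonometric series that vanishes identically has vanishing
coefficients. -/
theorem eq_zero_of_hasSum_e {ι : Type*} [Countable ι] {c : ι → ℂ} (hc : Summable fun i => ‖c i‖)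
    {l : ι → ℤ} (hl : Function.Injective l)
    (h : ∀ x : ℝ, HasSum (fun i => c i * e ((l i * x : ℝ))) 0) (i₀ : ι) : c i₀ = 0 := by
  have key := intervalIntegral.hasSum_integral_of_dominated_convergence (μ := volume)
    (a := 0) (b := 1) (F := fun i (x : ℝ) => c i * e ((l i * x : ℝ)) * e ((-(l i₀ * x) : ℝ)))
    (f := fun _ => 0) (fun i _ => ‖c i‖)
    (fun i => Continuous.aestronglyMeasurable (by unfold e; fun_prop))
    (fun i => Filter.Eventually.of_forall fun x _ => by
      rw [norm_mul, norm_mul, norm_e_ofReal, norm_e_ofReal, mul_one, mul_one])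
    (Filter.Eventually.of_forall fun x _ => hc) intervalIntegrable_const
    (Filter.Eventually.of_forall fun x _ => by
      simpa using (h x).mul_right (e ((-(l i₀ * x) : ℝ))))
  rw [intervalIntegral.integral_zero] at key
  have h2 : ∀ i, i ≠ i₀ →
      ∫ x : ℝ in (0 : ℝ)..1, c i * e ((l i * x : ℝ)) * e ((-(l i₀ * x) : ℝ)) = 0 := by
    intro i hi
    have hne : (2 * Real.pi * Complex.I * ((l i - l i₀ : ℤ) : ℂ)) ≠ 0 := by
      refine mul_ne_zero Complex.two_pi_I_ne_zero ?_
      exact_mod_cast sub_ne_zero.2 (hl.ne hi)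
    have h3 : ∀ x : ℝ, c i * e ((l i * x : ℝ)) * e ((-(l i₀ * x) : ℝ))
        = c i * Complex.exp (2 * Real.pi * Complex.I * ((l i - l i₀ : ℤ) : ℂ) * x) := fun x => by
      rw [mul_assoc, ← e_add, e]
      congr 2
      push_cast
      ring
    simp_rw [h3]
    rw [intervalIntegral.integral_const_mul, integral_exp_mul_complex hne]
    have h4 := e_intCast (l i - l i₀)
    rw [e] at h4
    rw [Complex.ofReal_one, mul_one, h4, Complex.ofReal_zero, mul_zero, Complex.exp_zero, sub_self,
      zero_div, mul_zero]
  have h5 := key.unique (hasSum_single i₀ h2)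
  have h6 : ∀ x : ℝ, c i₀ * e ((l i₀ * x : ℝ)) * e ((-(l i₀ * x) : ℝ)) = c i₀ := fun x => by
    rw [mul_assoc, ← e_add, Complex.ofReal_neg, add_neg_cancel, e_zero, mul_one]
  simp_rw [h6] at h5
  simpa using h5.symm

theorem exists_phi₀_ne_zero : ∃ τ, phi₀ τ ≠ 0 := by
  by_contra! h
  have hk := besselK0_pos (x := 2 * Real.pi * |((1 : ℤ) : ℝ)| * 1 / 24) (by
    have := Real.pi_pos; simp; positivity)
  have h1 := eq_zero_of_hasSum_e (ι := {n : ℤ // n ≠ 0}) (l := fun n => n)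
    (c := fun n => cohenT n * (besselK0 (2 * Real.pi * |((n : ℤ) : ℝ)| * 1 / 24) : ℂ))
    (by
      refine (summable_phi₀Term UpperHalfPlane.I).norm.congr fun n => ?_
      have := norm_e_ofReal ((n : ℤ) * UpperHalfPlane.I.re / 24)
      push_cast at this
      rw [phi₀Term, norm_mul, norm_mul, norm_mul, this, mul_one, UpperHalfPlane.I_im])
    Subtype.val_injective
    (fun x => by
      have h2 := (summable_phi₀Term ⟨⟨24 * x, 1⟩, one_pos⟩).hasSum
      have h3 := h ⟨⟨24 * x, 1⟩, one_pos⟩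
      rw [phi₀] at h3
      rw [(mul_eq_zero.1 h3).resolve_left (by simp [UpperHalfPlane.im])] at h2
      refine (congrArg (HasSum · _) (funext fun n => ?_)).mpr h2
      rw [phi₀Term, mul_right_comm]
      congr 2
      congr 1
      simp only [UpperHalfPlane.re]
      push_cast
      ring)
    ⟨1, one_ne_zero⟩
  rw [cohenT_one, one_mul] at h1
  exact hk.ne' (Complex.ofReal_eq_zero.1 h1)

end CohenFunction
end CohenMaass
end

noncomputable section
namespace CohenMaass
open Matrix UpperHalfPlane MeasureTheory
section Splitting

theorem quadForm_exA (ν : Fin 2 → ℝ) : quadForm exA ν = (3 * ν 0 ^ 2 - 2 * ν 1 ^ 2) / 2 := by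
  simp [quadForm, exA, dotProduct, Fin.sum_univ_two, Matrix.mulVec]
  ring

theorem bilForm_exA (ν μ : Fin 2 → ℝ) : bilForm exA ν μ = 3 * ν 0 * μ 0 - 2 * ν 1 * μ 1 := by
  simp [bilForm, exA, dotProduct, Fin.sum_univ_two, Matrix.mulVec]
  ring

theorem inv_eq_of_split {P : Matrix (Fin 2) (Fin 2) ℝ} (h : exA = Pᵀ * !![0, 1; 1, 0] * P) :
    P⁻¹ = !![P 1 0 / 3, P 0 0 / 3; -P 1 1 / 2, -P 0 1 / 2] := by
  refine Matrix.inv_eq_left_inv ?_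
  have h1 : !![P 1 0 / 3, P 0 0 / 3; -P 1 1 / 2, -P 0 1 / 2]
      = !![1 / 3, 0; 0, -(1 / 2)] * (Pᵀ * !![0, 1; 1, 0]) := by
    ext i j
    fin_cases i <;> fin_cases j <;> simp [Matrix.mul_apply, Fin.sum_univ_two] <;> ring
  rw [h1, Matrix.mul_assoc, ← h, exA]
  ext i j
  fin_cases i <;> fin_cases j <;> simp [Matrix.mul_apply, Fin.sum_univ_two]

theorem sqrt_two_thirds : Real.sqrt (2 / 3) = Real.sqrt 6 / 3 := by
  rw [show (2 / 3 : ℝ) = 6 / 3 ^ 2 by norm_num, Real.sqrt_div (by norm_num),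
    Real.sqrt_sq (by norm_num)]

/-- The pairing of `ν` with `c(t)` for the standard parametrization. -/
def pairC (ν : Fin 2 → ℝ) (t : ℝ) : ℝ := Real.sqrt 6 * ν 0 * Real.sinh t - 2 * ν 1 * Real.cosh t

/-- The pairing of `ν` with `c^⊥(t)` for the standard parametrization. -/
def pairPerp (ν : Fin 2 → ℝ) (t : ℝ) : ℝ :=
  Real.sqrt 6 * ν 0 * Real.cosh t - 2 * ν 1 * Real.sinh t

/-- Every splitting is the standard one, up to a translation of the parameter. -/
theorem IsSplitting.exists_shift {P : Matrix (Fin 2) (Fin 2) ℝ} {t₁ t₂ : ℝ}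
    (h : IsSplitting P t₁ t₂) : ∃ m, t₁ = m - halfLength ∧ t₂ = m + halfLength ∧
      (∀ ν t, bilForm exA ν (cvec P t) = pairC ν (t - m)) ∧
      ∀ ν t, bilForm exA ν (cperp P t) = pairPerp ν (t - m) := by
  have hinv := inv_eq_of_split h.split
  have hc : ∀ t, cvec P t = ![P 1 0 / 3 * Real.exp t - P 0 0 / 3 * Real.exp (-t),
      -P 1 1 / 2 * Real.exp t + P 0 1 / 2 * Real.exp (-t)] := fun t => by
    rw [cvec, hinv]
    ext i
    fin_cases i <;> simp [Matrix.mulVec, dotProduct, Fin.sum_univ_two] <;> ring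
  have hp : ∀ t, cperp P t = ![P 1 0 / 3 * Real.exp t + P 0 0 / 3 * Real.exp (-t),
      -P 1 1 / 2 * Real.exp t - P 0 1 / 2 * Real.exp (-t)] := fun t => by
    rw [cperp, hinv]
    ext i
    fin_cases i <;> simp [Matrix.mulVec, dotProduct, Fin.sum_univ_two] <;> ring
  have e00 := congrFun (congrFun h.split 0) 0
  have e01 := congrFun (congrFun h.split 0) 1
  have e11 := congrFun (congrFun h.split 1) 1
  simp [exA, Matrix.mul_apply, Fin.sum_univ_two] at e00 e01 e11
  have l0 := congrFun h.left 0
  have r0 := congrFun h.right 0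
  have l1 := congrFun h.left 1
  rw [hc] at l0 l1 r0
  simp [exc₁, exc₂] at l0 l1 r0
  generalize P 0 0 = p at *
  generalize P 0 1 = q at *
  generalize P 1 0 = r at *
  generalize P 1 1 = s at *
  have h3 : 0 < Real.sqrt 3 := Real.sqrt_pos.2 (by norm_num)
  have hE1 := Real.exp_pos t₁
  have hE1' := Real.exp_pos (-t₁)
  have hqs : q * s = -1 := by linarith
  have hpr : p * r = 3 / 2 := by linarith
  have hrp : r = p * s ^ 2 := by linear_combination r * hqs + s * e01
  have hs : s < 0 := by
    by_contra! hs
    have hq : q ≤ 0 := by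
      by_contra! hq
      nlinarith
    have : 0 < (Real.sqrt 3)⁻¹ * 3 := by positivity
    have a1 := mul_nonneg hs hE1.le
    have a2 := mul_nonneg (neg_nonneg.2 hq) hE1'.le
    linarith
  have hp0 : 0 < p := by
    by_contra! hp0
    have hr0 : r ≤ 0 := by rw [hrp]; exact mul_nonpos_of_nonpos_of_nonneg hp0 (sq_nonneg s)
    have a1 : Real.exp t₁ ≤ Real.exp t₂ := Real.exp_le_exp.2 h.lt.le
    have a2 : Real.exp (-t₂) ≤ Real.exp (-t₁) := Real.exp_le_exp.2 (by linarith [h.lt])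
    have a3 := mul_le_mul_of_nonpos_left a1 hr0
    have a4 := mul_le_mul_of_nonpos_left a2 hp0
    have : 0 < (Real.sqrt 3)⁻¹ * 2 := by positivity
    linarith
  have hsm : s = -Real.exp (-(-Real.log (-s))) := by
    rw [neg_neg, Real.exp_log (by linarith), neg_neg]
  generalize -Real.log (-s) = m at hsm
  have hem : Real.exp m * Real.exp (-m) = 1 := by rw [← Real.exp_add]; simp
  have hq : q = Real.exp m := by
    rw [hsm] at hqs
    linear_combination (-q) * hem - Real.exp m * hqs
  have hp1 : p = Real.sqrt 6 / 2 * Real.exp m := by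
    have hsq : p ^ 2 = (Real.sqrt 6 / 2 * Real.exp m) ^ 2 := by
      rw [hrp, hsm] at hpr
      have h6 := sq_sqrt_six
      linear_combination (Real.exp m ^ 2) * hpr
        - p ^ 2 * (Real.exp m * Real.exp (-m) + 1) * hem - Real.exp m ^ 2 / 4 * h6
    exact (pow_left_inj₀ hp0.le (by positivity) two_ne_zero).1 hsq
  have hr1 : r = Real.sqrt 6 / 2 * Real.exp (-m) := by
    rw [hrp, hsm, hp1]
    linear_combination (Real.sqrt 6 / 2 * Real.exp (-m)) * hem
  have hsinh : ∀ t, Real.sinh (t - m)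
      = (Real.exp (-m) * Real.exp t - Real.exp m * Real.exp (-t)) / 2 := fun t => by
    rw [Real.sinh_eq, ← Real.exp_add, ← Real.exp_add]; ring_nf
  have hcosh : ∀ t, Real.cosh (t - m)
      = (Real.exp (-m) * Real.exp t + Real.exp m * Real.exp (-t)) / 2 := fun t => by
    rw [Real.cosh_eq, ← Real.exp_add, ← Real.exp_add]; ring_nf
  have h33 : Real.sqrt 3 ^ 2 = 3 := Real.sq_sqrt (by norm_num)
  have h63 : Real.sqrt 6 * Real.sqrt 2 = 2 * Real.sqrt 3 := by
    rw [← Real.sqrt_mul (by norm_num), show (6 * 2 : ℝ) = 2 ^ 2 * 3 by norm_num,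
      Real.sqrt_mul (by norm_num), Real.sqrt_sq (by norm_num)]
  have h6p : 0 < Real.sqrt 6 := Real.sqrt_pos.2 (by norm_num)
  have hinv3 : (Real.sqrt 3)⁻¹ = Real.sqrt 3 / 3 := by
    field_simp; linarith
  refine ⟨m, ?_, ?_, fun ν t => ?_, fun ν t => ?_⟩
  · have : Real.sinh (t₁ - m) = Real.sinh (-halfLength) := by
      rw [Real.sinh_neg, sinh_halfLength, hsinh]
      rw [hr1, hp1, hinv3] at l0
      apply mul_left_cancel₀ h6p.ne'
      linear_combination 3 * l0 + h63
    have := Real.sinh_injective this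
    linarith
  · have : Real.sinh (t₂ - m) = Real.sinh halfLength := by
      rw [sinh_halfLength, hsinh]
      rw [hr1, hp1, hinv3] at r0
      apply mul_left_cancel₀ h6p.ne'
      linear_combination 3 * r0 - h63
    have := Real.sinh_injective this
    linarith
  · rw [bilForm_exA, hc, pairC, hsinh, hcosh, hr1, hp1, hq, hsm]
    simp
    ring
  · rw [bilForm_exA, hp, pairPerp, hsinh, hcosh, hr1, hp1, hq, hsm]
    simp
    ring

theorem exists_isSplitting : ∃ (P : Matrix (Fin 2) (Fin 2) ℝ) (t₁ t₂ : ℝ), IsSplitting P t₁ t₂ ∧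
    ∀ t : ℝ, cvec P t = ![Real.sqrt (2 / 3) * Real.sinh t, Real.cosh t] := by
  have hL := halfLength_pos
  have h6 := Real.mul_self_sqrt (by norm_num : (0 : ℝ) ≤ 6)
  have h3 : Real.sqrt 3 * Real.sqrt 3 = 3 := Real.mul_self_sqrt (by norm_num)
  have h3' : 0 < Real.sqrt 3 := Real.sqrt_pos.2 (by norm_num)
  have h63 : Real.sqrt 6 * Real.sqrt 2 = 2 * Real.sqrt 3 := by
    rw [← Real.sqrt_mul (by norm_num), show (6 * 2 : ℝ) = 2 ^ 2 * 3 by norm_num,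
      Real.sqrt_mul (by norm_num), Real.sqrt_sq (by norm_num)]
  set P : Matrix (Fin 2) (Fin 2) ℝ := !![Real.sqrt 6 / 2, 1; Real.sqrt 6 / 2, -1] with hP
  have hsplit : exA = Pᵀ * !![0, 1; 1, 0] * P := by
    ext i j
    fin_cases i <;> fin_cases j <;> simp [hP, exA, Matrix.mul_apply, Fin.sum_univ_two] <;> linarith
  have hc : ∀ t : ℝ, cvec P t = ![Real.sqrt (2 / 3) * Real.sinh t, Real.cosh t] := fun t => by
    rw [cvec, inv_eq_of_split hsplit, sqrt_two_thirds, Real.sinh_eq, Real.cosh_eq]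
    ext i
    fin_cases i <;> simp [hP, Matrix.mulVec, dotProduct, Fin.sum_univ_two] <;> ring
  have hinv3 : (Real.sqrt 3)⁻¹ = Real.sqrt 3 / 3 := by
    field_simp; linarith
  refine ⟨P, -halfLength, halfLength, ⟨hsplit, ?_, ?_, by linarith⟩, hc⟩
  · rw [hc, Real.sinh_neg, Real.cosh_neg, sinh_halfLength, cosh_halfLength, exc₁, sqrt_two_thirds]
    ext i
    fin_cases i
    · simp [hinv3]; linarith
    · simp [hinv3]
  · rw [hc, sinh_halfLength, cosh_halfLength, exc₂, sqrt_two_thirds]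
    ext i
    fin_cases i
    · simp [hinv3]; linarith
    · simp [hinv3]

end Splitting
end CohenMaass
end

noncomputable section
namespace CohenMaass
open Matrix UpperHalfPlane MeasureTheory
section Comparison

variable {P : Matrix (Fin 2) (Fin 2) ℝ} {t₁ t₂ : ℝ}

theorem IsSplitting.PhiHatTerm_eq (h : IsSplitting P t₁ t₂) (b : Fin 2 → ℝ) (τ : ℍ)
    (ν : Fin 2 → ℝ) : PhiHatTerm exA P t₁ t₂ b τ ν
      = stdTerm τ (ν 0) (ν 1) * e ((3 * b 0 * ν 0 - 2 * b 1 * ν 1 : ℝ)) := by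
  obtain ⟨m, rfl, rfl, hc, -⟩ := h.exists_shift
  simp only [PhiHatTerm, hc]
  rw [intervalIntegral.integral_comp_sub_right
    (fun t => Real.exp (-Real.pi * τ.im * pairC ν t ^ 2)), quadForm_exA, bilForm_exA, stdTerm]
  simp only [gaussKer]
  rw [intervalIntegral.integral_const_mul, intervalIntegral.integral_ofReal, mul_right_comm]
  congr 2
  · simp only [pairC, sub_sub_cancel_left, add_sub_cancel_left]
  · congr 1; ring

theorem IsSplitting.PhiHatTerm_latticePt (h : IsSplitting P t₁ t₂) (a b : Fin 2 → ℝ) (τ : ℍ)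
    (n : Fin 2 → ℤ) : PhiHatTerm exA P t₁ t₂ b τ (latticePt a n)
      = stdTerm τ ((finTwoArrowEquiv ℤ n).1 + a 0) ((finTwoArrowEquiv ℤ n).2 + a 1)
        * e ((3 * b 0 * ((finTwoArrowEquiv ℤ n).1 + a 0)
          - 2 * b 1 * ((finTwoArrowEquiv ℤ n).2 + a 1) : ℝ)) := by
  rw [h.PhiHatTerm_eq]
  simp only [latticePt, finTwoArrowEquiv_apply, add_comm (a _)]
  rfl

theorem IsSplitting.summable_PhiHatTerm (h : IsSplitting P t₁ t₂) (a b : Fin 2 → ℝ) (τ : ℍ) :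
    Summable fun n => PhiHatTerm exA P t₁ t₂ b τ (latticePt a n) := by
  have hs := summable_stdTerm_mul τ one_ne_zero one_ne_zero (a 0) (a 1)
    (χ := fun n => e ((3 * b 0 * (n.1 + a 0) - 2 * b 1 * (n.2 + a 1) : ℝ)))
    fun _ => norm_e_ofReal _
  simp only [one_mul] at hs
  exact ((finTwoArrowEquiv ℤ).summable_iff.2 hs).congr fun n => (h.PhiHatTerm_latticePt a b τ n).symm

theorem IsSplitting.PhiHat_eq (h : IsSplitting P t₁ t₂) (a b : Fin 2 → ℝ) :
    PhiHat exA P t₁ t₂ a b = stdTheta (a 0) (a 1) (b 0) (b 1) := by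
  funext τ
  rw [PhiHat, stdTheta]
  simp_rw [h.PhiHatTerm_latticePt]
  rw [(finTwoArrowEquiv ℤ).tsum_eq fun n : ℤ × ℤ => stdTerm τ (n.1 + a 0) (n.2 + a 1)
    * e ((3 * b 0 * (n.1 + a 0) - 2 * b 1 * (n.2 + a 1) : ℝ))]

/-- The three theta series for the standard parametrization. -/
def stdVec (τ : ℍ) : Fin 3 → ℂ :=
  ![stdTheta (1 / 6) 0 (1 / 6) (1 / 4) τ,
    (Real.sqrt 2 : ℂ) * stdTheta (1 / 6) (1 / 4) (1 / 6) 0 τ,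
    (Real.sqrt 2 : ℂ) * stdTheta (1 / 6) (1 / 4) (1 / 6) (1 / 4) τ]

theorem IsSplitting.PhiHatVec_eq (h : IsSplitting P t₁ t₂) : PhiHatVec P t₁ t₂ = stdVec := by
  funext τ
  simp only [PhiHatVec, h.PhiHat_eq, stdVec, vec₀, vec₁, Matrix.cons_val_zero, Matrix.cons_val_one]

theorem stdVec_vadd_one (τ : ℍ) : stdVec ((1 : ℝ) +ᵥ τ) = matT *ᵥ stdVec τ := by
  rw [matT_mulVec]
  simp only [stdVec, stdTheta_uw_T, stdTheta_wu_T, stdTheta_ww_T]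
  ext i
  fin_cases i <;> simp <;> ring

theorem stdVec_neg_one_div {τ τ' : ℍ} (h : (τ' : ℂ) = -1 / (τ : ℂ)) :
    stdVec τ' = matS *ᵥ stdVec τ := by
  have h' : (τ : ℂ) = -1 / (τ' : ℂ) := by
    rw [h]
    have := τ.ne_zero
    field_simp
  rw [matS_mulVec]
  simp only [stdVec, stdTheta_uw_S h, stdTheta_ww_S h, stdTheta_uw_S h']
  ext i
  fin_cases i <;> simp

theorem pairC_mul (ν : Fin 2 → ℝ) :
    pairC ν (-halfLength) * pairC ν halfLength = 12 * (ν 1 ^ 2 - ν 0 ^ 2) := by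
  have h2 : Real.sqrt 2 ^ 2 = 2 := Real.sq_sqrt (by norm_num)
  have h3 : Real.sqrt 3 ^ 2 = 3 := Real.sq_sqrt (by norm_num)
  rw [pairC, pairC, Real.sinh_neg, Real.cosh_neg, sinh_halfLength, cosh_halfLength]
  linear_combination 4 * ν 1 ^ 2 * h3 - Real.sqrt 6 ^ 2 * ν 0 ^ 2 * h2
    - 2 * ν 0 ^ 2 * sq_sqrt_six

theorem pairPerp_mul (ν : Fin 2 → ℝ) :
    pairPerp ν (-halfLength) * pairPerp ν halfLength = 2 * ((3 * ν 0) ^ 2 - (2 * ν 1) ^ 2) := by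
  have h2 : Real.sqrt 2 ^ 2 = 2 := Real.sq_sqrt (by norm_num)
  have h3 : Real.sqrt 3 ^ 2 = 3 := Real.sq_sqrt (by norm_num)
  rw [pairPerp, pairPerp, Real.sinh_neg, Real.cosh_neg, sinh_halfLength, cosh_halfLength]
  linear_combination -4 * ν 1 ^ 2 * h2 + Real.sqrt 6 ^ 2 * ν 0 ^ 2 * h3
    + 3 * ν 0 ^ 2 * sq_sqrt_six

theorem half_one_sub_sign_of_neg {x : ℝ} (hx : x < 0) : 1 / 2 * (1 - Real.sign x) = 1 := by
  rw [Real.sign_of_neg hx]; norm_num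

theorem half_one_sub_sign_of_pos {x : ℝ} (hx : 0 < x) : 1 / 2 * (1 - Real.sign x) = 0 := by
  rw [Real.sign_of_pos hx]; norm_num

theorem quadForm_latticePt_vec₀ (n : Fin 2 → ℤ) :
    quadForm exA (latticePt vec₀ n) = latNorm (n 0) (n 1) / 24 := by
  rw [quadForm_exA, latNorm]
  simp [latticePt, vec₀]
  ring

theorem e_bilForm_latticePt_vec₀ (n : Fin 2 → ℤ) :
    e (bilForm exA (latticePt vec₀ n) vec₁) = zeta 12 * latSign (n 0) (n 1) := by
  rw [← e_pairing, bilForm_exA]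
  refine congrArg e (congrArg _ ?_)
  simp [latticePt, vec₀, vec₁]
  ring

theorem IsSplitting.PhiTerm₁_eq (h : IsSplitting P t₁ t₂) (τ : ℍ) (n : Fin 2 → ℤ) :
    PhiTerm₁ exA P t₁ t₂ vec₁ τ (latticePt vec₀ n) = zeta 12 *
      {p : ℤ × ℤ | PosCone p.1 p.2}.indicator (coneTerm τ) (finTwoArrowEquiv ℤ n) := by
  obtain ⟨m, rfl, rfl, hc, -⟩ := h.exists_shift
  have hp : pairC (latticePt vec₀ n) (-halfLength) * pairC (latticePt vec₀ n) halfLength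
      = (((6 * n 1) ^ 2 - (6 * n 0 + 1) ^ 2 : ℤ) : ℝ) / 3 := by
    rw [pairC_mul]
    simp [latticePt, vec₀]
    ring
  rw [PhiTerm₁, hc, hc, sub_sub_cancel_left, add_sub_cancel_left, hp, quadForm_latticePt_vec₀,
    e_bilForm_latticePt_vec₀, show finTwoArrowEquiv ℤ n = (n 0, n 1) from rfl]
  by_cases hcone : PosCone (n 0) (n 1)
  · have h1 := latNorm_ge_of_posCone hcone
    have h2 : 0 ≤ latNorm (n 0) (n 1) := by nlinarith [sq_nonneg (6 * n 0 + 1)]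
    rw [Set.indicator_of_mem (by exact hcone), coneTerm, half_one_sub_sign_of_neg, ← Int.cast_abs,
      abs_of_nonneg h2]
    · push_cast
      rw [mul_div_right_comm (latNorm (n 0) (n 1) : ℂ)]
      ring_nf
    · rw [PosCone, ← sq_lt_sq, ← sub_neg] at hcone
      have : (((6 * n 1) ^ 2 - (6 * n 0 + 1) ^ 2 : ℤ) : ℝ) < 0 := by exact_mod_cast hcone
      linarith
  · rw [Set.indicator_of_notMem (by exact hcone), half_one_sub_sign_of_pos]
    · simp
    · have h1 : |6 * n 0 + 1| < |6 * n 1| := by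
        refine lt_of_le_of_ne (not_lt.1 hcone) fun h2 => ?_
        rcases abs_eq_abs.1 h2 with h3 | h3 <;> omega
      rw [← sq_lt_sq, ← sub_pos] at h1
      have : 0 < (((6 * n 1) ^ 2 - (6 * n 0 + 1) ^ 2 : ℤ) : ℝ) := by exact_mod_cast h1
      linarith

theorem IsSplitting.PhiTerm₂_eq (h : IsSplitting P t₁ t₂) (τ : ℍ) (n : Fin 2 → ℤ) :
    PhiTerm₂ exA P t₁ t₂ vec₁ τ (latticePt vec₀ n) = zeta 12 *
      {p : ℤ × ℤ | NegCone p.1 p.2}.indicator (coneTerm τ) (finTwoArrowEquiv ℤ n) := by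
  obtain ⟨m, rfl, rfl, -, hc⟩ := h.exists_shift
  have hp : pairPerp (latticePt vec₀ n) (-halfLength) * pairPerp (latticePt vec₀ n) halfLength
      = (((6 * n 0 + 1) ^ 2 - (4 * n 1) ^ 2 : ℤ) : ℝ) / 2 := by
    rw [pairPerp_mul]
    simp [latticePt, vec₀]
    ring
  rw [PhiTerm₂, hc, hc, sub_sub_cancel_left, add_sub_cancel_left, hp, quadForm_latticePt_vec₀,
    e_bilForm_latticePt_vec₀, show finTwoArrowEquiv ℤ n = (n 0, n 1) from rfl]
  have habs : 4 * |n 1| = |4 * n 1| := by rw [abs_mul, abs_of_pos (by norm_num : (0 : ℤ) < 4)]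
  by_cases hcone : NegCone (n 0) (n 1)
  · have h1 := latNorm_le_of_negCone hcone
    have h2 : latNorm (n 0) (n 1) ≤ 0 := by nlinarith [sq_nonneg (n 1)]
    rw [Set.indicator_of_mem (by exact hcone), coneTerm, half_one_sub_sign_of_neg, ← Int.cast_abs,
      abs_of_nonpos h2]
    · push_cast
      rw [mul_div_right_comm (latNorm (n 0) (n 1) : ℂ)]
      ring_nf
    · rw [NegCone, habs, ← sq_lt_sq, ← sub_neg] at hcone
      have : (((6 * n 0 + 1) ^ 2 - (4 * n 1) ^ 2 : ℤ) : ℝ) < 0 := by exact_mod_cast hcone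
      linarith
  · rw [Set.indicator_of_notMem (by exact hcone), half_one_sub_sign_of_pos]
    · simp
    · have h1 : |4 * n 1| < |6 * n 0 + 1| := by
        rw [NegCone, habs, not_lt] at hcone
        refine lt_of_le_of_ne hcone fun h2 => ?_
        rcases abs_eq_abs.1 h2 with h3 | h3 <;> omega
      rw [← sq_lt_sq, ← sub_pos] at h1
      have : 0 < (((6 * n 0 + 1) ^ 2 - (4 * n 1) ^ 2 : ℤ) : ℝ) := by exact_mod_cast h1
      linarith

theorem summable_coneTerm_indicator (τ : ℍ) {s : Set (ℤ × ℤ)} (hs : s ⊆ coneDomain) :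
    Summable (s.indicator (coneTerm τ)) := by
  have h0 : Summable (coneTerm τ ∘ ((↑) : coneDomain → ℤ × ℤ)) := (hasSum_coneTerm τ).summable
  have h := (summable_subtype_iff_indicator.1 h0).indicator s
  rwa [Set.indicator_indicator, Set.inter_eq_left.2 hs] at h

theorem posCone_subset : {p : ℤ × ℤ | PosCone p.1 p.2} ⊆ coneDomain := fun _ h => Or.inl h

theorem negCone_subset : {p : ℤ × ℤ | NegCone p.1 p.2} ⊆ coneDomain := fun _ h => Or.inr h

theorem IsSplitting.summable_PhiTerm₁ (h : IsSplitting P t₁ t₂) (τ : ℍ) :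
    Summable fun n => PhiTerm₁ exA P t₁ t₂ vec₁ τ (latticePt vec₀ n) := by
  simp_rw [h.PhiTerm₁_eq]
  exact ((finTwoArrowEquiv ℤ).summable_iff.2
    (summable_coneTerm_indicator τ posCone_subset)).mul_left _

theorem IsSplitting.summable_PhiTerm₂ (h : IsSplitting P t₁ t₂) (τ : ℍ) :
    Summable fun n => PhiTerm₂ exA P t₁ t₂ vec₁ τ (latticePt vec₀ n) := by
  simp_rw [h.PhiTerm₂_eq]
  exact ((finTwoArrowEquiv ℤ).summable_iff.2
    (summable_coneTerm_indicator τ negCone_subset)).mul_left _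

theorem IsSplitting.Phi_eq (h : IsSplitting P t₁ t₂) (τ : ℍ) :
    Phi exA P t₁ t₂ vec₀ vec₁ τ = zeta 12 * phi₀ τ := by
  have hdisj : Disjoint {p : ℤ × ℤ | PosCone p.1 p.2} {p : ℤ × ℤ | NegCone p.1 p.2} := by
    rw [Set.disjoint_left]
    intro p h1 h2
    have h3 := latNorm_ge_of_posCone h1
    have h4 := latNorm_le_of_negCone h2
    exact latNorm_ne_zero p.1 p.2 (by nlinarith [sq_nonneg (6 * p.1 + 1), sq_nonneg p.2])
  have hsum : ∑' p : coneDomain, coneTerm τ p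
      = (∑' p, {p : ℤ × ℤ | PosCone p.1 p.2}.indicator (coneTerm τ) p)
        + ∑' p, {p : ℤ × ℤ | NegCone p.1 p.2}.indicator (coneTerm τ) p := by
    rw [← (summable_coneTerm_indicator τ posCone_subset).tsum_add
      (summable_coneTerm_indicator τ negCone_subset), tsum_subtype,
      show coneDomain = {p : ℤ × ℤ | PosCone p.1 p.2} ∪ {p : ℤ × ℤ | NegCone p.1 p.2} from rfl,
      Set.indicator_union_of_disjoint hdisj]
  rw [Phi, phi₀, (hasSum_phi₀Term τ).tsum_eq, hsum, Real.sign_of_pos (sub_pos.2 h.lt)]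
  simp_rw [h.PhiTerm₁_eq, h.PhiTerm₂_eq]
  rw [tsum_mul_left, tsum_mul_left, (finTwoArrowEquiv ℤ).tsum_eq, (finTwoArrowEquiv ℤ).tsum_eq]
  push_cast
  ring

theorem stdVec_T (τ : ℍ) : stdVec (ModularGroup.T • τ) = matT *ᵥ stdVec τ := by
  rw [UpperHalfPlane.modular_T_smul, stdVec_vadd_one]

theorem stdVec_S (τ : ℍ) : stdVec (ModularGroup.S • τ) = matS *ᵥ stdVec τ := by
  refine stdVec_neg_one_div ?_
  rw [UpperHalfPlane.modular_S_smul]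
  simp [neg_div, inv_neg]

theorem stdVec_zero (τ : ℍ) : stdVec τ 0 = zeta 12 * phi₀ τ := stdTheta_uw_eq_phi₀ τ

theorem exists_stdVec_zero_ne_zero : ∃ τ, stdVec τ 0 ≠ 0 := by
  obtain ⟨τ, hτ⟩ := exists_phi₀_ne_zero
  exact ⟨τ, by rw [stdVec_zero]; exact mul_ne_zero (zeta_ne_zero 12) hτ⟩

theorem stdTheta_isBigO (a₁ a₂ b₁ b₂ : ℝ) :
    stdTheta a₁ a₂ b₁ b₂ =O[atImInfty] fun τ : ℍ => τ.im ^ 1 := by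
  obtain ⟨K, hK⟩ := exists_norm_stdTheta_le a₁ a₂ b₁ b₂
  refine Asymptotics.IsBigO.of_bound |K| ((atImInfty_mem _).2 ⟨1, fun τ hτ => ?_⟩)
  refine (hK τ hτ).trans ?_
  rw [pow_one, Real.norm_of_nonneg τ.im_pos.le]
  exact mul_le_mul (le_abs_self K) ((Real.sqrt_le_left τ.im_pos.le).2 (by nlinarith))
    (Real.sqrt_nonneg _) (abs_nonneg K)

theorem stdVec_isBigO (i : Fin 3) : (fun τ => stdVec τ i) =O[atImInfty] fun τ : ℍ => τ.im ^ 1 := by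
  fin_cases i
  · exact stdTheta_isBigO _ _ _ _
  · exact (stdTheta_isBigO _ _ _ _).const_mul_left _
  · exact (stdTheta_isBigO _ _ _ _).const_mul_left _

theorem phi₀_isBigO {ρ : Matrix.SpecialLinearGroup (Fin 2) ℤ →* Matrix (Fin 3) (Fin 3) ℂ}
    (hρ : ∀ γ τ, stdVec (γ • τ) = ρ γ *ᵥ stdVec τ) (γ : Matrix.SpecialLinearGroup (Fin 2) ℤ) :
    (fun τ : ℍ => phi₀ (γ • τ)) =O[atImInfty] fun τ : ℍ => τ.im ^ 1 := by
  have h : (fun τ : ℍ => phi₀ (γ • τ))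
      = fun τ => (zeta 12)⁻¹ * ∑ i, ρ γ 0 i * stdVec τ i := by
    funext τ
    have h1 := stdVec_zero (γ • τ)
    rw [hρ] at h1
    rw [eq_inv_mul_iff_mul_eq₀ (zeta_ne_zero 12), ← h1]
    rfl
  rw [h]
  exact (Asymptotics.IsBigO.fun_sum fun i _ => (stdVec_isBigO i).const_mul_left _).const_mul_left _

end Comparison
end CohenMaass
end

open CohenMaass UpperHalfPlane Matrix
open scoped MatrixGroups

theorem mainTheorem5 :
    -- one can take `c(t) = (√(2/3) sinh t, cosh t)`
    (∃ (P : Matrix (Fin 2) (Fin 2) ℝ) (t₁ t₂ : ℝ), IsSplitting P t₁ t₂ ∧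
      ∀ t : ℝ, cvec P t = ![Real.sqrt (2 / 3) * Real.sinh t, Real.cosh t]) ∧
    -- the multiplier system `v` exists and is uniquely determined by its two values
    ∃ v : CongruenceSubgroup.Gamma0 2 →* ℂˣ,
      ((v genT : ℂ) = zeta 24 ∧ (v genU : ℂ) = zeta 24) ∧
      (∀ w : CongruenceSubgroup.Gamma0 2 →* ℂˣ,
        (w genT : ℂ) = zeta 24 → (w genU : ℂ) = zeta 24 → w = v) ∧
      (∀ γ, ‖(v γ : ℂ)‖ = 1) ∧
      -- `φ₀` is a Maass waveform on `Γ₀(2)`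
      (∀ τ : ℍ, Summable (phi₀Term τ)) ∧
      IsMaassForm (CongruenceSubgroup.Gamma0 2) v (1 / 4) phi₀ ∧
      ∃ ρ : SL(2, ℤ) →* Matrix (Fin 3) (Fin 3) ℂ,
        ρ ModularGroup.T = matT ∧ ρ ModularGroup.S = matS ∧
        ∀ (P : Matrix (Fin 2) (Fin 2) ℝ) (t₁ t₂ : ℝ), IsSplitting P t₁ t₂ →
          -- all the series involved converge absolutely
          (∀ τ : ℍ,
            Summable (fun n => PhiHatTerm exA P t₁ t₂ vec₁ τ (latticePt vec₀ n)) ∧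
            Summable (fun n => PhiHatTerm exA P t₁ t₂ vec₀ τ (latticePt vec₁ n)) ∧
            Summable (fun n => PhiHatTerm exA P t₁ t₂ vec₁ τ (latticePt vec₁ n)) ∧
            Summable (fun n => PhiTerm₁ exA P t₁ t₂ vec₁ τ (latticePt vec₀ n)) ∧
            Summable (fun n => PhiTerm₂ exA P t₁ t₂ vec₁ τ (latticePt vec₀ n))) ∧
          -- the vector-valued transformation law under `τ ↦ τ + 1` and `τ ↦ -1/τ`
          (∀ τ : ℍ, PhiHatVec P t₁ t₂ ((1 : ℝ) +ᵥ τ) = matT *ᵥ PhiHatVec P t₁ t₂ τ) ∧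
          (∀ τ τ' : ℍ, (τ' : ℂ) = -1 / (τ : ℂ) →
            PhiHatVec P t₁ t₂ τ' = matS *ᵥ PhiHatVec P t₁ t₂ τ) ∧
          -- hence under the full modular group
          (∀ (γ : SL(2, ℤ)) (τ : ℍ),
            PhiHatVec P t₁ t₂ (γ • τ) = ρ γ *ᵥ PhiHatVec P t₁ t₂ τ) ∧
          -- the transformation law of the first component on `Γ₀(2)`
          (∀ (γ : CongruenceSubgroup.Gamma0 2) (τ : ℍ),
            PhiHat exA P t₁ t₂ vec₀ vec₁ ((γ : SL(2, ℤ)) • τ)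
              = (v γ : ℂ) * PhiHat exA P t₁ t₂ vec₀ vec₁ τ) ∧
          -- `Φ̂ = Φ = ζ₁₂ φ₀`
          (∀ τ : ℍ, PhiHat exA P t₁ t₂ vec₀ vec₁ τ = Phi exA P t₁ t₂ vec₀ vec₁ τ) ∧
          (∀ τ : ℍ, Phi exA P t₁ t₂ vec₀ vec₁ τ = zeta 12 * phi₀ τ) := by
  obtain ⟨ρ, hρT, hρS, hρ⟩ := exists_representation stdVec_T stdVec_S exists_stdVec_zero_ne_zero
  obtain ⟨v, hvT, hvU, hv⟩ := exists_character (f := fun τ => stdVec τ 0) (z := zeta 24)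
    exists_stdVec_zero_ne_zero (zeta_ne_zero 24)
    (fun τ => by
      have h := congrFun (stdVec_T τ) 0
      rw [matT_mulVec] at h
      exact h)
    (vec_genU stdVec_T stdVec_S)
  have hphi : ∀ (γ : CongruenceSubgroup.Gamma0 2) (τ : ℍ),
      phi₀ ((γ : SL(2, ℤ)) • τ) = (v γ : ℂ) * phi₀ τ := fun γ τ => by
    have h := hv γ τ
    rw [stdVec_zero, stdVec_zero, mul_left_comm] at h
    exact mul_left_cancel₀ (zeta_ne_zero 12) h
  refine ⟨exists_isSplitting, v, ⟨hvT, hvU⟩, fun w hwT hwU => ?_, ?_, summable_phi₀Term, ?_,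
    ρ, hρT, hρS, ?_⟩
  · exact character_unique (hwT.trans hvT.symm) (hwU.trans hvU.symm)
  · exact character_norm (by rw [hvT, norm_zeta]) (by rw [hvU, norm_zeta])
  · exact ⟨contDiffOn_phi₀, laplacian_phi₀, hphi, fun γ => ⟨1, phi₀_isBigO hρ γ⟩⟩
  · intro P t₁ t₂ h
    have h0 : PhiHat exA P t₁ t₂ vec₀ vec₁ = fun τ => stdVec τ 0 := h.PhiHat_eq vec₀ vec₁
    refine ⟨fun τ => ⟨h.summable_PhiHatTerm _ _ τ, h.summable_PhiHatTerm _ _ τ,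
      h.summable_PhiHatTerm _ _ τ, h.summable_PhiTerm₁ τ, h.summable_PhiTerm₂ τ⟩, ?_, ?_, ?_, ?_,
      fun τ => ?_, h.Phi_eq⟩
    · rw [h.PhiHatVec_eq]
      exact stdVec_vadd_one
    · rw [h.PhiHatVec_eq]
      exact fun τ τ' => stdVec_neg_one_div
    · rw [h.PhiHatVec_eq]
      exact hρ
    · rw [h0]
      exact hv
    · rw [h0, h.Phi_eq]
      exact stdVec_zero τ
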